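/- **Morawetz estimate for the tensorial Fackerell–Ipser equation on Schwarzschild.** Let $M>0$ and let $\mathcal S_e=\mathbb R_t\times(2M,\infty)_r\times\mathbb S^2$ be the Schwarzschild exterior with metric $$g=-(1-\mu)\,dt^2+(1-\mu)^{-1}dr^2+r^2g_{\mathbb S^2},\qquad \mu=\frac{2M}{r}.$$ Let $r_*=r+2M\log(r-2M)-3M-2M\log M$, $u=t-r_*$, $v=t+r_*$, $L=\partial_t+\partial_{r_*}$, $\underline L=\partial_t-\partial_{r_*}$. Let $\mathcal B\subset T\mathcal S_e$ be the bundle of vectors tangent to the spheres of constant $(t,r)$, let $(\cdot)^\perp$ be the orthogonal projection onto $\mathcal B$ and $\nabla$ the Levi-Civita connection of $g$. For a vector field $X$ and a section $W$ of $\mathcal B$ put $D_XW=(\nabla_XW)^\perp$, and extend $D_X$ to tensors on $\mathcal B$ by the Leibniz rule. For a section $\phi$ of $\mathcal B^*$ let $D\phi$ be the section $(X,Y)\mapsto (D_X\phi)(Y)$ of $\mathcal B^*\otimes\mathcal B^*$, and let $\Delta\phi_C=\gamma^{AB}D_AD_B\phi_C$ be the covariant Laplacian, where $\gamma$ is the induced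 metric on the spheres. With $\Omega_1,\Omega_2,\Omega_3$ the rotation vector fields about the coordinate axes, let $$|\eta|=\sum_{a}|\eta(\Omega_a/r)|\quad(\eta\in\mathcal B^*),\qquad |\eta|=\sum_{a,b}|\eta(\Omega_a/r,\Omega_b/r)|\quad(\eta\in\mathcal B^*\otimes\mathcal B^*).$$ With $V=(1-\mu)/r^2$ and $d\mathbb S^2$ the standard measure of the unit sphere, define the null fluxes $$\mathcal F^T_u[\phi](v_1,v_2)=\int_{v_1}^{v_2}\!\int_{\mathbb S^2}\big[|D_L\phi|^2+(1-\mu)|D\phi|^2+V|\phi|^2\big](u,v,\omega)\,d\mathbb S^2(\omega)\,dv,$$ $$\mathcal F^T_v[\phi](u_1,u_2)=\int_{u_1}^{u_2}\!\int_{\mathbb S^2}\big[|D_{\underline L}\phi|^2+(1-\mu)|D\phi|^2+V|\phi|^2\big](u,v,\omega)\,d\mathbb S^2(\omega)\,du.$$ Then for every $M>0$ there is a constant $C>0$, depending only on $M$, such that the following holds. Let $u_0,v_0\in\mathbb R$ and let $\phi$ be a section of $\mathcal B^*$ that is smooth on an open neighbourhood in $\mathcal S_e$ of $\{u\ge u_0\}\cap\{v\ge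 v_0\}$ and satisfies on this set the Fackerell–Ipser equation $$D_{\underline L}D_L\phi-(1-\mu)\Delta\phi+\frac{1-\mu}{r^2}\phi=0 .$$ Then for all real $u_2\ge u_1\ge u_0$ and $v_2\ge v_1\ge v_0$, $$\int_{u_1}^{u_2}\!\int_{v_1}^{v_2}\!\int_{\mathbb S^2}\Big\{\frac1{r^2}|D_L\phi-D_{\underline L}\phi|^2+\frac{(r-3M)^2}{r^3}\Big(|D\phi|^2+\frac1r|D_L\phi+D_{\underline L}\phi|^2\Big)+\frac1{r^3}|\phi|^2\Big\}(1-\mu)\,d\mathbb S^2\,dv\,du$$ $$\le C\big(\mathcal F^T_{v_1}[\phi](u_1,u_2)+\mathcal F^T_{u_1}[\phi](v_1,v_2)\big).$$ -/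

import Mathlib

namespace FackerellIpser

noncomputable section

/-! ### The Schwarzschild exterior

The exterior `ℝ × (2M, ∞) × 𝕊²` is described in the global chart `(t, r, ω) ↦ (t, r ω)`, which is a
diffeomorphism onto the open subset `{2M < |x|}` of `ℝ × ℝ³`.  All tensors are given by their
components in this chart (index `0` is `t`, indices `1, 2, 3` are `x`). -/

/-- Points of the chart, `(t, x)` with `x = r ω`. -/
abbrev Pt : Type := Fin 4 → ℝ

/-- The area radius `r = |x|`. -/
def rad (p : Pt) : ℝ := √(p 1 ^ 2 + p 2 ^ 2 + p 3 ^ 2)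

/-- `μ = 2M / r`. -/
def mu (M : ℝ) (p : Pt) : ℝ := 2 * M / rad p

/-- The open Schwarzschild exterior. -/
def exterior (M : ℝ) : Set Pt := {p | 2 * M < rad p}

/-- Components of the one-form `dt`; they are also the components of the vector field `∂_t`. -/
def dt : Fin 4 → ℝ := ![1, 0, 0, 0]

/-- Components of the one-form `dr`; they are also the components of the vector field `∂_r` of the
coordinates `(t, r, ω)`. -/
def dr (p : Pt) : Fin 4 → ℝ := ![0, p 1 / rad p, p 2 / rad p, p 3 / rad p]

/-- The tensor `r² g_{𝕊²} = |dx|² - dr²`, that is, the induced metric on the spheres of constant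
`t, r`.  In this chart the same matrix is the `g`-orthogonal projection `(·)^⊥` of tangent vectors
onto the tangent spaces of these spheres (it kills `∂_t` and `∂_r`). -/
def sph (p : Pt) (i j : Fin 4) : ℝ :=
  (if i = j then 1 else 0) - dt i * dt j - dr p i * dr p j

/-- The Schwarzschild metric `-(1-μ) dt² + (1-μ)⁻¹ dr² + r² g_{𝕊²}`. -/
def metric (M : ℝ) (p : Pt) : Matrix (Fin 4) (Fin 4) ℝ :=
  Matrix.of fun i j =>
    -(1 - mu M p) * dt i * dt j + (1 - mu M p)⁻¹ * dr p i * dr p j + sph p i j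

/-- Partial derivative in the `i`-th coordinate. -/
def pd (i : Fin 4) (f : Pt → ℝ) (p : Pt) : ℝ := fderiv ℝ f p (Pi.single i 1)

/-- Christoffel symbols `Γ^k_{ij}` of the Levi-Civita connection of the Schwarzschild metric. -/
def christoffel (M : ℝ) (p : Pt) (k i j : Fin 4) : ℝ :=
  (1 / 2) * ∑ l, (metric M p)⁻¹ k l *
    (pd i (fun q => metric M q j l) p + pd j (fun q => metric M q i l) p
      - pd l (fun q => metric M q i j) p)

/-! ### Covariant derivatives -/

/-- A field of covectors, by components. -/
abbrev OneForm : Type := Pt → Fin 4 → ℝ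

/-- A field of covariant 2-tensors, by components. -/
abbrev TwoTensor : Type := Pt → Fin 4 → Fin 4 → ℝ

/-- `∇_i φ_j` for the Levi-Civita connection. -/
def nablaOne (M : ℝ) (φ : OneForm) (p : Pt) (i j : Fin 4) : ℝ :=
  pd i (fun q => φ q j) p - ∑ k, christoffel M p k i j * φ p k

/-- `∇_i T_{jk}` for the Levi-Civita connection. -/
def nablaTwo (M : ℝ) (T : TwoTensor) (p : Pt) (i j k : Fin 4) : ℝ :=
  pd i (fun q => T q j k) p - ∑ l, christoffel M p l i j * T p l k
    - ∑ l, christoffel M p l i k * T p j l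

/-- The null vector field `L = ∂_t + ∂_{r_*}`, where `∂_{r_*} = (1-μ) ∂_r`. -/
def L (M : ℝ) (p : Pt) (i : Fin 4) : ℝ := dt i + (1 - mu M p) * dr p i

/-- The null vector field `L̲ = ∂_t - ∂_{r_*}`. -/
def Lbar (M : ℝ) (p : Pt) (i : Fin 4) : ℝ := dt i - (1 - mu M p) * dr p i

/-- The projected derivative `∇̸_X φ` of a one-form `φ` tangent to the spheres: for `W` tangent to
the spheres, `(∇̸_X φ)(W) = X(φ(W)) - φ((∇_X W)^⊥) = (∇_X φ)(W)`, and `∇̸_X φ` vanishes on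
normal vectors. -/
def slashAlong (M : ℝ) (X : Pt → Fin 4 → ℝ) (φ : OneForm) : OneForm := fun p j =>
  ∑ b, sph p j b * ∑ a, X p a * nablaOne M φ p a b

/-- The angular derivative `∇̸φ`, `(∇̸φ)(X, Y) = (∇̸_X φ)(Y)` for `X, Y` tangent to the spheres,
extended by zero on normal vectors. -/
def slashGrad (M : ℝ) (φ : OneForm) : TwoTensor := fun p i j =>
  ∑ a, ∑ b, sph p i a * sph p j b * nablaOne M φ p a b

/-- The second angular derivative `∇̸∇̸φ`, the projection of `∇(∇̸φ)` to the spheres. -/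
def slashHess (M : ℝ) (φ : OneForm) (p : Pt) (i j k : Fin 4) : ℝ :=
  ∑ a, ∑ b, ∑ c, sph p i a * sph p j b * sph p k c * nablaTwo M (slashGrad M φ) p a b c

/-- The covariant Laplacian `Δ̸φ_C = g̸^{AB} ∇̸_A ∇̸_B φ_C` on the spheres. -/
def slashLaplacian (M : ℝ) (φ : OneForm) : OneForm := fun p k =>
  ∑ i, ∑ j, (metric M p)⁻¹ i j * slashHess M φ p i j k

/-- `φ` is a smooth section, over the set `W`, of the bundle of one-forms tangent to the spheres of
constant `t, r` (covectors that vanish on `L` and `L̲`). -/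
structure IsSmoothSphereForm (M : ℝ) (φ : OneForm) (W : Set Pt) : Prop where
  smooth : ContDiffOn ℝ ((⊤ : ℕ∞) : WithTop ℕ∞) φ W
  apply_L : ∀ p ∈ W, ∑ i, φ p i * L M p i = 0
  apply_Lbar : ∀ p ∈ W, ∑ i, φ p i * Lbar M p i = 0

/-- The tensorial Fackerell--Ipser equation
`∇̸_{L̲} ∇̸_L φ - (1-μ) Δ̸φ + (1-μ)/r² φ = 0` at the point `p`. -/
def FackerellIpserAt (M : ℝ) (φ : OneForm) (p : Pt) : Prop :=
  ∀ k : Fin 4, slashAlong M (Lbar M) (slashAlong M (L M) φ) p k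
    - (1 - mu M p) * slashLaplacian M φ p k + (1 - mu M p) / rad p ^ 2 * φ p k = 0

/-! ### Pointwise norms -/

/-- The rotation vector fields `Ω_1, Ω_2, Ω_3` about the coordinate axes. -/
def rot (a : Fin 3) (p : Pt) : Fin 4 → ℝ :=
  (![![0, 0, -p 3, p 2], ![0, p 3, 0, -p 1], ![0, -p 2, p 1, 0]] : Fin 3 → Fin 4 → ℝ) a

/-- The angular norm `|η| = ∑_a |η(Ω_a / r)|` of a one-form tangent to the spheres. -/
def normOne (p : Pt) (η : Fin 4 → ℝ) : ℝ :=
  ∑ a, |∑ i, η i * (rot a p i / rad p)|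

/-- The angular norm `|η| = ∑_{a,b} |η(Ω_a / r, Ω_b / r)|` of a 2-tensor tangent to the spheres. -/
def normTwo (p : Pt) (η : Fin 4 → Fin 4 → ℝ) : ℝ :=
  ∑ a, ∑ b, |∑ i, ∑ j, η i j * (rot a p i / rad p) * (rot b p j / rad p)|

/-! ### Double null coordinates -/

/-- `r_* = r + 2M log(r - 2M) - 3M - 2M log M`. -/
def rStar (M r : ℝ) : ℝ := r + 2 * M * Real.log (r - 2 * M) - 3 * M - 2 * M * Real.log M

/-- `r ↦ r_*` is a bijection from `(2M, ∞)` onto `ℝ`, so that `rOf` below is its inverse. -/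
theorem rStar_bijOn {M : ℝ} (hM : 0 < M) :
    Set.BijOn (rStar M) (Set.Ioi (2 * M)) Set.univ := by
  have hmono : StrictMonoOn (rStar M) (Set.Ioi (2 * M)) := by
    intro a ha b hb hab
    simp only [Set.mem_Ioi] at ha hb
    have h := Real.log_lt_log (by linarith : 0 < a - 2 * M) (by linarith : a - 2 * M < b - 2 * M)
    have h2 : 2 * M * Real.log (a - 2 * M) < 2 * M * Real.log (b - 2 * M) :=
      mul_lt_mul_of_pos_left h (by linarith)
    unfold rStar
    linarith
  refine ⟨fun _ _ => Set.mem_univ _, hmono.injOn, ?_⟩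
  intro s _
  have hcont : ContinuousOn (rStar M) (Set.Ioi (2 * M)) := by
    unfold rStar
    refine ((continuousOn_id.add (continuousOn_const.mul (ContinuousOn.log ?_ ?_))).sub
      continuousOn_const).sub continuousOn_const
    · fun_prop
    · intro x hx
      simp only [Set.mem_Ioi] at hx
      linarith
  obtain ⟨A, hA⟩ : ∃ A : ℝ, A = |s + M + 2 * M * Real.log M| + |s + 3 * M + 2 * M * Real.log M| :=
    ⟨_, rfl⟩
  have h1 := le_abs_self (s + 3 * M + 2 * M * Real.log M)
  have h2 := neg_abs_le (s + M + 2 * M * Real.log M)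
  have h3 := abs_nonneg (s + 3 * M + 2 * M * Real.log M)
  have h4 := abs_nonneg (s + M + 2 * M * Real.log M)
  -- A point where `r_*` is at most `s`.
  have hlow : ∃ a ∈ Set.Ioi (2 * M), rStar M a ≤ s := by
    refine ⟨2 * M + Real.exp (-(A + 1) / (2 * M)), ?_, ?_⟩
    · simp only [Set.mem_Ioi]
      linarith [Real.exp_pos (-(A + 1) / (2 * M))]
    · have hle : Real.exp (-(A + 1) / (2 * M)) ≤ 1 :=
        Real.exp_le_one_iff.2 (div_nonpos_of_nonpos_of_nonneg (by linarith) (by linarith))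
      have hmul : 2 * M * (-(A + 1) / (2 * M)) = -(A + 1) := by
        field_simp
      unfold rStar
      rw [add_sub_cancel_left, Real.log_exp, hmul]
      linarith
  -- A point where `r_*` is at least `s`.
  have hhigh : ∃ b ∈ Set.Ioi (2 * M), s ≤ rStar M b := by
    refine ⟨2 * M + 1 + A, ?_, ?_⟩
    · simp only [Set.mem_Ioi]
      linarith
    · have hlog : 0 ≤ Real.log (2 * M + 1 + A - 2 * M) := Real.log_nonneg (by linarith)
      have := mul_nonneg (by linarith : 0 ≤ 2 * M) hlog
      unfold rStar
      linarith
  obtain ⟨a, ha, has⟩ := hlow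
  obtain ⟨b, hb, hbs⟩ := hhigh
  obtain ⟨x, hx, hxs⟩ := isPreconnected_Ioi.intermediate_value ha hb hcont ⟨has, hbs⟩
  exact ⟨x, hx, hxs⟩

/-- The radius `r > 2M` with `r_* = s`. -/
def rOf (M s : ℝ) : ℝ := Function.invFunOn (rStar M) (Set.Ioi (2 * M)) s

/-- The retarded time `u = t - r_*`. -/
def uCoord (M : ℝ) (p : Pt) : ℝ := p 0 - rStar M (rad p)

/-- The advanced time `v = t + r_*`. -/
def vCoord (M : ℝ) (p : Pt) : ℝ := p 0 + rStar M (rad p)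

/-- The region `{u ≥ u₀} ∩ {v ≥ v₀}` of the exterior. -/
def region (M u₀ v₀ : ℝ) : Set Pt :=
  {p | p ∈ exterior M ∧ u₀ ≤ uCoord M p ∧ v₀ ≤ vCoord M p}

/-- The unit sphere of `ℝ³`. -/
abbrev S2 : Type := Metric.sphere (0 : EuclideanSpace ℝ (Fin 3)) 1

/-- The standard surface measure of the unit sphere. -/
def dS2 : MeasureTheory.Measure S2 :=
  (MeasureTheory.volume : MeasureTheory.Measure (EuclideanSpace ℝ (Fin 3))).toSphere

/-- The point of the exterior with double null coordinates `(u, v, ω)`: here `t = (u + v) / 2` and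
`r_* = (v - u) / 2`. -/
def pt (M u v : ℝ) (ω : S2) : Pt :=
  ![(u + v) / 2, rOf M ((v - u) / 2) * ω.1 0, rOf M ((v - u) / 2) * ω.1 1,
    rOf M ((v - u) / 2) * ω.1 2]

/-! ### Fluxes and the Morawetz bulk term -/

/-- `(1-μ)|∇̸φ|² + V|φ|²` with `V = (1-μ)/r²`. -/
def angularDensity (M : ℝ) (φ : OneForm) (p : Pt) : ℝ :=
  (1 - mu M p) * normTwo p (slashGrad M φ p) ^ 2
    + (1 - mu M p) / rad p ^ 2 * normOne p (φ p) ^ 2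

/-- The flux `𝓕ᵀ_u[φ](v₁, v₂)` through an outgoing null cone. -/
def fluxU (M : ℝ) (φ : OneForm) (u v₁ v₂ : ℝ) : ℝ :=
  ∫ v in v₁..v₂, ∫ ω : S2, (normOne (pt M u v ω) (slashAlong M (L M) φ (pt M u v ω)) ^ 2
    + angularDensity M φ (pt M u v ω)) ∂dS2

/-- The flux `𝓕ᵀ_v[φ](u₁, u₂)` through an ingoing null cone. -/
def fluxV (M : ℝ) (φ : OneForm) (v u₁ u₂ : ℝ) : ℝ :=
  ∫ u in u₁..u₂, ∫ ω : S2, (normOne (pt M u v ω) (slashAlong M (Lbar M) φ (pt M u v ω)) ^ 2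
    + angularDensity M φ (pt M u v ω)) ∂dS2

/-- The degenerate spacetime density
`r⁻²|∇̸_L φ - ∇̸_L̲ φ|² + (r-3M)²/r³ (|∇̸φ|² + r⁻¹|∇̸_L φ + ∇̸_L̲ φ|²) + r⁻³|φ|²`. -/
def morawetzDensity (M : ℝ) (φ : OneForm) (p : Pt) : ℝ :=
  1 / rad p ^ 2 * normOne p (slashAlong M (L M) φ p - slashAlong M (Lbar M) φ p) ^ 2
    + (rad p - 3 * M) ^ 2 / rad p ^ 3 *
      (normTwo p (slashGrad M φ p) ^ 2
        + 1 / rad p * normOne p (slashAlong M (L M) φ p + slashAlong M (Lbar M) φ p) ^ 2)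
    + 1 / rad p ^ 3 * normOne p (φ p) ^ 2

end

end FackerellIpser

/-!
The estimate is the classical vector field argument for the potential `(1 - μ) l (l + 1) / r²`,
which applies to one-forms without any decomposition into spherical harmonics, and without a
Poincaré inequality, after the following reformulation.

Write a one-form `φ` tangent to the spheres in its Cartesian components `φ_c` on `ℝ × ℝ³`.  The
Christoffel symbols with two tangential indices, one of them the upper index, vanish
(`sum_mul_christoffel`), so that `D_L φ` and `D_L̲ φ` are componentwise derivatives
(`slashAlong_eq_der`) and the angular derivatives are projections of flat ones (`slashGrad_eq`).
If `Ω_a` acts on components, then `r² |∇̸φ|² + |φ|² = ∑_a |Ω_a φ|²`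
(`TangentialOn.sum_slashGrad_rot_sq`), and `r² Δ̸φ - φ` is the tangential part of `∑_a Ω_a Ω_a φ`
(`sum_mul_slashLaplacian_eq`).  The Fackerell--Ipser equation therefore says that
`L̲ L φ_c = (1 - μ) r⁻² ∑_a Ω_a Ω_a φ_c` when tested against tangential one-forms
(`FackerellIpserAt.sum_mul_der`); `L φ`, `L̲ φ` and `φ` itself are tangential.  The fields `L`, `L̲`
and `Ω_a` commute.

The rotations preserve the measure of the sphere, hence `∫ Ω_a F = 0` on each sphere
(`integral_rot_eq_zero`).  With `∂_u = L̲ / 2` and `∂_v = L / 2` this gives a divergence theorem for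
currents `L̲ P + L Q + ∑_a Ω_a Y_a` on null rectangles (`integral_divergence`).  It is applied twice.

* With `V = (1 - μ) / r²`, the multiplier `∂_t` gives
  `L̲ (|L φ|² + V N) + L (|L̲ φ|² + V N) + (angular divergence) = 0` with `N = ∑_a |Ω_a φ|²`, so the
  two future fluxes are bounded by the two initial ones (`TangentialOn.divergence_energy`).
* Let a prime denote the derivative in `r_*`.  The multiplier `f ∂_{r_*}` with `f = 1 - 3M/r`, the
  Lagrangian term `w φ` with `w = f' - g`, and the total derivative of `h |φ|²` give a current whose
  divergence is minus
  `(f' - g/2) |Z|² + (g/2) |S|² - 2 (f V' + V g) N + (g'' - f''' + 2 h') |φ|² + 2 h φ · Z`,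
  where `Z = L φ - L̲ φ` and `S = L φ + L̲ φ` (`TangentialOn.divergence_morawetz`).  Since
  `V' = -2 (1 - μ) (r - 3M) / r⁴`, the coefficient of `N` is a positive multiple of `(r - 3M)²` for
  small `g`.  The function `g`, a small multiple of `M V (r - 3M)² / r²`, produces the degenerate
  control of the time derivative.  For `h = 0` the coefficient of `|φ|²` is negative near the
  horizon, even after `|φ|² ≤ N` is used there; the choice of `h` as a multiple of `M³ V / r³`
  makes it positive after completing the square in `Z` (`TangentialOn.le_morawetzBulk`).

All weights are polynomials in `x = M / r ∈ (0, 1/2)`, which reduces positivity to one polynomial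
inequality (`zeroth_coefficient_pos`).  The Morawetz current is bounded by the energy densities, and
the angular norms of the statement are comparable with the Euclidean ones.
-/

namespace FackerellIpser

noncomputable section

open MeasureTheory Set Topology Function

/-! ### The null coordinates -/

theorem two_mul_lt_rOf {M : ℝ} (hM : 0 < M) (s : ℝ) : 2 * M < rOf M s :=
  (rStar_bijOn hM).surjOn.mapsTo_invFunOn (mem_univ s)

theorem rStar_rOf {M : ℝ} (hM : 0 < M) (s : ℝ) : rStar M (rOf M s) = s :=
  (rStar_bijOn hM).surjOn.rightInvOn_invFunOn (mem_univ s)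

theorem rOf_rStar {M : ℝ} (hM : 0 < M) {r : ℝ} (hr : 2 * M < r) : rOf M (rStar M r) = r :=
  (rStar_bijOn hM).injOn.leftInvOn_invFunOn hr

theorem hasDerivAt_rStar {M : ℝ} (hM : 0 < M) {r : ℝ} (hr : 2 * M < r) :
    HasDerivAt (rStar M) (1 - 2 * M / r)⁻¹ r := by
  have h0 : r - 2 * M ≠ 0 := by linarith
  have h1 : r ≠ 0 := by linarith
  have h := ((((hasDerivAt_id r).sub_const (2 * M)).log h0).const_mul (2 * M))
  have h' := (((hasDerivAt_id r).add h).sub_const (3 * M)).sub_const (2 * M * Real.log M)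
  have h2 : 1 - 2 * M / r ≠ 0 := by
    rw [one_sub_div h1]; exact div_ne_zero h0 h1
  refine h'.congr_deriv ?_
  rw [one_sub_div h1, inv_div, id]
  field_simp
  ring

theorem strictMonoOn_rStar {M : ℝ} (hM : 0 < M) : StrictMonoOn (rStar M) (Ioi (2 * M)) := by
  intro a ha b hb hab
  simp only [mem_Ioi] at ha hb
  have h := Real.log_lt_log (by linarith : 0 < a - 2 * M) (by linarith : a - 2 * M < b - 2 * M)
  have h2 : 2 * M * Real.log (a - 2 * M) < 2 * M * Real.log (b - 2 * M) :=
    mul_lt_mul_of_pos_left h (by linarith)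
  unfold rStar
  linarith

theorem strictMono_rOf {M : ℝ} (hM : 0 < M) : StrictMono (rOf M) := by
  intro a b hab
  rw [← (strictMonoOn_rStar hM).lt_iff_lt (two_mul_lt_rOf hM a) (two_mul_lt_rOf hM b),
    rStar_rOf hM, rStar_rOf hM]
  exact hab

theorem range_rOf {M : ℝ} (hM : 0 < M) : range (rOf M) = Ioi (2 * M) := by
  ext r
  constructor
  · rintro ⟨s, rfl⟩
    exact two_mul_lt_rOf hM s
  · intro hr
    exact ⟨rStar M r, rOf_rStar hM hr⟩

theorem continuous_rOf {M : ℝ} (hM : 0 < M) : Continuous (rOf M) := by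
  rw [continuous_iff_continuousAt]
  intro s
  refine ((strictMono_rOf hM).strictMonoOn univ).continuousAt_of_image_mem_nhds Filter.univ_mem ?_
  rw [image_univ, range_rOf hM]
  exact Ioi_mem_nhds (two_mul_lt_rOf hM s)

theorem hasDerivAt_rOf {M : ℝ} (hM : 0 < M) (s : ℝ) :
    HasDerivAt (rOf M) (1 - 2 * M / rOf M s) s := by
  have hr := two_mul_lt_rOf hM s
  have h0 : 1 - 2 * M / rOf M s ≠ 0 := by
    rw [one_sub_div (by linarith)]
    exact div_ne_zero (by linarith) (by linarith)
  have := HasDerivAt.of_local_left_inverse (continuous_rOf hM).continuousAt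
    (hasDerivAt_rStar hM hr) (inv_ne_zero h0) (Filter.Eventually.of_forall (rStar_rOf hM))
  rwa [inv_inv] at this

theorem sphere_sq_sum (ω : S2) : ω.1 0 ^ 2 + ω.1 1 ^ 2 + ω.1 2 ^ 2 = 1 := by
  have h : ‖ω.1‖ = 1 := by simp
  have h2 := EuclideanSpace.norm_sq_eq ω.1
  rw [h] at h2
  simp [Fin.sum_univ_three] at h2
  linarith

theorem rad_pt {M : ℝ} (hM : 0 < M) (u v : ℝ) (ω : S2) :
    rad (pt M u v ω) = rOf M ((v - u) / 2) := by
  have hr := two_mul_lt_rOf hM ((v - u) / 2)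
  have hs := sphere_sq_sum ω
  have : (pt M u v ω 1) ^ 2 + (pt M u v ω 2) ^ 2 + (pt M u v ω 3) ^ 2
      = rOf M ((v - u) / 2) ^ 2 := by
    simp [pt]
    linear_combination rOf M ((v - u) / 2) ^ 2 * hs
  rw [rad, this, Real.sqrt_sq (by linarith)]

theorem pt_mem_region {M : ℝ} (hM : 0 < M) {u₀ v₀ u v : ℝ} (hu : u₀ ≤ u) (hv : v₀ ≤ v) (ω : S2) :
    pt M u v ω ∈ region M u₀ v₀ := by
  have h0 : pt M u v ω 0 = (u + v) / 2 := by simp [pt]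
  refine ⟨?_, ?_, ?_⟩
  · simp only [exterior, mem_ofPred_eq, rad_pt hM]
    exact two_mul_lt_rOf hM _
  · rw [uCoord, rad_pt hM, rStar_rOf hM, h0]; linarith
  · rw [vCoord, rad_pt hM, rStar_rOf hM, h0]; linarith

theorem continuous_pt {M : ℝ} (hM : 0 < M) :
    Continuous fun q : ℝ × ℝ × S2 => pt M q.1 q.2.1 q.2.2 := by
  have hr := continuous_rOf hM
  refine continuous_pi fun i => ?_
  fin_cases i <;> simp [pt] <;> fun_prop

theorem dr_pt {M : ℝ} (hM : 0 < M) (u v : ℝ) (ω : S2) :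
    dr (pt M u v ω) = ![0, ω.1 0, ω.1 1, ω.1 2] := by
  have hr := two_mul_lt_rOf hM ((v - u) / 2)
  have h0 : rOf M ((v - u) / 2) ≠ 0 := by linarith
  simp only [dr, rad_pt hM]
  simp [pt, h0]

/-- On functions of `(u, v, ω)`, the derivative `∂_u` is `L̲ / 2`. -/
theorem hasDerivAt_pt_u {M : ℝ} (hM : 0 < M) (u v : ℝ) (ω : S2) :
    HasDerivAt (fun u => pt M u v ω) ((1 / 2 : ℝ) • Lbar M (pt M u v ω)) u := by
  have h1 : HasDerivAt (fun u : ℝ => (v - u) / 2) (-1 / 2) u := by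
    simpa using ((hasDerivAt_id u).const_sub v).div_const 2
  have h2 := (hasDerivAt_rOf hM ((v - u) / 2)).comp u h1
  have h3 : HasDerivAt (fun u : ℝ => (u + v) / 2) (1 / 2) u := by
    simpa using ((hasDerivAt_id u).add_const v).div_const 2
  rw [hasDerivAt_pi]
  intro i
  simp only [Pi.smul_apply, Lbar, mu, rad_pt hM, dr_pt hM, smul_eq_mul]
  fin_cases i
  · simpa [pt, dt] using h3
  all_goals
    simp [pt, dt]
    refine (h2.mul_const _).congr_deriv ?_
    ring

/-- On functions of `(u, v, ω)`, the derivative `∂_v` is `L / 2`. -/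
theorem hasDerivAt_pt_v {M : ℝ} (hM : 0 < M) (u v : ℝ) (ω : S2) :
    HasDerivAt (fun v => pt M u v ω) ((1 / 2 : ℝ) • L M (pt M u v ω)) v := by
  have h1 : HasDerivAt (fun v : ℝ => (v - u) / 2) (1 / 2) v := by
    simpa using ((hasDerivAt_id v).sub_const u).div_const 2
  have h2 := (hasDerivAt_rOf hM ((v - u) / 2)).comp v h1
  have h3 : HasDerivAt (fun v : ℝ => (u + v) / 2) (1 / 2) v := by
    simpa using ((hasDerivAt_id v).const_add u).div_const 2
  rw [hasDerivAt_pi]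
  intro i
  simp only [Pi.smul_apply, L, mu, rad_pt hM, dr_pt hM, smul_eq_mul]
  fin_cases i
  · simpa [pt, dt] using h3
  all_goals
    simp [pt, dt]
    refine (h2.mul_const _).congr_deriv ?_
    ring

/-! ### Integration over the sphere -/

instance isFiniteMeasure_dS2 : IsFiniteMeasure dS2 := by unfold dS2; infer_instance

theorem integrable_dS2 {f : S2 → ℝ} (hf : Continuous f) : Integrable f dS2 :=
  integrableOn_univ.1 (hf.continuousOn.integrableOn_compact isCompact_univ)

/-- The action of a linear isometry on the unit sphere. -/
def sphereMap (e : EuclideanSpace ℝ (Fin 3) ≃ₗᵢ[ℝ] EuclideanSpace ℝ (Fin 3)) (ω : S2) : S2 :=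
  ⟨e ω.1, by simp⟩

theorem continuous_sphereMap (e : EuclideanSpace ℝ (Fin 3) ≃ₗᵢ[ℝ] EuclideanSpace ℝ (Fin 3)) :
    Continuous (sphereMap e) :=
  (e.continuous.comp continuous_subtype_val).subtype_mk _

open scoped Pointwise in
theorem measurePreserving_sphereMap
    (e : EuclideanSpace ℝ (Fin 3) ≃ₗᵢ[ℝ] EuclideanSpace ℝ (Fin 3)) :
    MeasurePreserving (sphereMap e) dS2 dS2 := by
  refine ⟨(continuous_sphereMap e).measurable, ?_⟩
  ext s hs
  rw [Measure.map_apply (continuous_sphereMap e).measurable hs, dS2,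
    Measure.toSphere_apply' _ hs,
    Measure.toSphere_apply' _ ((continuous_sphereMap e).measurable hs)]
  congr 1
  refine Eq.trans ?_ (e.measurePreserving.measure_preimage_equiv (f := e.toMeasurableEquiv) _)
  congr 1
  ext x
  simp only [mem_smul, mem_image, mem_preimage, Subtype.exists]
  constructor
  · rintro ⟨c, hc, _, ⟨y, hy, hys, rfl⟩, rfl⟩
    exact ⟨c, hc, e y, ⟨e y, by simpa using hy, hys, rfl⟩, by
      change _ = e (c • y); simp⟩
  · rintro ⟨c, hc, _, ⟨y, hy, hys, rfl⟩, hx⟩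
    refine ⟨c, hc, e.symm y, ⟨e.symm y, by simpa using hy, ?_, rfl⟩, ?_⟩
    · have : sphereMap e ⟨e.symm y, by simpa using hy⟩ = ⟨y, hy⟩ := by
        simp [sphereMap]
      rwa [this]
    · change c • y = e x at hx
      rw [← map_smul, hx]; simp

theorem integral_comp_sphereMap
    (e : EuclideanSpace ℝ (Fin 3) ≃ₗᵢ[ℝ] EuclideanSpace ℝ (Fin 3)) {f : S2 → ℝ}
    (hf : Continuous f) : ∫ ω, f (sphereMap e ω) ∂dS2 = ∫ ω, f ω ∂dS2 := by
  have h := measurePreserving_sphereMap e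
  have h2 := integral_map (μ := dS2) h.measurable.aemeasurable
    (f := f) hf.aestronglyMeasurable
  rw [h.map_eq] at h2
  exact h2.symm

/-- The coordinates of the rotation by the angle `θ` about the axis `a`. -/
def rotCoord (a : Fin 3) (θ : ℝ) (x : Fin 3 → ℝ) : Fin 3 → ℝ :=
  (![![x 0, Real.cos θ * x 1 - Real.sin θ * x 2, Real.sin θ * x 1 + Real.cos θ * x 2],
    ![Real.cos θ * x 0 + Real.sin θ * x 2, x 1, -Real.sin θ * x 0 + Real.cos θ * x 2],
    ![Real.cos θ * x 0 - Real.sin θ * x 1, Real.sin θ * x 0 + Real.cos θ * x 1, x 2]] :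
    Fin 3 → Fin 3 → ℝ) a

/-- The rotation by the angle `θ` about the axis `a`, whose generator is `rot a`. -/
def rotation (a : Fin 3) (θ : ℝ) : EuclideanSpace ℝ (Fin 3) ≃ₗᵢ[ℝ] EuclideanSpace ℝ (Fin 3) :=
  LinearIsometry.toLinearIsometryEquiv
    { toFun := fun x => WithLp.toLp 2 (rotCoord a θ x.ofLp)
      map_add' := by
        intro x y
        ext i
        fin_cases a <;> fin_cases i <;> simp [rotCoord] <;> ring
      map_smul' := by
        intro c x
        ext i
        fin_cases a <;> fin_cases i <;> simp [rotCoord] <;> ring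
      norm_map' := by
        intro x
        have hcs := Real.sin_sq_add_cos_sq θ
        rw [EuclideanSpace.norm_eq, EuclideanSpace.norm_eq]
        congr 1
        fin_cases a <;> simp [rotCoord, Fin.sum_univ_three]
        · linear_combination (x.ofLp 1 ^ 2 + x.ofLp 2 ^ 2) * hcs
        · linear_combination (x.ofLp 0 ^ 2 + x.ofLp 2 ^ 2) * hcs
        · linear_combination (x.ofLp 0 ^ 2 + x.ofLp 1 ^ 2) * hcs }
    rfl

theorem rotation_apply (a : Fin 3) (θ : ℝ) (x : EuclideanSpace ℝ (Fin 3)) :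
    (rotation a θ x).ofLp = rotCoord a θ x.ofLp := rfl

theorem hasDerivAt_pt_rotation {M : ℝ} (u v : ℝ) (a : Fin 3) (θ : ℝ) (ω : S2) :
    HasDerivAt (fun θ => pt M u v (sphereMap (rotation a θ) ω))
      (rot a (pt M u v (sphereMap (rotation a θ) ω))) θ := by
  have hs := Real.hasDerivAt_sin θ
  have hc := Real.hasDerivAt_cos θ
  rw [hasDerivAt_pi]
  intro i
  simp only [pt, sphereMap, rotation_apply]
  fin_cases a <;> fin_cases i <;> simp [rotCoord, rot]
  all_goals first
    | exact hasDerivAt_const _ _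
    | refine (((hc.mul_const _).sub (hs.mul_const _)).const_mul _).congr_deriv ?_
      ring
    | refine (((hs.mul_const _).add (hc.mul_const _)).const_mul _).congr_deriv ?_
      ring
    | refine (((hc.mul_const _).add (hs.mul_const _)).const_mul _).congr_deriv ?_
      ring
    | refine ((((hs.mul_const _).neg).add (hc.mul_const _)).const_mul _).congr_deriv ?_
      ring

theorem continuous_sphereMap_rotation (a : Fin 3) :
    Continuous fun q : ℝ × S2 => sphereMap (rotation a q.1) q.2 := by
  refine Continuous.subtype_mk ?_ _
  refine (PiLp.continuous_toLp 2 _).comp (?_ : Continuous fun q : ℝ × S2 => rotCoord a q.1 q.2.1.ofLp)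
  refine continuous_pi fun i => ?_
  fin_cases a <;> fin_cases i <;> simp [rotCoord] <;> fun_prop

/-! ### Fubini's theorem and the fundamental theorem of calculus on `[a, b] × 𝕊²` -/

/-- A function that is continuous on `[a, b] × 𝕊²` agrees there with a globally continuous one. -/
theorem exists_continuous_extension {a b : ℝ} (hab : a ≤ b) {G : ℝ → S2 → ℝ}
    (hG : ContinuousOn (uncurry G) (Icc a b ×ˢ univ)) :
    ∃ H : ℝ → S2 → ℝ, Continuous (uncurry H) ∧ ∀ x ∈ Icc a b, H x = G x := by
  -- `x` is replaced by the nearest point of `[a, b]`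
  refine ⟨fun x => G (projIcc a b hab x), ?_, ?_⟩
  · refine hG.comp_continuous (f := fun q : ℝ × S2 => ((projIcc a b hab q.1 : ℝ), q.2))
      (by fun_prop) fun q => ⟨(projIcc a b hab q.1).2, mem_univ _⟩
  · intro x hx
    simp [projIcc_of_mem hab hx]

theorem continuousOn_integral_dS2 {a b : ℝ} (hab : a ≤ b) {G : ℝ → S2 → ℝ}
    (hG : ContinuousOn (uncurry G) (Icc a b ×ˢ univ)) :
    ContinuousOn (fun x => ∫ ω, G x ω ∂dS2) (Icc a b) := by
  obtain ⟨H, hH, hHG⟩ := exists_continuous_extension hab hG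
  have := continuous_parametric_integral_of_continuous (μ := dS2) hH isCompact_univ
  simp only [Measure.restrict_univ] at this
  refine this.continuousOn.congr fun x hx => ?_
  simp only [hHG x hx]

/-- The fundamental theorem of calculus in the first variable, integrated over the sphere. -/
theorem integral_integral_deriv {a b : ℝ} (hab : a ≤ b) {G G' : ℝ → S2 → ℝ}
    (hG : ∀ x ∈ Icc a b, ∀ ω, HasDerivAt (fun x => G x ω) (G' x ω) x)
    (hG' : ContinuousOn (uncurry G') (Icc a b ×ˢ univ)) :
    ∫ x in a..b, ∫ ω, G' x ω ∂dS2 = ∫ ω, (G b ω - G a ω) ∂dS2 := by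
  obtain ⟨H, hH, hHG⟩ := exists_continuous_extension hab hG'
  have h1 : ∫ x in a..b, ∫ ω, G' x ω ∂dS2 = ∫ x in a..b, ∫ ω, H x ω ∂dS2 := by
    refine intervalIntegral.integral_congr fun x hx => ?_
    rw [uIcc_of_le hab] at hx
    simp only [hHG x hx]
  rw [h1, intervalIntegral_integral_swap]
  · refine integral_congr_ae (Filter.Eventually.of_forall fun ω => ?_)
    refine intervalIntegral.integral_eq_sub_of_hasDerivAt (f := fun x => G x ω) (fun x hx => ?_) ?_
    · rw [uIcc_of_le hab] at hx
      rw [hHG x hx]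
      exact hG x hx ω
    · exact (hH.comp (by fun_prop : Continuous fun x : ℝ => (x, ω))).intervalIntegrable _ _
  · have h2 : IntegrableOn (uncurry H) (uIcc a b ×ˢ univ) (volume.prod dS2) :=
      hH.continuousOn.integrableOn_compact (isCompact_uIcc.prod isCompact_univ)
    have h3 := h2.mono_set (prod_mono uIoc_subset_uIcc (Subset.refl univ))
    rwa [IntegrableOn, ← Measure.prod_restrict, Measure.restrict_univ] at h3

/-- Rotation vector fields are divergence free on the sphere. -/
theorem integral_rot_eq_zero {M : ℝ} (hM : 0 < M) (u v : ℝ) (a : Fin 3) {F : Pt → ℝ}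
    (hF : ∀ ω, DifferentiableAt ℝ F (pt M u v ω))
    (hF' : Continuous fun ω => fderiv ℝ F (pt M u v ω) (rot a (pt M u v ω))) :
    ∫ ω, fderiv ℝ F (pt M u v ω) (rot a (pt M u v ω)) ∂dS2 = 0 := by
  have hcF : Continuous fun ω => F (pt M u v ω) :=
    continuous_iff_continuousAt.2 fun ω => (hF ω).continuousAt.comp_of_eq
      ((continuous_pt hM).comp (by fun_prop : Continuous fun ω : S2 => (u, v, ω))).continuousAt rfl
  -- Along the rotation flow for unit time, the integral of `F` does not change, while its rate of
  -- change is at all times the integral of `Ω_a F`.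
  have h := integral_integral_deriv (zero_le_one' ℝ)
    (G := fun θ ω => F (pt M u v (sphereMap (rotation a θ) ω)))
    (G' := fun θ ω => fderiv ℝ F (pt M u v (sphereMap (rotation a θ) ω))
      (rot a (pt M u v (sphereMap (rotation a θ) ω))))
    (fun θ _ ω => (hF _).hasFDerivAt.comp_hasDerivAt θ (hasDerivAt_pt_rotation u v a θ ω))
    (hF'.comp (continuous_sphereMap_rotation a)).continuousOn
  simp only [integral_comp_sphereMap _ hF'] at h
  rw [integral_sub, integral_comp_sphereMap _ hcF, integral_comp_sphereMap _ hcF] at h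
  · simpa using h
  · exact integrable_dS2 (hcF.comp (continuous_sphereMap _))
  · exact integrable_dS2 (hcF.comp (continuous_sphereMap _))

/-! ### Derivatives along vector fields -/

/-- `f` is infinitely differentiable on `W`. -/
abbrev SmoothOn {E : Type*} [NormedAddCommGroup E] [NormedSpace ℝ E] (f : Pt → E) (W : Set Pt) :
    Prop :=
  ContDiffOn ℝ ((⊤ : ℕ∞) : WithTop ℕ∞) f W

/-- The derivative of the function `f` along the vector field `X`. -/
def der (X : Pt → Fin 4 → ℝ) (f : Pt → ℝ) (p : Pt) : ℝ := fderiv ℝ f p (X p)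

theorem rad_pos {M : ℝ} (hM : 0 < M) {p : Pt} (hp : p ∈ exterior M) : 0 < rad p :=
  lt_trans (by linarith) (show 2 * M < rad p from hp)

theorem rad_sq (p : Pt) : rad p ^ 2 = p 1 ^ 2 + p 2 ^ 2 + p 3 ^ 2 :=
  Real.sq_sqrt (by positivity)

theorem contDiffAt_rad {p : Pt} (hp : 0 < rad p) : ContDiffAt ℝ ((⊤ : ℕ∞) : WithTop ℕ∞) rad p := by
  have h : p 1 ^ 2 + p 2 ^ 2 + p 3 ^ 2 ≠ 0 := by
    rw [← rad_sq]; positivity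
  unfold rad
  exact ContDiffAt.sqrt (by fun_prop) h

theorem contDiffOn_rad {M : ℝ} (hM : 0 < M) : SmoothOn rad (exterior M) :=
  fun _ hp => (contDiffAt_rad (rad_pos hM hp)).contDiffWithinAt

theorem contDiffOn_dr {M : ℝ} (hM : 0 < M) : SmoothOn dr (exterior M) := by
  have h := contDiffOn_rad hM
  have h0 : ∀ p ∈ exterior M, rad p ≠ 0 := fun p hp => (rad_pos hM hp).ne'
  refine contDiffOn_pi.2 fun i => ?_
  have hi : ∀ j : Fin 4, SmoothOn (fun p : Pt => p j / rad p) (exterior M) :=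
    fun j => ContDiffOn.div (by fun_prop) h h0
  fin_cases i
  · simpa [dr] using contDiffOn_const
  · simpa [dr] using hi 1
  · simpa [dr] using hi 2
  · simpa [dr] using hi 3

theorem contDiffOn_mu {M : ℝ} (hM : 0 < M) : SmoothOn (mu M) (exterior M) :=
  contDiffOn_const.div (contDiffOn_rad hM) fun _ hp => (rad_pos hM hp).ne'

theorem contDiffOn_L {M : ℝ} (hM : 0 < M) : SmoothOn (L M) (exterior M) :=
  contDiffOn_pi.2 fun i => contDiffOn_const.add
    ((contDiffOn_const.sub (contDiffOn_mu hM)).mul (contDiffOn_pi.1 (contDiffOn_dr hM) i))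

theorem contDiffOn_Lbar {M : ℝ} (hM : 0 < M) : SmoothOn (Lbar M) (exterior M) :=
  contDiffOn_pi.2 fun i => contDiffOn_const.sub
    ((contDiffOn_const.sub (contDiffOn_mu hM)).mul (contDiffOn_pi.1 (contDiffOn_dr hM) i))

theorem contDiff_rot (a : Fin 3) : ContDiff ℝ ((⊤ : ℕ∞) : WithTop ℕ∞) (rot a) := by
  refine contDiff_pi.2 fun i => ?_
  fin_cases a <;> fin_cases i <;> simp [rot] <;> fun_prop

theorem contDiffOn_der {W : Set Pt} (hW : IsOpen W) {X : Pt → Fin 4 → ℝ}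
    (hX : SmoothOn X W) {f : Pt → ℝ} (hf : SmoothOn f W) :
    SmoothOn (der X f) W :=
  (hf.fderiv_of_isOpen hW (by simp)).clm_apply hX

theorem differentiableAt_of_mem {W : Set Pt} (hW : IsOpen W) {f : Pt → ℝ}
    (hf : SmoothOn f W) {p : Pt} (hp : p ∈ W) : DifferentiableAt ℝ f p :=
  (hf.contDiffAt (hW.mem_nhds hp)).differentiableAt (by simp)

/-! ### Integration over a null rectangle times the sphere -/

/-- A function that is continuous on `[a, b] × [c, d] × 𝕊²` agrees there with a globally continuous
one. -/
theorem exists_continuous_extension₂ {a b c d : ℝ} (hab : a ≤ b) (hcd : c ≤ d)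
    {G : ℝ → ℝ → S2 → ℝ}
    (hG : ContinuousOn (fun q : ℝ × ℝ × S2 => G q.1 q.2.1 q.2.2) (Icc a b ×ˢ Icc c d ×ˢ univ)) :
    ∃ H : ℝ → ℝ → S2 → ℝ, Continuous (fun q : ℝ × ℝ × S2 => H q.1 q.2.1 q.2.2) ∧
      ∀ x ∈ Icc a b, ∀ y ∈ Icc c d, H x y = G x y := by
  refine ⟨fun x y => G (projIcc a b hab x) (projIcc c d hcd y), ?_, ?_⟩
  · refine hG.comp_continuous
      (f := fun q : ℝ × ℝ × S2 => ((projIcc a b hab q.1 : ℝ), (projIcc c d hcd q.2.1 : ℝ), q.2.2))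
      (by fun_prop) fun q =>
        ⟨(projIcc a b hab q.1).2, (projIcc c d hcd q.2.1).2, mem_univ _⟩
  · intro x hx y hy
    simp [projIcc_of_mem hab hx, projIcc_of_mem hcd hy]

theorem continuous_integral_dS2₂ {H : ℝ → ℝ → S2 → ℝ}
    (hH : Continuous (fun q : ℝ × ℝ × S2 => H q.1 q.2.1 q.2.2)) :
    Continuous (uncurry fun x y => ∫ ω, H x y ω ∂dS2) := by
  have := continuous_parametric_integral_of_continuous (μ := dS2)
    (f := fun (q : ℝ × ℝ) ω => H q.1 q.2 ω)
    (hH.comp (by fun_prop : Continuous fun q : (ℝ × ℝ) × S2 => (q.1.1, q.1.2, q.2)))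
    isCompact_univ
  simp only [Measure.restrict_univ] at this
  exact this

theorem integral_congr_rectangle {a b c d : ℝ} (hab : a ≤ b) (hcd : c ≤ d) {F G : ℝ → ℝ → ℝ}
    (h : ∀ x ∈ Icc a b, ∀ y ∈ Icc c d, F x y = G x y) :
    ∫ x in a..b, ∫ y in c..d, F x y = ∫ x in a..b, ∫ y in c..d, G x y := by
  refine intervalIntegral.integral_congr fun x hx => intervalIntegral.integral_congr fun y hy => ?_
  rw [uIcc_of_le hab] at hx
  rw [uIcc_of_le hcd] at hy
  exact h x hx y hy

theorem intervalIntegral_mono_of_nonneg {a b : ℝ} (hab : a ≤ b) {F G : ℝ → ℝ}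
    (hF : ∀ x ∈ Icc a b, 0 ≤ F x) (hFG : ∀ x ∈ Icc a b, F x ≤ G x)
    (hG : ContinuousOn G (Icc a b)) : ∫ x in a..b, F x ≤ ∫ x in a..b, G x := by
  rw [intervalIntegral.integral_of_le hab, intervalIntegral.integral_of_le hab]
  refine integral_mono_of_nonneg ?_ ((hG.integrableOn_compact isCompact_Icc).mono_set
    Ioc_subset_Icc_self) ?_
  · filter_upwards [ae_restrict_mem measurableSet_Ioc] with x hx using hF x (Ioc_subset_Icc_self hx)
  · filter_upwards [ae_restrict_mem measurableSet_Ioc] with x hx using hFG x (Ioc_subset_Icc_self hx)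

/-- Monotonicity of the spacetime integral; only the larger integrand has to be continuous. -/
theorem integral_rectangle_mono_of_nonneg {a b c d : ℝ} (hab : a ≤ b) (hcd : c ≤ d)
    {F G : ℝ → ℝ → S2 → ℝ}
    (hF : ∀ x ∈ Icc a b, ∀ y ∈ Icc c d, ∀ ω, 0 ≤ F x y ω)
    (hFG : ∀ x ∈ Icc a b, ∀ y ∈ Icc c d, ∀ ω, F x y ω ≤ G x y ω)
    (hG : ContinuousOn (fun q : ℝ × ℝ × S2 => G q.1 q.2.1 q.2.2)
      (Icc a b ×ˢ Icc c d ×ˢ univ)) :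
    ∫ x in a..b, ∫ y in c..d, ∫ ω, F x y ω ∂dS2
      ≤ ∫ x in a..b, ∫ y in c..d, ∫ ω, G x y ω ∂dS2 := by
  obtain ⟨H, hH, hHG⟩ := exists_continuous_extension₂ hab hcd hG
  rw [integral_congr_rectangle hab hcd (F := fun x y => ∫ ω, G x y ω ∂dS2)
    (G := fun x y => ∫ ω, H x y ω ∂dS2) fun x hx y hy => by simp only [hHG x hx y hy]]
  have hc := continuous_integral_dS2₂ hH
  have h0 : ∀ x ∈ Icc a b, ∀ y ∈ Icc c d, 0 ≤ ∫ ω, F x y ω ∂dS2 := fun x hx y hy =>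
    integral_nonneg fun ω => hF x hx y hy ω
  have h1 : ∀ x ∈ Icc a b, ∀ y ∈ Icc c d, ∫ ω, F x y ω ∂dS2 ≤ ∫ ω, H x y ω ∂dS2 :=
    fun x hx y hy => integral_mono_of_nonneg
      (Filter.Eventually.of_forall fun ω => hF x hx y hy ω)
      (integrable_dS2 (hH.comp (by fun_prop : Continuous fun ω : S2 => (x, y, ω))))
      (Filter.Eventually.of_forall fun ω => by
        simp only [hHG x hx y hy]; exact hFG x hx y hy ω)
  refine intervalIntegral_mono_of_nonneg hab
    (fun x hx => intervalIntegral.integral_nonneg hcd fun y hy => h0 x hx y hy)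
    (fun x hx => intervalIntegral_mono_of_nonneg hcd (h0 x hx) (h1 x hx) ?_) ?_
  · exact (hc.comp (by fun_prop : Continuous fun y : ℝ => (x, y))).continuousOn
  · exact (intervalIntegral.continuous_parametric_intervalIntegral_of_continuous' hc _ _).continuousOn

theorem integral_cone_mono {a b : ℝ} (hab : a ≤ b) {F G : ℝ → S2 → ℝ}
    (hF : ContinuousOn (uncurry F) (Icc a b ×ˢ univ))
    (hG : ContinuousOn (uncurry G) (Icc a b ×ˢ univ))
    (hFG : ∀ x ∈ Icc a b, ∀ ω, F x ω ≤ G x ω) :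
    ∫ x in a..b, ∫ ω, F x ω ∂dS2 ≤ ∫ x in a..b, ∫ ω, G x ω ∂dS2 := by
  have hs : ∀ {K : ℝ → S2 → ℝ}, ContinuousOn (uncurry K) (Icc a b ×ˢ univ) →
      ∀ x ∈ Icc a b, Integrable (K x) dS2 := fun hK x hx => integrable_dS2
    (hK.comp_continuous (by fun_prop : Continuous fun ω : S2 => (x, ω)) fun ω => ⟨hx, mem_univ _⟩)
  have hi : ∀ {K : ℝ → S2 → ℝ}, ContinuousOn (uncurry K) (Icc a b ×ˢ univ) →
      IntervalIntegrable (fun x => ∫ ω, K x ω ∂dS2) volume a b := fun hK =>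
    ContinuousOn.intervalIntegrable (by rw [uIcc_of_le hab]; exact continuousOn_integral_dS2 hab hK)
  exact intervalIntegral.integral_mono_on hab (hi hF) (hi hG) fun x hx =>
    integral_mono (hs hF x hx) (hs hG x hx) (hFG x hx)

theorem continuousOn_pt {M : ℝ} (hM : 0 < M) {W : Set Pt} {F : Pt → ℝ} (hF : ContinuousOn F W)
    {a b c d : ℝ} (hpt : ∀ u ∈ Icc a b, ∀ v ∈ Icc c d, ∀ ω, pt M u v ω ∈ W) :
    ContinuousOn (fun q : ℝ × ℝ × S2 => F (pt M q.1 q.2.1 q.2.2)) (Icc a b ×ˢ Icc c d ×ˢ univ) :=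
  hF.comp (continuous_pt hM).continuousOn fun _ hq => hpt _ hq.1 _ hq.2.1 _

theorem continuousOn_pt_u {M : ℝ} (hM : 0 < M) {W : Set Pt} {F : Pt → ℝ} (hF : ContinuousOn F W)
    {a b v : ℝ} (hpt : ∀ u ∈ Icc a b, ∀ ω, pt M u v ω ∈ W) :
    ContinuousOn (uncurry fun u ω => F (pt M u v ω)) (Icc a b ×ˢ univ) :=
  hF.comp ((continuous_pt hM).comp
    (by fun_prop : Continuous fun q : ℝ × S2 => (q.1, v, q.2))).continuousOn fun _ hq => hpt _ hq.1 _

theorem continuousOn_pt_v {M : ℝ} (hM : 0 < M) {W : Set Pt} {F : Pt → ℝ} (hF : ContinuousOn F W)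
    {u c d : ℝ} (hpt : ∀ v ∈ Icc c d, ∀ ω, pt M u v ω ∈ W) :
    ContinuousOn (uncurry fun v ω => F (pt M u v ω)) (Icc c d ×ˢ univ) :=
  hF.comp ((continuous_pt hM).comp
    (by fun_prop : Continuous fun q : ℝ × S2 => (u, q.1, q.2))).continuousOn fun _ hq => hpt _ hq.1 _

theorem integral_integral_sub {a b : ℝ} (hab : a ≤ b) {F G : ℝ → S2 → ℝ}
    (hF : ContinuousOn (uncurry F) (Icc a b ×ˢ univ))
    (hG : ContinuousOn (uncurry G) (Icc a b ×ˢ univ)) :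
    ∫ x in a..b, ∫ ω, (F x ω - G x ω) ∂dS2
      = (∫ x in a..b, ∫ ω, F x ω ∂dS2) - ∫ x in a..b, ∫ ω, G x ω ∂dS2 := by
  have hs : ∀ {K : ℝ → S2 → ℝ}, ContinuousOn (uncurry K) (Icc a b ×ˢ univ) →
      ∀ x ∈ Icc a b, Integrable (K x) dS2 := fun hK x hx => integrable_dS2
    (hK.comp_continuous (by fun_prop : Continuous fun ω : S2 => (x, ω)) fun ω => ⟨hx, mem_univ _⟩)
  have hi : ∀ {K : ℝ → S2 → ℝ}, ContinuousOn (uncurry K) (Icc a b ×ˢ univ) →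
      IntervalIntegrable (fun x => ∫ ω, K x ω ∂dS2) volume a b := fun hK =>
    ContinuousOn.intervalIntegrable (by rw [uIcc_of_le hab]; exact continuousOn_integral_dS2 hab hK)
  rw [← intervalIntegral.integral_sub (hi hF) (hi hG)]
  refine intervalIntegral.integral_congr fun x hx => ?_
  rw [uIcc_of_le hab] at hx
  exact integral_sub (hs hF x hx) (hs hG x hx)

theorem integral_der_Lbar {M : ℝ} (hM : 0 < M) {a b v : ℝ} (hab : a ≤ b) {W : Set Pt}
    (hW : IsOpen W) (hWM : W ⊆ exterior M) {P : Pt → ℝ} (hP : SmoothOn P W)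
    (hpt : ∀ u ∈ Icc a b, ∀ ω, pt M u v ω ∈ W) :
    ∫ u in a..b, ∫ ω, der (Lbar M) P (pt M u v ω) ∂dS2
      = 2 * ∫ ω, (P (pt M b v ω) - P (pt M a v ω)) ∂dS2 := by
  have hd := contDiffOn_der hW ((contDiffOn_Lbar hM).mono hWM) hP
  have h := integral_integral_deriv hab (G := fun u ω => 2 * P (pt M u v ω))
    (G' := fun u ω => der (Lbar M) P (pt M u v ω)) (fun u hu ω => by
      have h1 := ((differentiableAt_of_mem hW hP (hpt u hu ω)).hasFDerivAt.comp_hasDerivAt u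
        (hasDerivAt_pt_u hM u v ω)).const_mul 2
      refine h1.congr_deriv ?_
      rw [map_smul, der, smul_eq_mul]
      ring) (continuousOn_pt_u hM hd.continuousOn hpt)
  rw [h, ← integral_const_mul]
  simp only [mul_sub]

theorem integral_der_L {M : ℝ} (hM : 0 < M) {u c d : ℝ} (hcd : c ≤ d) {W : Set Pt}
    (hW : IsOpen W) (hWM : W ⊆ exterior M) {Q : Pt → ℝ} (hQ : SmoothOn Q W)
    (hpt : ∀ v ∈ Icc c d, ∀ ω, pt M u v ω ∈ W) :
    ∫ v in c..d, ∫ ω, der (L M) Q (pt M u v ω) ∂dS2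
      = 2 * ∫ ω, (Q (pt M u d ω) - Q (pt M u c ω)) ∂dS2 := by
  have hd := contDiffOn_der hW ((contDiffOn_L hM).mono hWM) hQ
  have h := integral_integral_deriv hcd (G := fun v ω => 2 * Q (pt M u v ω))
    (G' := fun v ω => der (L M) Q (pt M u v ω)) (fun v hv ω => by
      have h1 := ((differentiableAt_of_mem hW hQ (hpt v hv ω)).hasFDerivAt.comp_hasDerivAt v
        (hasDerivAt_pt_v hM u v ω)).const_mul 2
      refine h1.congr_deriv ?_
      rw [map_smul, der, smul_eq_mul]
      ring) (continuousOn_pt_v hM hd.continuousOn hpt)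
  rw [h, ← integral_const_mul]
  simp only [mul_sub]

/-- The divergence theorem on a null rectangle times the sphere: the angular part `∑ Ω_a Y_a` does
not contribute, and the two null parts reduce to fluxes through the four bounding null cones. -/
theorem integral_divergence {M : ℝ} (hM : 0 < M) {u₁ u₂ v₁ v₂ : ℝ} (hu : u₁ ≤ u₂) (hv : v₁ ≤ v₂)
    {W : Set Pt} (hW : IsOpen W) (hWM : W ⊆ exterior M)
    (hpt : ∀ u ∈ Icc u₁ u₂, ∀ v ∈ Icc v₁ v₂, ∀ ω, pt M u v ω ∈ W)
    {P Q B : Pt → ℝ} {Y : Fin 3 → Pt → ℝ} (hP : SmoothOn P W) (hQ : SmoothOn Q W)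
    (hY : ∀ a, SmoothOn (Y a) W)
    (hB : ∀ u ∈ Icc u₁ u₂, ∀ v ∈ Icc v₁ v₂, ∀ ω, B (pt M u v ω)
      = der (Lbar M) P (pt M u v ω) + der (L M) Q (pt M u v ω)
        + ∑ a, der (rot a) (Y a) (pt M u v ω)) :
    ∫ u in u₁..u₂, ∫ v in v₁..v₂, ∫ ω, B (pt M u v ω) ∂dS2
      = 2 * ((∫ v in v₁..v₂, ∫ ω, P (pt M u₂ v ω) ∂dS2)
          - ∫ v in v₁..v₂, ∫ ω, P (pt M u₁ v ω) ∂dS2)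
        + 2 * ((∫ u in u₁..u₂, ∫ ω, Q (pt M u v₂ ω) ∂dS2)
          - ∫ u in u₁..u₂, ∫ ω, Q (pt M u v₁ ω) ∂dS2) := by
  have hdP := contDiffOn_der hW ((contDiffOn_Lbar hM).mono hWM) hP
  have hdQ := contDiffOn_der hW ((contDiffOn_L hM).mono hWM) hQ
  have hdY := fun a => contDiffOn_der hW (contDiff_rot a).contDiffOn (hY a)
  have hcont : ∀ {F : Pt → ℝ}, SmoothOn F W → ∀ u ∈ Icc u₁ u₂, ∀ v ∈ Icc v₁ v₂,
      Continuous fun ω => F (pt M u v ω) := fun hF u hu v hv =>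
    hF.continuousOn.comp_continuous ((continuous_pt hM).comp
      (by fun_prop : Continuous fun ω : S2 => (u, v, ω))) (hpt u hu v hv)
  obtain ⟨HP, hHP, hHPe⟩ := exists_continuous_extension₂ hu hv
    (G := fun u v ω => der (Lbar M) P (pt M u v ω)) (continuousOn_pt hM hdP.continuousOn hpt)
  obtain ⟨HQ, hHQ, hHQe⟩ := exists_continuous_extension₂ hu hv
    (G := fun u v ω => der (L M) Q (pt M u v ω)) (continuousOn_pt hM hdQ.continuousOn hpt)
  have hcP := continuous_integral_dS2₂ hHP
  have hcQ := continuous_integral_dS2₂ hHQ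
  -- the rotations drop out of the integral over each sphere
  have hinner : ∀ u ∈ Icc u₁ u₂, ∀ v ∈ Icc v₁ v₂, ∫ ω, B (pt M u v ω) ∂dS2
      = (∫ ω, HP u v ω ∂dS2) + ∫ ω, HQ u v ω ∂dS2 := by
    intro u hu' v hv'
    simp only [hB u hu' v hv', hHPe u hu' v hv', hHQe u hu' v hv']
    have iP := integrable_dS2 (hcont hdP u hu' v hv')
    have iQ := integrable_dS2 (hcont hdQ u hu' v hv')
    have iY := fun a => integrable_dS2 (hcont (hdY a) u hu' v hv')
    have iPQ : Integrable (fun ω => der (Lbar M) P (pt M u v ω) + der (L M) Q (pt M u v ω)) dS2 :=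
      iP.add iQ
    rw [integral_add iPQ (integrable_finsetSum _ fun a _ => iY a), integral_add iP iQ,
      integral_finsetSum _ fun a _ => iY a]
    have : ∀ a, ∫ ω, der (rot a) (Y a) (pt M u v ω) ∂dS2 = 0 := fun a =>
      integral_rot_eq_zero hM u v a
        (fun ω => differentiableAt_of_mem hW (hY a) (hpt u hu' v hv' ω))
        (hcont (hdY a) u hu' v hv')
    simp [this]
  rw [integral_congr_rectangle hu hv hinner]
  have hcu : ∀ {K : ℝ → ℝ → ℝ}, Continuous (uncurry K) → ∀ u, Continuous fun v => K u v :=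
    fun hK u => hK.comp (by fun_prop : Continuous fun v : ℝ => (u, v))
  -- the part with `L̲ P` is to be integrated in `u` first
  have hsplit : ∫ u in u₁..u₂, ∫ v in v₁..v₂,
        ((∫ ω, HP u v ω ∂dS2) + ∫ ω, HQ u v ω ∂dS2)
      = (∫ v in v₁..v₂, ∫ u in u₁..u₂, ∫ ω, HP u v ω ∂dS2)
        + ∫ u in u₁..u₂, ∫ v in v₁..v₂, ∫ ω, HQ u v ω ∂dS2 := by
    rw [intervalIntegral_intervalIntegral_swap (F := fun v u => ∫ ω, HP u v ω ∂dS2)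
      ((hcP.comp continuous_swap).continuousOn.integrableOn_compact
        (isCompact_uIcc.prod isCompact_uIcc) |>.mono_set
          (prod_mono uIoc_subset_uIcc uIoc_subset_uIcc)),
      ← intervalIntegral.integral_add]
    · refine intervalIntegral.integral_congr fun u _ => ?_
      exact intervalIntegral.integral_add ((hcu hcP u).intervalIntegrable _ _)
        ((hcu hcQ u).intervalIntegrable _ _)
    · exact (intervalIntegral.continuous_parametric_intervalIntegral_of_continuous'
        hcP _ _).intervalIntegrable _ _
    · exact (intervalIntegral.continuous_parametric_intervalIntegral_of_continuous'
        hcQ _ _).intervalIntegrable _ _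
  rw [hsplit]
  have hu₁ : u₁ ∈ Icc u₁ u₂ := left_mem_Icc.2 hu
  have hu₂ : u₂ ∈ Icc u₁ u₂ := right_mem_Icc.2 hu
  have hv₁ : v₁ ∈ Icc v₁ v₂ := left_mem_Icc.2 hv
  have hv₂ : v₂ ∈ Icc v₁ v₂ := right_mem_Icc.2 hv
  rw [← integral_integral_sub hv (continuousOn_pt_v hM hP.continuousOn (hpt u₂ hu₂))
      (continuousOn_pt_v hM hP.continuousOn (hpt u₁ hu₁)),
    ← integral_integral_sub hu
      (continuousOn_pt_u hM hQ.continuousOn fun u hu' => hpt u hu' v₂ hv₂)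
      (continuousOn_pt_u hM hQ.continuousOn fun u hu' => hpt u hu' v₁ hv₁),
    ← intervalIntegral.integral_const_mul, ← intervalIntegral.integral_const_mul]
  congr 1
  · refine intervalIntegral.integral_congr fun v hv' => ?_
    rw [uIcc_of_le hv] at hv'
    beta_reduce
    rw [← integral_der_Lbar hM hu hW hWM hP fun u hu' => hpt u hu' v hv']
    refine intervalIntegral.integral_congr fun u hu' => ?_
    rw [uIcc_of_le hu] at hu'
    simp only [hHPe u hu' v hv']
  · refine intervalIntegral.integral_congr fun u hu' => ?_
    rw [uIcc_of_le hu] at hu'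
    beta_reduce
    rw [← integral_der_L hM hv hW hWM hQ fun v hv' => hpt u hu' v hv']
    refine intervalIntegral.integral_congr fun v hv' => ?_
    rw [uIcc_of_le hv] at hv'
    simp only [hHQe u hu' v hv']

/-! ### The projected connection in the chart -/

section PartialDerivatives

variable {f g : Pt → ℝ} {p : Pt}

theorem pd_const (i : Fin 4) (c : ℝ) (p : Pt) : pd i (fun _ => c) p = 0 := by simp [pd]

theorem pd_add (i : Fin 4) (hf : DifferentiableAt ℝ f p) (hg : DifferentiableAt ℝ g p) :
    pd i (fun q => f q + g q) p = pd i f p + pd i g p := by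
  simp [pd, fderiv_fun_add hf hg]

theorem pd_sub (i : Fin 4) (hf : DifferentiableAt ℝ f p) (hg : DifferentiableAt ℝ g p) :
    pd i (fun q => f q - g q) p = pd i f p - pd i g p := by
  simp [pd, fderiv_fun_sub hf hg]

theorem pd_mul (i : Fin 4) (hf : DifferentiableAt ℝ f p) (hg : DifferentiableAt ℝ g p) :
    pd i (fun q => f q * g q) p = f p * pd i g p + g p * pd i f p := by
  simp [pd, fderiv_fun_mul hf hg]

theorem pd_congr (i : Fin 4) {W : Set Pt} (hW : IsOpen W) (hfg : ∀ q ∈ W, f q = g q)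
    (hp : p ∈ W) : pd i f p = pd i g p := by
  have : f =ᶠ[𝓝 p] g := by
    filter_upwards [hW.mem_nhds hp] with q hq using hfg q hq
  rw [pd, pd, this.fderiv_eq]

theorem der_eq_sum (X : Pt → Fin 4 → ℝ) (f : Pt → ℝ) (p : Pt) :
    der X f p = ∑ i, X p i * pd i f p := by
  conv_lhs => rw [der, pi_eq_sum_univ' (X p)]
  simp [pd, map_sum]

end PartialDerivatives

theorem dr_zero (p : Pt) : dr p 0 = 0 := rfl

theorem sum_dr_sq {p : Pt} (hp : 0 < rad p) : dr p 1 ^ 2 + dr p 2 ^ 2 + dr p 3 ^ 2 = 1 := by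
  have h := rad_sq p
  have h0 := hp.ne'
  simp only [dr, Matrix.cons_val]
  field_simp
  linarith

theorem pd_coord (i j : Fin 4) (p : Pt) : pd i (fun q => q j) p = if i = j then 1 else 0 := by
  have : HasFDerivAt (fun q : Pt => q j) (ContinuousLinearMap.proj (R := ℝ) j) p :=
    (ContinuousLinearMap.proj (R := ℝ) (φ := fun _ : Fin 4 => ℝ) j).hasFDerivAt
  rw [pd, this.fderiv]
  simp [Pi.single_apply, eq_comm]

theorem differentiableAt_rad {p : Pt} (hp : 0 < rad p) : DifferentiableAt ℝ rad p :=
  (contDiffAt_rad hp).differentiableAt (by simp)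

theorem pd_rad (i : Fin 4) {p : Pt} (hp : 0 < rad p) : pd i rad p = dr p i := by
  have hd := differentiableAt_rad hp
  have h1 : pd i (fun q => rad q * rad q) p
      = pd i (fun q => q 1 * q 1 + q 2 * q 2 + q 3 * q 3) p := by
    congr 1
    ext q
    have := rad_sq q
    nlinarith
  have hc : ∀ j : Fin 4, DifferentiableAt ℝ (fun q : Pt => q j) p := fun j => by fun_prop
  rw [pd_mul i hd hd, pd_add i (by fun_prop) (by fun_prop), pd_add i (by fun_prop) (by fun_prop),
    pd_mul i (hc 1) (hc 1), pd_mul i (hc 2) (hc 2), pd_mul i (hc 3) (hc 3)] at h1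
  simp only [pd_coord] at h1
  have h0 := hp.ne'
  fin_cases i <;> simp [dr] at h1 ⊢
  · exact h1.resolve_left h0
  all_goals
    field_simp
    linarith

theorem differentiableAt_div_rad {f : Pt → ℝ} {p : Pt} (hf : DifferentiableAt ℝ f p)
    (hp : 0 < rad p) : DifferentiableAt ℝ (fun q => f q / rad q) p := by
  have := (differentiableAt_rad hp).fun_inv hp.ne'
  simpa only [div_eq_mul_inv] using hf.fun_mul this

theorem differentiableAt_dr {p : Pt} (hp : 0 < rad p) (j : Fin 4) :
    DifferentiableAt ℝ (fun q => dr q j) p := by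
  have h : ∀ k : Fin 4, DifferentiableAt ℝ (fun q : Pt => q k / rad q) p := fun k =>
    differentiableAt_div_rad (by fun_prop) hp
  fin_cases j
  · simp [dr]
  · simpa [dr] using h 1
  · simpa [dr] using h 2
  · simpa [dr] using h 3

theorem dr_mul_rad {p : Pt} (hp : 0 < rad p) (j : Fin 4) :
    dr p j * rad p = if j = 0 then 0 else p j := by
  have h0 := hp.ne'
  fin_cases j <;> simp [dr, h0]

/-- The Hessian of `r`, that is, the second fundamental form of the round spheres. -/
theorem pd_dr (i j : Fin 4) {p : Pt} (hp : 0 < rad p) :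
    pd i (fun q => dr q j) p = sph p i j / rad p := by
  have h0 := hp.ne'
  have hopen : IsOpen {q : Pt | 0 < rad q} :=
    isOpen_lt continuous_const (by unfold rad; fun_prop)
  have h1 : pd i (fun q => dr q j * rad q) p = pd i (fun q => if j = 0 then 0 else q j) p :=
    pd_congr i hopen (fun q hq => dr_mul_rad hq j) hp
  rw [pd_mul i (differentiableAt_dr hp j) (differentiableAt_rad hp), pd_rad i hp] at h1
  have h2 : pd i (fun q : Pt => if j = 0 then 0 else q j) p
      = (if i = j then 1 else 0) - dt i * dt j := by
    by_cases hj : j = 0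
    · subst hj
      fin_cases i <;> simp [pd_const, dt]
    · simp only [hj, if_false, pd_coord]
      have : dt j = 0 := by
        fin_cases j <;> simp [dt] at hj ⊢
      simp [this]
  rw [h2] at h1
  rw [sph, eq_div_iff h0]
  linarith

/-- Covectors at `p` that are tangent to the spheres of constant `t` and `r`. -/
def IsTangent (p : Pt) (η : Fin 4 → ℝ) : Prop :=
  η 0 = 0 ∧ dr p 1 * η 1 + dr p 2 * η 2 + dr p 3 * η 3 = 0

theorem sph_symm (p : Pt) (i j : Fin 4) : sph p i j = sph p j i := by
  simp only [sph, eq_comm (a := i)]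
  ring

theorem isTangent_sph {p : Pt} (hp : 0 < rad p) (j : Fin 4) : IsTangent p fun i => sph p i j := by
  have h := sum_dr_sq hp
  refine ⟨?_, ?_⟩
  · fin_cases j <;> simp [sph, dt, dr_zero]
  · fin_cases j <;> simp [sph, dt, dr_zero]
    · linear_combination (-dr p 1) * h
    · linear_combination (-dr p 2) * h
    · linear_combination (-dr p 3) * h

/-- Projection to the spheres, expanded. -/
theorem sum_sph_mul (p : Pt) (j : Fin 4) (η : Fin 4 → ℝ) :
    ∑ b, sph p j b * η b
      = η j - dt j * η 0 - dr p j * (dr p 1 * η 1 + dr p 2 * η 2 + dr p 3 * η 3) := by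
  fin_cases j <;> simp [Fin.sum_univ_four, sph, dt, dr_zero] <;> ring

theorem IsTangent.sum_sph_mul {p : Pt} {η : Fin 4 → ℝ} (hη : IsTangent p η) (j : Fin 4) :
    ∑ b, sph p j b * η b = η j := by
  rw [FackerellIpser.sum_sph_mul, hη.1, hη.2]
  ring

theorem one_sub_mu_pos {M : ℝ} (hM : 0 < M) {p : Pt} (hp : p ∈ exterior M) : 0 < 1 - mu M p := by
  have hr := rad_pos hM hp
  have : 2 * M < rad p := hp
  rw [mu, sub_pos, div_lt_one hr]
  exact this

/-- The inverse metric acts as the identity on covectors tangent to the spheres. -/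
theorem sum_mul_metric_inv {M : ℝ} (hM : 0 < M) {p : Pt} (hp : p ∈ exterior M) {η : Fin 4 → ℝ}
    (hη : IsTangent p η) (l : Fin 4) : ∑ k, η k * (metric M p)⁻¹ k l = η l := by
  have ha := (one_sub_mu_pos hM hp).ne'
  have hn := sum_dr_sq (rad_pos hM hp)
  set a := 1 - mu M p with ha_def
  let N : Matrix (Fin 4) (Fin 4) ℝ := Matrix.of fun i j =>
    -a⁻¹ * dt i * dt j + a * dr p i * dr p j + sph p i j
  have hmul : metric M p * N = 1 := by
    let T : Matrix (Fin 4) (Fin 4) ℝ := Matrix.vecMulVec dt dt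
    let R : Matrix (Fin 4) (Fin 4) ℝ := Matrix.vecMulVec (dr p) (dr p)
    have hTT : T * T = T := by
      have : dt ⬝ᵥ dt = 1 := by simp [dotProduct, Fin.sum_univ_four, dt]
      simp only [T, Matrix.vecMulVec_mul_vecMulVec, this]
      simp
    have hRR : R * R = R := by
      have : dr p ⬝ᵥ dr p = 1 := by
        simp [dotProduct, Fin.sum_univ_four, dr_zero]; linarith
      simp [R, Matrix.vecMulVec_mul_vecMulVec, this]
    have hTR : T * R = 0 := by
      have : dt ⬝ᵥ dr p = 0 := by simp [dotProduct, Fin.sum_univ_four, dt, dr_zero]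
      simp [T, R, Matrix.vecMulVec_mul_vecMulVec, this]
    have hRT : R * T = 0 := by
      have : dr p ⬝ᵥ dt = 0 := by simp [dotProduct, Fin.sum_univ_four, dt, dr_zero]
      simp [T, R, Matrix.vecMulVec_mul_vecMulVec, this]
    have hg : metric M p = (-a) • T + a⁻¹ • R + (1 - T - R) := by
      ext i j
      simp [metric, T, R, Matrix.vecMulVec_apply, sph, Matrix.one_apply, ← ha_def]
      ring
    have hN : N = (-a⁻¹) • T + a • R + (1 - T - R) := by
      ext i j
      simp [N, T, R, Matrix.vecMulVec_apply, sph, Matrix.one_apply]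
      ring
    rw [hg, hN]
    simp only [add_mul, mul_add, sub_mul, mul_sub, smul_mul_assoc, mul_smul_comm, hTT, hRR, hTR,
      hRT, smul_zero, mul_one, one_mul]
    simp [ha]
    abel
  rw [Matrix.inv_eq_right_inv hmul]
  have h1 := hη.1
  have h2 := hη.2
  have h3 : ∑ k, η k * N k l
      = -a⁻¹ * dt l * η 0 + a * dr p l * (dr p 1 * η 1 + dr p 2 * η 2 + dr p 3 * η 3)
        + ∑ k, sph p l k * η k := by
    simp only [N, Matrix.of_apply, Fin.sum_univ_four, sph_symm p _ l]
    simp [dt, dr_zero]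
    ring
  rw [h3, hη.sum_sph_mul, h1, h2]
  ring

theorem pd_metric {M : ℝ} (hM : 0 < M) {p : Pt} (hp : p ∈ exterior M) (i j l : Fin 4) :
    pd i (fun q => metric M q j l) p
      = pd i (mu M) p * (dt j * dt l) + pd i (fun q => (1 - mu M q)⁻¹) p * (dr p j * dr p l)
        + ((1 - mu M p)⁻¹ - 1) * (sph p i j * dr p l + dr p j * sph p i l) / rad p := by
  have hr := rad_pos hM hp
  have ha := (one_sub_mu_pos hM hp).ne'
  have hmu : DifferentiableAt ℝ (mu M) p :=
    differentiableAt_div_rad (differentiableAt_const _) hr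
  have hinv : DifferentiableAt ℝ (fun q => (1 - mu M q)⁻¹) p :=
    DifferentiableAt.inv ((differentiableAt_const _).sub hmu) ha
  have hdr := fun j => differentiableAt_dr hr j
  have h1 : (fun q => metric M q j l) = fun q => (mu M q * (dt j * dt l)
      + ((1 - mu M q)⁻¹ - 1) * (dr q j * dr q l)) + ((if j = l then 1 else 0) - 2 * (dt j * dt l)) := by
    ext q
    simp [metric, sph]
    ring
  have e1 : DifferentiableAt ℝ (fun q => mu M q * (dt j * dt l)) p := hmu.mul_const _
  have e2 : DifferentiableAt ℝ (fun q => dr q j * dr q l) p := (hdr j).mul (hdr l)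
  have e3 : DifferentiableAt ℝ (fun q => (1 - mu M q)⁻¹ - 1) p := hinv.sub_const _
  have e4 : DifferentiableAt ℝ (fun q => ((1 - mu M q)⁻¹ - 1) * (dr q j * dr q l)) p := e3.mul e2
  rw [h1, pd_add i (e1.fun_add e4) (differentiableAt_const _), pd_add i e1 e4,
    pd_mul i hmu (differentiableAt_const _), pd_mul i e3 e2, pd_mul i (hdr j) (hdr l),
    pd_sub i hinv (differentiableAt_const _), pd_dr i j hr, pd_dr i l hr]
  simp only [pd_const]
  ring

/-- The Christoffel symbols with two indices tangent to the spheres, one of them the upper index,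
vanish: in this chart the projected connection is the projection of the flat one. -/
theorem sum_mul_christoffel {M : ℝ} (hM : 0 < M) {p : Pt} (hp : p ∈ exterior M)
    {η ψ : Fin 4 → ℝ} (hη : IsTangent p η) (hψ : IsTangent p ψ) (a : Fin 4) :
    ∑ b, ψ b * ∑ k, christoffel M p k a b * η k = 0 := by
  have h1 : ∀ b, ∑ k, christoffel M p k a b * η k
      = (1 / 2) * ∑ l, η l * (pd a (fun q => metric M q b l) p + pd b (fun q => metric M q a l) p
          - pd l (fun q => metric M q a b) p) := by
    intro b
    simp only [christoffel]
    have : ∀ l, η l = ∑ k, η k * (metric M p)⁻¹ k l := fun l => (sum_mul_metric_inv hM hp hη l).symm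
    conv_rhs =>
      enter [2, 2, l]
      rw [this l, Finset.sum_mul]
    rw [Finset.sum_comm, Finset.mul_sum]
    refine Finset.sum_congr rfl fun k _ => ?_
    rw [mul_assoc, Finset.sum_mul]
    congr 1
    exact Finset.sum_congr rfl fun l _ => by ring
  have s1 := hη.sum_sph_mul
  have s2 := hψ.sum_sph_mul
  have hsum : ∀ b, ∑ k, christoffel M p k a b * η k
      = (1 / 2) * (∑ l, η l * (pd a (fun q => metric M q b l) p)
          + ∑ l, η l * pd b (fun q => metric M q a l) p
          - ∑ l, η l * pd l (fun q => metric M q a b) p) := by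
    intro b
    rw [h1, ← Finset.sum_add_distrib, ← Finset.sum_sub_distrib]
    congr 1
    exact Finset.sum_congr rfl fun l _ => by ring
  set c := (1 - mu M p)⁻¹ - 1 with hc
  have hA : ∀ i j, ∑ l, η l * pd i (fun q => metric M q j l) p = c / rad p * dr p j * η i := by
    intro i j
    simp only [pd_metric hM hp, ← hc]
    conv_rhs => rw [← s1 i]
    have e1 := hη.1
    have e2 := hη.2
    simp only [Fin.sum_univ_four, dt, dr_zero, Matrix.cons_val]
    linear_combination (pd i (mu M) p * (![1, 0, 0, 0] : Fin 4 → ℝ) j) * e1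
      + (pd i (fun q => (1 - mu M q)⁻¹) p * dr p j + c * sph p i j / rad p) * e2
  have hB : ∀ b, ∑ l, η l * pd l (fun q => metric M q a b) p
      = c / rad p * (η a * dr p b + dr p a * η b)
        + (∑ l, η l * pd l (mu M) p) * dt a * dt b
        + (∑ l, η l * pd l (fun q => (1 - mu M q)⁻¹) p) * dr p a * dr p b := by
    intro b
    simp only [pd_metric hM hp, ← hc]
    conv_rhs => rw [← s1 a, ← s1 b]
    simp only [Fin.sum_univ_four, sph_symm p _ a, sph_symm p _ b]
    ring
  simp only [hsum, hA, hB]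
  have e1 := hψ.1
  have e2 := hψ.2
  set A1 := ∑ l, η l * pd l (mu M) p
  set A2 := ∑ l, η l * pd l (fun q => (1 - mu M q)⁻¹) p
  have : ∀ b, ψ b * (1 / 2 * (c / rad p * dr p b * η a + c / rad p * dr p a * η b
      - (c / rad p * (η a * dr p b + dr p a * η b) + A1 * dt a * dt b + A2 * dr p a * dr p b)))
      = -(1 / 2) * A1 * dt a * (ψ b * dt b) - (1 / 2) * A2 * dr p a * (ψ b * dr p b) := by
    intro b; ring
  simp only [this]
  simp only [Fin.sum_univ_four, dt, dr_zero, Matrix.cons_val]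
  linear_combination (-(1 / 2) * A1 * (![1, 0, 0, 0] : Fin 4 → ℝ) a) * e1
    + (-(1 / 2) * A2 * dr p a) * e2

/-! ### Projected derivatives of tangential one-forms -/

theorem differentiableAt_pd {W : Set Pt} (hW : IsOpen W) {f : Pt → ℝ} (hf : SmoothOn f W)
    {p : Pt} (hp : p ∈ W) (i : Fin 4) : DifferentiableAt ℝ (pd i f) p :=
  differentiableAt_of_mem hW (contDiffOn_der hW (X := fun _ => Pi.single i 1) contDiffOn_const hf) hp

theorem IsSmoothSphereForm.isTangent {M : ℝ} (hM : 0 < M) {φ : OneForm} {W : Set Pt}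
    (hWM : W ⊆ exterior M) (hφ : IsSmoothSphereForm M φ W) {p : Pt} (hp : p ∈ W) :
    IsTangent p (φ p) := by
  have h1 := hφ.apply_L p hp
  have h2 := hφ.apply_Lbar p hp
  have ha := one_sub_mu_pos hM (hWM hp)
  simp only [L, Lbar, Fin.sum_univ_four, dt, dr_zero, Matrix.cons_val] at h1 h2
  refine ⟨by linarith, ?_⟩
  have : (1 - mu M p) * (dr p 1 * φ p 1 + dr p 2 * φ p 2 + dr p 3 * φ p 3) = 0 := by linarith
  exact (mul_eq_zero.1 this).resolve_left ha.ne'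

/-- Derivatives of a tangential form along a vector field normal to the spheres are tangential. -/
theorem isTangent_der {φ : OneForm} {W : Set Pt} (hW : IsOpen W)
    (hr : ∀ p ∈ W, 0 < rad p) (hφ : ∀ j, SmoothOn (fun q => φ q j) W)
    (ht : ∀ p ∈ W, IsTangent p (φ p)) {X : Pt → Fin 4 → ℝ} {p : Pt} (hp : p ∈ W)
    (hX : ∀ j, ∑ i, X p i * sph p i j = 0) : IsTangent p fun j => der X (fun q => φ q j) p := by
  have hd := fun j => differentiableAt_of_mem hW (hφ j) hp
  have hdr := fun j => differentiableAt_dr (hr p hp) j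
  have hXdr : ∀ j, ∑ i, X p i * pd i (fun q => dr q j) p = 0 := by
    intro j
    have := hX j
    simp only [pd_dr _ _ (hr p hp), mul_div_assoc', ← Finset.sum_div, this, zero_div]
  constructor
  · beta_reduce
    rw [der_eq_sum]
    refine Finset.sum_eq_zero fun i _ => ?_
    rw [pd_congr i hW (fun q hq => (ht q hq).1) hp, pd_const, mul_zero]
  · have h0 : ∑ i, X p i * pd i (fun q => dr q 1 * φ q 1 + dr q 2 * φ q 2 + dr q 3 * φ q 3) p
        = 0 := by
      refine Finset.sum_eq_zero fun i _ => ?_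
      rw [pd_congr i hW (fun q hq => (ht q hq).2) hp, pd_const, mul_zero]
    have hm : ∀ j, DifferentiableAt ℝ (fun q => dr q j * φ q j) p := fun j =>
      (hdr j).fun_mul (hd j)
    simp only [pd_add _ ((hm 1).fun_add (hm 2)) (hm 3), pd_add _ (hm 1) (hm 2),
      pd_mul _ (hdr _) (hd _)] at h0
    simp only [der_eq_sum]
    have h1 := hXdr 1
    have h2 := hXdr 2
    have h3 := hXdr 3
    simp only [Fin.sum_univ_four] at h0 h1 h2 h3 ⊢
    linear_combination h0 - φ p 1 * h1 - φ p 2 * h2 - φ p 3 * h3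

/-- The normal component of a derivative of a tangential form is given by the form itself. -/
theorem sum_dr_mul_pd {φ : OneForm} {W : Set Pt} (hW : IsOpen W)
    (hr : ∀ p ∈ W, 0 < rad p) (hφ : ∀ j, SmoothOn (fun q => φ q j) W)
    (ht : ∀ p ∈ W, IsTangent p (φ p)) {p : Pt} (hp : p ∈ W) (i : Fin 4) :
    dr p 1 * pd i (fun q => φ q 1) p + dr p 2 * pd i (fun q => φ q 2) p
      + dr p 3 * pd i (fun q => φ q 3) p = -φ p i / rad p := by
  have hd := fun j => differentiableAt_of_mem hW (hφ j) hp
  have hdr := fun j => differentiableAt_dr (hr p hp) j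
  have h0 : pd i (fun q => dr q 1 * φ q 1 + dr q 2 * φ q 2 + dr q 3 * φ q 3) p = 0 := by
    rw [pd_congr i hW (fun q hq => (ht q hq).2) hp, pd_const]
  have hm : ∀ j, DifferentiableAt ℝ (fun q => dr q j * φ q j) p := fun j =>
    (hdr j).fun_mul (hd j)
  simp only [pd_add _ ((hm 1).fun_add (hm 2)) (hm 3), pd_add _ (hm 1) (hm 2),
    pd_mul _ (hdr _) (hd _), pd_dr _ _ (hr p hp)] at h0
  have h1 := (ht p hp).sum_sph_mul i
  have e1 := (ht p hp).1
  simp only [Fin.sum_univ_four] at h1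
  have h2 : -φ p i / rad p
      = -(sph p i 0 * φ p 0 + sph p i 1 * φ p 1 + sph p i 2 * φ p 2 + sph p i 3 * φ p 3) / rad p := by
    rw [h1]
  rw [h2]
  linear_combination h0 + sph p i 0 / rad p * e1

theorem sum_sph_L {M : ℝ} {p : Pt} (hp : 0 < rad p) (j : Fin 4) :
    ∑ i, L M p i * sph p i j = 0 := by
  have h1 := (isTangent_sph hp j).1
  have h2 := (isTangent_sph hp j).2
  simp only [L, Fin.sum_univ_four, dt, dr_zero, Matrix.cons_val]
  linear_combination h1 + (1 - mu M p) * h2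

theorem sum_sph_Lbar {M : ℝ} {p : Pt} (hp : 0 < rad p) (j : Fin 4) :
    ∑ i, Lbar M p i * sph p i j = 0 := by
  have h1 := (isTangent_sph hp j).1
  have h2 := (isTangent_sph hp j).2
  simp only [Lbar, Fin.sum_univ_four, dt, dr_zero, Matrix.cons_val]
  linear_combination h1 - (1 - mu M p) * h2

theorem sum_mul_nablaOne {M : ℝ} (hM : 0 < M) {p : Pt} (hp : p ∈ exterior M) {φ : OneForm}
    (hφ : IsTangent p (φ p)) {ψ : Fin 4 → ℝ} (hψ : IsTangent p ψ) (a : Fin 4) :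
    ∑ b, ψ b * nablaOne M φ p a b = ∑ b, ψ b * pd a (fun q => φ q b) p := by
  simp only [nablaOne, mul_sub, Finset.sum_sub_distrib, sum_mul_christoffel hM hp hφ hψ a, sub_zero]

theorem slashAlong_eq_der {M : ℝ} (hM : 0 < M) {φ : OneForm} {W : Set Pt} (hW : IsOpen W)
    (hWM : W ⊆ exterior M) (hφ : ∀ j, SmoothOn (fun q => φ q j) W)
    (ht : ∀ p ∈ W, IsTangent p (φ p)) {X : Pt → Fin 4 → ℝ} {p : Pt} (hp : p ∈ W)
    (hX : ∀ j, ∑ i, X p i * sph p i j = 0) (j : Fin 4) :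
    slashAlong M X φ p j = der X (fun q => φ q j) p := by
  have hr := fun q (hq : q ∈ W) => rad_pos hM (hWM hq)
  have h1 := fun a => sum_mul_nablaOne hM (hWM hp) (ht p hp) (isTangent_sph (hr p hp) j) a
  rw [← (isTangent_der hW hr hφ ht hp hX).sum_sph_mul j]
  simp only [slashAlong, der_eq_sum, Finset.mul_sum]
  rw [Finset.sum_comm]
  conv_rhs => rw [Finset.sum_comm]
  refine Finset.sum_congr rfl fun a _ => ?_
  have := h1 a
  simp only [sph_symm p _ j] at this
  have h2 := congrArg (X p a * ·) this
  simp only [Finset.mul_sum] at h2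
  convert h2 using 2 <;> ring

theorem slashGrad_eq_sum {M : ℝ} (hM : 0 < M) {p : Pt} (hp : p ∈ exterior M) {φ : OneForm}
    (hφ : IsTangent p (φ p)) (i j : Fin 4) :
    slashGrad M φ p i j = ∑ a, sph p i a * ∑ b, sph p j b * pd a (fun q => φ q b) p := by
  have h1 := fun a => sum_mul_nablaOne hM hp hφ (isTangent_sph (rad_pos hM hp) j) a
  simp only [sph_symm p _ j] at h1
  simp only [slashGrad, ← h1, Finset.mul_sum, mul_assoc]

/-- The angular gradient of a tangential one-form in terms of Cartesian partial derivatives. -/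
theorem slashGrad_eq {M : ℝ} (hM : 0 < M) {φ : OneForm} {W : Set Pt} (hW : IsOpen W)
    (hWM : W ⊆ exterior M) (hφ : ∀ j, SmoothOn (fun q => φ q j) W)
    (ht : ∀ p ∈ W, IsTangent p (φ p)) {p : Pt} (hp : p ∈ W) (b c : Fin 4) :
    slashGrad M φ p b c = pd b (fun q => φ q c) p - dt b * pd 0 (fun q => φ q c) p
      - dr p b * der dr (fun q => φ q c) p + dr p c * (φ p b / rad p) := by
  have hr := fun q (hq : q ∈ W) => rad_pos hM (hWM hq)
  have h0 : ∀ a, pd a (fun q => φ q 0) p = 0 := fun a => by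
    rw [pd_congr a hW (fun q hq => (ht q hq).1) hp, pd_const]
  have h1 : ∀ a, ∑ d, sph p c d * pd a (fun q => φ q d) p
      = pd a (fun q => φ q c) p + dr p c * (φ p a / rad p) := by
    intro a
    rw [sum_sph_mul, sum_dr_mul_pd hW hr hφ ht hp a, h0]
    ring
  have h2 : ∀ a, sph p b a * (pd a (fun q => φ q c) p + dr p c * (φ p a / rad p))
      = sph p b a * pd a (fun q => φ q c) p + dr p c / rad p * (sph p b a * φ p a) := by
    intro a; ring
  rw [slashGrad_eq_sum hM (hWM hp) (ht p hp)]
  simp only [h1, h2, Finset.sum_add_distrib, ← Finset.mul_sum, (ht p hp).sum_sph_mul]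
  rw [sum_sph_mul p b fun a => pd a (fun q => φ q c) p, der_eq_sum, Fin.sum_univ_four, dr_zero]
  ring

theorem isTangent_slashGrad_left {M : ℝ} (hM : 0 < M) {p : Pt} (hp : p ∈ exterior M) {φ : OneForm}
    (j : Fin 4) : IsTangent p fun i => slashGrad M φ p i j := by
  have h : ∀ a, IsTangent p fun i => sph p i a := isTangent_sph (rad_pos hM hp)
  constructor
  · refine Finset.sum_eq_zero fun a _ => Finset.sum_eq_zero fun b _ => ?_
    have := (h a).1
    simp only at this
    rw [this]; ring
  · simp only [slashGrad, Finset.mul_sum, ← Finset.sum_add_distrib]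
    refine Finset.sum_eq_zero fun a _ => Finset.sum_eq_zero fun b _ => ?_
    have := (h a).2
    linear_combination sph p j b * nablaOne M φ p a b * this

theorem isTangent_slashGrad_right {M : ℝ} (hM : 0 < M) {p : Pt} (hp : p ∈ exterior M)
    {φ : OneForm} (i : Fin 4) : IsTangent p fun j => slashGrad M φ p i j := by
  have h : ∀ a, IsTangent p fun i => sph p i a := isTangent_sph (rad_pos hM hp)
  constructor
  · refine Finset.sum_eq_zero fun a _ => Finset.sum_eq_zero fun b _ => ?_
    have := (h b).1
    simp only at this
    rw [this]; ring
  · simp only [slashGrad, Finset.mul_sum, ← Finset.sum_add_distrib]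
    refine Finset.sum_eq_zero fun a _ => Finset.sum_eq_zero fun b _ => ?_
    have := (h b).2
    linear_combination sph p i a * nablaOne M φ p a b * this

/-- Contraction of `∇T` with tangential vectors, for a tangential tensor `T`, does not see the
Christoffel symbols. -/
theorem sum_mul_nablaTwo {M : ℝ} (hM : 0 < M) {p : Pt} (hp : p ∈ exterior M) {T : TwoTensor}
    (hl : ∀ j, IsTangent p fun i => T p i j) (hr : ∀ i, IsTangent p fun j => T p i j)
    {ξ ψ : Fin 4 → ℝ} (hξ : IsTangent p ξ) (hψ : IsTangent p ψ) (a : Fin 4) :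
    ∑ b, ∑ c, ξ b * ψ c * nablaTwo M T p a b c
      = ∑ b, ∑ c, ξ b * ψ c * pd a (fun q => T q b c) p := by
  simp only [nablaTwo, mul_sub, Finset.sum_sub_distrib]
  have h1 : ∑ b, ∑ c, ξ b * ψ c * ∑ l, christoffel M p l a b * T p l c = 0 := by
    rw [Finset.sum_comm]
    refine Finset.sum_eq_zero fun c _ => ?_
    have := sum_mul_christoffel hM hp (hl c) hξ a
    rw [← mul_zero (ψ c), ← this, Finset.mul_sum]
    exact Finset.sum_congr rfl fun b _ => by ring
  have h2 : ∑ b, ∑ c, ξ b * ψ c * ∑ l, christoffel M p l a c * T p b l = 0 := by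
    refine Finset.sum_eq_zero fun b _ => ?_
    have := sum_mul_christoffel hM hp (hr b) hψ a
    rw [← mul_zero (ξ b), ← this, Finset.mul_sum]
    exact Finset.sum_congr rfl fun b _ => by ring
  rw [h1, h2]
  ring

/-- The angular Laplacian paired with a tangential vector. -/
theorem sum_mul_slashLaplacian {M : ℝ} (hM : 0 < M) {p : Pt} (hp : p ∈ exterior M) {φ : OneForm}
    {ψ : Fin 4 → ℝ} (hψ : IsTangent p ψ) :
    ∑ k, ψ k * slashLaplacian M φ p k
      = ∑ a, ∑ b, ∑ c, sph p a b * ψ c * pd a (fun q => slashGrad M φ q b c) p := by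
  have hr := rad_pos hM hp
  have hH : ∀ i j k, slashHess M φ p i j k = ∑ a, ∑ b, ∑ c,
      sph p i a * (sph p j b * sph p k c * pd a (fun q => slashGrad M φ q b c) p) := by
    intro i j k
    have := fun a => sum_mul_nablaTwo hM hp (isTangent_slashGrad_left hM hp (φ := φ))
      (isTangent_slashGrad_right hM hp) (isTangent_sph hr j) (isTangent_sph hr k) a
    simp only [sph_symm p _ j, sph_symm p _ k] at this
    simp only [slashHess, mul_assoc, ← Finset.mul_sum] at this ⊢
    exact Finset.sum_congr rfl fun a _ => by rw [this a]
  have hPP : ∀ a b, ∑ i, ∑ j, (metric M p)⁻¹ i j * (sph p i a * sph p j b) = sph p a b := by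
    intro a b
    rw [Finset.sum_comm]
    have : ∀ j, ∑ i, (metric M p)⁻¹ i j * (sph p i a * sph p j b) = sph p a j * sph p j b := by
      intro j
      have := sum_mul_metric_inv hM hp (isTangent_sph hr a) j
      rw [sph_symm p a j, ← this, Finset.sum_mul]
      exact Finset.sum_congr rfl fun i _ => by ring
    simp only [this]
    rw [(isTangent_sph hr b).sum_sph_mul]
  have hL : ∀ k, slashLaplacian M φ p k = ∑ a, ∑ b, ∑ c,
      sph p a b * (sph p k c * pd a (fun q => slashGrad M φ q b c) p) := by
    intro k
    obtain ⟨S, hS⟩ : ∃ S : Fin 4 → Fin 4 → ℝ, ∀ a b, sph p a b = S a b := ⟨_, fun _ _ => rfl⟩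
    have hS' : ∀ a b, S a b = ∑ i, ∑ j, (metric M p)⁻¹ i j * (sph p i a * sph p j b) :=
      fun a b => ((hPP a b).trans (hS a b)).symm
    have hR : ∑ a, ∑ b, ∑ c, sph p a b * (sph p k c * pd a (fun q => slashGrad M φ q b c) p)
        = ∑ a, ∑ b, ∑ c, S a b * (sph p k c * pd a (fun q => slashGrad M φ q b c) p) := by
      simp only [hS]
    rw [hR]
    simp only [slashLaplacian, hH]
    simp only [hS', Finset.mul_sum, Finset.sum_mul]
    calc _ = ∑ i, ∑ a, ∑ j, ∑ b, ∑ c, (metric M p)⁻¹ i j *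
          (sph p i a * (sph p j b * sph p k c * pd a (fun q => slashGrad M φ q b c) p)) :=
          Finset.sum_congr rfl fun i _ => Finset.sum_comm
      _ = ∑ a, ∑ i, ∑ b, ∑ j, ∑ c, (metric M p)⁻¹ i j *
          (sph p i a * (sph p j b * sph p k c * pd a (fun q => slashGrad M φ q b c) p)) := by
          rw [Finset.sum_comm]
          exact Finset.sum_congr rfl fun a _ => Finset.sum_congr rfl fun i _ => Finset.sum_comm
      _ = ∑ a, ∑ b, ∑ i, ∑ c, ∑ j, (metric M p)⁻¹ i j *
          (sph p i a * (sph p j b * sph p k c * pd a (fun q => slashGrad M φ q b c) p)) := by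
          refine Finset.sum_congr rfl fun a _ => ?_
          rw [Finset.sum_comm]
          exact Finset.sum_congr rfl fun b _ => Finset.sum_congr rfl fun i _ => Finset.sum_comm
      _ = _ := by
          refine Finset.sum_congr rfl fun a _ => Finset.sum_congr rfl fun b _ => ?_
          rw [Finset.sum_comm]
          exact Finset.sum_congr rfl fun c _ => Finset.sum_congr rfl fun i _ =>
            Finset.sum_congr rfl fun j _ => by ring
  simp only [hL, Finset.mul_sum]
  calc _ = ∑ a, ∑ k, ∑ b, ∑ c, ψ k *
        (sph p a b * (sph p k c * pd a (fun q => slashGrad M φ q b c) p)) := Finset.sum_comm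
    _ = ∑ a, ∑ b, ∑ c, ∑ k, ψ k *
        (sph p a b * (sph p k c * pd a (fun q => slashGrad M φ q b c) p)) := by
        refine Finset.sum_congr rfl fun a _ => ?_
        rw [Finset.sum_comm]
        exact Finset.sum_congr rfl fun b _ => Finset.sum_comm
    _ = _ := by
        refine Finset.sum_congr rfl fun a _ => Finset.sum_congr rfl fun b _ =>
          Finset.sum_congr rfl fun c _ => ?_
        conv_rhs => rw [← hψ.sum_sph_mul c, Finset.mul_sum, Finset.sum_mul]
        exact Finset.sum_congr rfl fun k _ => by rw [sph_symm p k c]; ring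

/-! ### The equation in terms of the rotations -/

theorem sum_rot_mul_rot (p : Pt) (i j : Fin 4) :
    ∑ a, rot a p i * rot a p j
      = (rad p ^ 2) * ((if i = j then 1 else 0) - dt i * dt j) -
        (if i = 0 then 0 else p i) * (if j = 0 then 0 else p j) := by
  rw [rad_sq]
  fin_cases i <;> fin_cases j <;> simp [Fin.sum_univ_three, rot, dt] <;> ring

theorem sum_rot_mul_rot_eq_sph {p : Pt} (hp : 0 < rad p) (i j : Fin 4) :
    ∑ a, rot a p i * rot a p j = rad p ^ 2 * sph p i j := by
  rw [sum_rot_mul_rot, sph, ← dr_mul_rad hp, ← dr_mul_rad hp]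
  ring

theorem pd_rot (a : Fin 3) (i j : Fin 4) (p : Pt) :
    pd i (fun q => rot a q j) p = rot a (Pi.single i 1) j := by
  have hc : ∀ j : Fin 4, DifferentiableAt ℝ (fun q : Pt => q j) p := fun j => by fun_prop
  have hn : ∀ j : Fin 4, pd i (fun q : Pt => -q j) p = -pd i (fun q => q j) p := fun j => by
    simp [pd, fderiv_fun_neg]
  fin_cases a <;> fin_cases j <;> simp [rot, pd_const, hn, pd_coord, Pi.single_apply, eq_comm]

theorem differentiableAt_rot (a : Fin 3) (j : Fin 4) (p : Pt) :
    DifferentiableAt ℝ (fun q => rot a q j) p :=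
  differentiableAt_pi.1 ((contDiff_rot a).contDiffAt.differentiableAt (by simp)) j

theorem pd_finset_sum {ι : Type*} (s : Finset ι) (i : Fin 4) {f : ι → Pt → ℝ} {p : Pt}
    (hf : ∀ j, DifferentiableAt ℝ (f j) p) :
    pd i (fun q => ∑ j ∈ s, f j q) p = ∑ j ∈ s, pd i (f j) p := by
  simp [pd, fderiv_fun_sum fun j _ => hf j]

/-- The spherical Laplacian of a function is the sum of the squares of the rotations. -/
theorem sum_der_rot_der_rot {W : Set Pt} (hW : IsOpen W) {f : Pt → ℝ} (hf : SmoothOn f W) {p : Pt}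
    (hp : p ∈ W) (hr : 0 < rad p) :
    ∑ a, der (rot a) (der (rot a) f) p
      = rad p ^ 2 * ∑ i, ∑ j, sph p i j * pd i (pd j f) p - 2 * rad p * der dr f p := by
  have hd := fun j => differentiableAt_pd hW hf hp j
  have h1 : ∀ a, der (rot a) (der (rot a) f) p
      = ∑ i, ∑ j, (rot a p i * rot a p j * pd i (pd j f) p
        + rot a p i * rot a (Pi.single i 1) j * pd j f p) := by
    intro a
    rw [der_eq_sum]
    refine Finset.sum_congr rfl fun i _ => ?_
    have h2 : der (rot a) f = fun q => ∑ j, rot a q j * pd j f q := by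
      ext q
      exact der_eq_sum _ _ _
    rw [h2, pd_finset_sum _ _ fun j => (differentiableAt_rot a j p).fun_mul (hd j), Finset.mul_sum]
    refine Finset.sum_congr rfl fun j _ => ?_
    rw [pd_mul i (differentiableAt_rot a j p) (hd j), pd_rot]
    ring
  simp only [h1, Finset.sum_add_distrib]
  have h3 : ∑ a, ∑ i, ∑ j, rot a p i * rot a p j * pd i (pd j f) p
      = rad p ^ 2 * ∑ i, ∑ j, sph p i j * pd i (pd j f) p := by
    rw [Finset.sum_comm, Finset.mul_sum]
    refine Finset.sum_congr rfl fun i _ => ?_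
    rw [Finset.sum_comm, Finset.mul_sum]
    refine Finset.sum_congr rfl fun j _ => ?_
    rw [← Finset.sum_mul, sum_rot_mul_rot_eq_sph hr, mul_assoc]
  have h4 : ∑ a, ∑ i, ∑ j, rot a p i * rot a (Pi.single i 1) j * pd j f p
      = -(2 * rad p * der dr f p) := by
    have e1 := dr_mul_rad hr 1
    have e2 := dr_mul_rad hr 2
    have e3 := dr_mul_rad hr 3
    rw [der_eq_sum]
    simp [Fin.sum_univ_three, Fin.sum_univ_four, rot, dr_zero] at e1 e2 e3 ⊢
    linear_combination 2 * pd 1 f p * e1 + 2 * pd 2 f p * e2 + 2 * pd 3 f p * e3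
  rw [h3, h4]
  ring

/-- On tangential one-forms, `r²` times the angular Laplacian is the tangential part of the sum of
the squares of the rotations, acting on Cartesian components, plus the identity. -/
theorem sum_mul_slashLaplacian_eq {M : ℝ} (hM : 0 < M) {φ : OneForm} {W : Set Pt} (hW : IsOpen W)
    (hWM : W ⊆ exterior M) (hφ : ∀ j, SmoothOn (fun q => φ q j) W)
    (ht : ∀ p ∈ W, IsTangent p (φ p)) {p : Pt} (hp : p ∈ W) {ψ : Fin 4 → ℝ}
    (hψ : IsTangent p ψ) :
    rad p ^ 2 * ∑ k, ψ k * slashLaplacian M φ p k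
      = (∑ c, ψ c * ∑ a, der (rot a) (der (rot a) fun q => φ q c) p) + ∑ c, ψ c * φ p c := by
  have hr := rad_pos hM (hWM hp)
  have h0 := hr.ne'
  have hd := fun j => differentiableAt_of_mem hW (hφ j) hp
  have hdr := fun j => differentiableAt_dr hr j
  have hdd := fun b c => differentiableAt_pd hW (hφ c) hp b
  have hR : ∀ c, DifferentiableAt ℝ (der dr fun q => φ q c) p := fun c =>
    differentiableAt_of_mem hW (contDiffOn_der hW ((contDiffOn_dr hM).mono hWM) (hφ c)) hp
  -- In the derivative of the angular gradient, the terms along `dt`, `dr` and the normal component of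
  -- `ψ` are annihilated by the contraction with `sph p a b * ψ c`.
  have hT : ∀ a b c, pd a (fun q => slashGrad M φ q b c) p
      = pd a (pd b fun q => φ q c) p - dt b * pd a (pd 0 fun q => φ q c) p
        - (dr p b * pd a (der dr fun q => φ q c) p
          + der dr (fun q => φ q c) p * (sph p a b / rad p))
        + (dr p c * pd a (fun q => φ q b / rad q) p
          + φ p b / rad p * (sph p a c / rad p)) := by
    intro a b c
    rw [pd_congr a hW (fun q hq => slashGrad_eq hM hW hWM hφ ht hq b c) hp]
    have e1 : DifferentiableAt ℝ (fun q => dt b * pd 0 (fun q => φ q c) q) p :=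
      (hdd 0 c).const_mul _
    have e2 : DifferentiableAt ℝ (fun q => dr q b * der dr (fun q => φ q c) q) p :=
      (hdr b).fun_mul (hR c)
    have e3 : DifferentiableAt ℝ (fun q => φ q b / rad q) p := differentiableAt_div_rad (hd b) hr
    have e4 : DifferentiableAt ℝ (fun q => dr q c * (φ q b / rad q)) p := (hdr c).fun_mul e3
    rw [pd_add a (((hdd b c).fun_sub e1).fun_sub e2) e4, pd_sub a ((hdd b c).fun_sub e1) e2,
      pd_sub a (hdd b c) e1, pd_mul a (differentiableAt_const _) (hdd 0 c), pd_const,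
      pd_mul a (hdr b) (hR c), pd_mul a (hdr c) e3, pd_dr a b hr, pd_dr a c hr]
    ring
  rw [sum_mul_slashLaplacian hM (hWM hp) hψ]
  simp only [hT]
  have hP0 : ∀ a, ∑ b, sph p a b * dt b = 0 := fun a => by
    have := (isTangent_sph hr a).1
    simp only [sph_symm p 0 a] at this
    simp [Fin.sum_univ_four, dt, this]
  have hPn : ∀ a, ∑ b, sph p a b * dr p b = 0 := fun a => by
    have := (isTangent_sph hr a).2
    simp only [sph_symm p _ a] at this
    simp [Fin.sum_univ_four, dr_zero]
    linarith
  have hPP : ∑ a, ∑ b, sph p a b * sph p a b = 2 := by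
    have : ∀ a, ∑ b, sph p a b * sph p a b = sph p a a := fun a => by
      have := (isTangent_sph hr a).sum_sph_mul a
      simpa only [sph_symm p _ a] using this
    have hn := sum_dr_sq hr
    simp only [this, Fin.sum_univ_four]
    simp [sph, dt, dr_zero]
    linear_combination -hn
  have hψn : ∑ c, ψ c * dr p c = 0 := by
    have := hψ.2
    simp [Fin.sum_univ_four, dr_zero]
    linarith
  have hsplit : ∀ a b c, sph p a b * ψ c * (pd a (pd b fun q => φ q c) p
        - dt b * pd a (pd 0 fun q => φ q c) p
        - (dr p b * pd a (der dr fun q => φ q c) p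
          + der dr (fun q => φ q c) p * (sph p a b / rad p))
        + (dr p c * pd a (fun q => φ q b / rad q) p
          + φ p b / rad p * (sph p a c / rad p)))
      = ψ c * (sph p a b * pd a (pd b fun q => φ q c) p)
        - (sph p a b * dt b) * (ψ c * pd a (pd 0 fun q => φ q c) p)
        - (sph p a b * dr p b) * (ψ c * pd a (der dr fun q => φ q c) p)
        - (sph p a b * sph p a b) * (ψ c * der dr (fun q => φ q c) p / rad p)
        + (sph p a b * pd a (fun q => φ q b / rad q) p) * (ψ c * dr p c)
        + (sph p a b * φ p b / rad p ^ 2) * (sph p a c * ψ c) := by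
    intro a b c
    field_simp
    ring
  simp only [hsplit, Finset.sum_add_distrib, Finset.sum_sub_distrib]
  have z1 : ∑ a, ∑ b, ∑ c, (sph p a b * dt b) * (ψ c * pd a (pd 0 fun q => φ q c) p) = 0 := by
    refine Finset.sum_eq_zero fun a _ => ?_
    simp only [← Finset.mul_sum]
    rw [← Finset.sum_mul, hP0, zero_mul]
  have z2 : ∑ a, ∑ b, ∑ c, (sph p a b * dr p b) * (ψ c * pd a (der dr fun q => φ q c) p) = 0 := by
    refine Finset.sum_eq_zero fun a _ => ?_
    simp only [← Finset.mul_sum]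
    rw [← Finset.sum_mul, hPn, zero_mul]
  have z3 : ∑ a, ∑ b, ∑ c, (sph p a b * sph p a b) * (ψ c * der dr (fun q => φ q c) p / rad p)
      = 2 * ∑ c, ψ c * der dr (fun q => φ q c) p / rad p := by
    simp only [← Finset.mul_sum, ← Finset.sum_mul]
    rw [hPP]
  have z4 : ∑ a, ∑ b, ∑ c, (sph p a b * pd a (fun q => φ q b / rad q) p) * (ψ c * dr p c) = 0 := by
    refine Finset.sum_eq_zero fun a _ => Finset.sum_eq_zero fun b _ => ?_
    rw [← Finset.mul_sum, hψn, mul_zero]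
  have z5 : ∑ a, ∑ b, ∑ c, (sph p a b * φ p b / rad p ^ 2) * (sph p a c * ψ c)
      = (∑ c, ψ c * φ p c) / rad p ^ 2 := by
    simp only [← Finset.mul_sum, hψ.sum_sph_mul, ← Finset.sum_mul, ← Finset.sum_div,
      (ht p hp).sum_sph_mul]
    rw [Finset.sum_div]
    exact Finset.sum_congr rfl fun a _ => by ring
  have z0 : ∑ a, ∑ b, ∑ c, ψ c * (sph p a b * pd a (pd b fun q => φ q c) p)
      = ∑ c, ψ c * ∑ a, ∑ b, sph p a b * pd a (pd b fun q => φ q c) p := by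
    simp only [Finset.mul_sum]
    rw [eq_comm, Finset.sum_comm]
    exact Finset.sum_congr rfl fun a _ => Finset.sum_comm
  rw [z0, z1, z2, z3, z4, z5]
  simp only [sum_der_rot_der_rot hW (hφ _) hp hr, mul_sub, Finset.sum_sub_distrib]
  have y1 : ∑ c, ψ c * (rad p ^ 2 * ∑ i, ∑ j, sph p i j * pd i (pd j fun q => φ q c) p)
      = rad p ^ 2 * ∑ c, ψ c * ∑ i, ∑ j, sph p i j * pd i (pd j fun q => φ q c) p := by
    rw [Finset.mul_sum]
    exact Finset.sum_congr rfl fun c _ => by ring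
  have y2 : ∑ c, ψ c * (2 * rad p * der dr (fun q => φ q c) p)
      = rad p ^ 2 * (2 * ∑ c, ψ c * der dr (fun q => φ q c) p / rad p) := by
    simp only [Finset.mul_sum]
    refine Finset.sum_congr rfl fun c _ => ?_
    field_simp
  rw [y1, y2]
  field_simp
  ring

/-- The Fackerell--Ipser equation, paired with a tangential vector: a wave equation for the
Cartesian components of `φ`. -/
theorem FackerellIpserAt.sum_mul_der {M : ℝ} (hM : 0 < M) {φ : OneForm} {W : Set Pt}
    (hW : IsOpen W) (hWM : W ⊆ exterior M) (hφ : ∀ j, SmoothOn (fun q => φ q j) W)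
    (ht : ∀ p ∈ W, IsTangent p (φ p)) {p : Pt} (hp : p ∈ W) (hFI : FackerellIpserAt M φ p)
    {ψ : Fin 4 → ℝ} (hψ : IsTangent p ψ) :
    ∑ c, ψ c * der (Lbar M) (der (L M) fun q => φ q c) p
      = (1 - mu M p) / rad p ^ 2
        * ∑ c, ψ c * ∑ a, der (rot a) (der (rot a) fun q => φ q c) p := by
  have hr := fun q (hq : q ∈ W) => rad_pos hM (hWM hq)
  have h0 := (hr p hp).ne'
  have hL : ∀ q ∈ W, ∀ j, slashAlong M (L M) φ q j = der (L M) (fun q => φ q j) q :=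
    fun q hq j => slashAlong_eq_der hM hW hWM hφ ht hq (sum_sph_L (hr q hq)) j
  have hdL : ∀ j, SmoothOn (fun q => slashAlong M (L M) φ q j) W := fun j =>
    (contDiffOn_der hW ((contDiffOn_L hM).mono hWM) (hφ j)).congr fun q hq => hL q hq j
  have htL : ∀ q ∈ W, IsTangent q (slashAlong M (L M) φ q) := fun q hq => by
    rw [show slashAlong M (L M) φ q = fun j => der (L M) (fun q => φ q j) q from
      funext fun j => hL q hq j]
    exact isTangent_der hW hr hφ ht hq (sum_sph_L (hr q hq))
  have hLL : ∀ j, slashAlong M (Lbar M) (slashAlong M (L M) φ) p j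
      = der (Lbar M) (der (L M) fun q => φ q j) p := by
    intro j
    rw [slashAlong_eq_der hM hW hWM hdL htL hp (sum_sph_Lbar (hr p hp)) j, der_eq_sum, der_eq_sum]
    refine Finset.sum_congr rfl fun i _ => ?_
    rw [pd_congr i hW (fun q hq => hL q hq j) hp]
  have h1 := sum_mul_slashLaplacian_eq hM hW hWM hφ ht hp hψ
  have h2 : ∑ k, ψ k * (der (Lbar M) (der (L M) fun q => φ q k) p
      - (1 - mu M p) * slashLaplacian M φ p k + (1 - mu M p) / rad p ^ 2 * φ p k) = 0 := by
    refine Finset.sum_eq_zero fun k _ => ?_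
    rw [← hLL, hFI k, mul_zero]
  have h3 : ∑ k, ψ k * (der (Lbar M) (der (L M) fun q => φ q k) p
      - (1 - mu M p) * slashLaplacian M φ p k + (1 - mu M p) / rad p ^ 2 * φ p k)
      = (∑ k, ψ k * der (Lbar M) (der (L M) fun q => φ q k) p)
        - (1 - mu M p) * (∑ k, ψ k * slashLaplacian M φ p k)
        + (1 - mu M p) / rad p ^ 2 * ∑ k, ψ k * φ p k := by
    simp only [Finset.mul_sum, ← Finset.sum_sub_distrib, ← Finset.sum_add_distrib]
    exact Finset.sum_congr rfl fun k _ => by ring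
  rw [h3] at h2
  have h4 : ∑ k, ψ k * slashLaplacian M φ p k
      = ((∑ c, ψ c * ∑ a, der (rot a) (der (rot a) fun q => φ q c) p) + ∑ c, ψ c * φ p c)
        / rad p ^ 2 := by
    rw [eq_div_iff (by positivity)]
    linarith
  rw [h4] at h2
  linear_combination h2

/-! ### Commutators -/

/-- Vector fields with vanishing Lie bracket at a point commute there as derivations. -/
theorem der_der_comm {W : Set Pt} (hW : IsOpen W) {f : Pt → ℝ} (hf : SmoothOn f W)
    {X Y : Pt → Fin 4 → ℝ} {p : Pt} (hp : p ∈ W) (hX : DifferentiableAt ℝ X p)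
    (hY : DifferentiableAt ℝ Y p)
    (hXY : ∀ i, der X (fun q => Y q i) p = der Y (fun q => X q i) p) :
    der X (der Y f) p = der Y (der X f) p := by
  have hf' : ContDiffAt ℝ ((⊤ : ℕ∞) : WithTop ℕ∞) f p := hf.contDiffAt (hW.mem_nhds hp)
  have hdf : DifferentiableAt ℝ (fderiv ℝ f) p :=
    (hf'.fderiv_right (m := 1) (WithTop.coe_le_coe.2 (le_top : (2 : ℕ∞) ≤ ⊤))).differentiableAt (by simp)
  have hsymm : IsSymmSndFDerivAt ℝ f p := hf'.isSymmSndFDerivAt (by simpa using WithTop.coe_le_coe.2 (le_top : (2 : ℕ∞) ≤ ⊤))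
  have hc : ∀ {X Y : Pt → Fin 4 → ℝ}, DifferentiableAt ℝ Y p → der X (der Y f) p
      = fderiv ℝ (fderiv ℝ f) p (X p) (Y p) + fderiv ℝ f p (fderiv ℝ Y p (X p)) := by
    intro X Y hY
    change fderiv ℝ (fun q => fderiv ℝ f q (Y q)) p (X p) = _
    rw [fderiv_clm_apply hdf hY]
    simp [add_comm]
  have hcomp : ∀ {X Y : Pt → Fin 4 → ℝ}, DifferentiableAt ℝ Y p →
      fderiv ℝ Y p (X p) = fun i => der X (fun q => Y q i) p := by
    intro X Y hY
    ext i
    have h := (hasFDerivAt_pi'.1 hY.hasFDerivAt i).fderiv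
    rw [der, h]
    rfl
  rw [hc hY, hc hX, hcomp hY, hcomp hX, hsymm (X p) (Y p)]
  congr 2
  exact funext hXY

theorem der_L_rad {M : ℝ} {p : Pt} (hp : 0 < rad p) : der (L M) rad p = 1 - mu M p := by
  have hn := sum_dr_sq hp
  simp only [der_eq_sum, pd_rad _ hp, Fin.sum_univ_four, L, dt, dr_zero, Matrix.cons_val]
  linear_combination (1 - mu M p) * hn

theorem der_Lbar_rad {M : ℝ} {p : Pt} (hp : 0 < rad p) : der (Lbar M) rad p = -(1 - mu M p) := by
  have hn := sum_dr_sq hp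
  simp only [der_eq_sum, pd_rad _ hp, Fin.sum_univ_four, Lbar, dt, dr_zero, Matrix.cons_val]
  linear_combination -(1 - mu M p) * hn

theorem sum_rot_mul_dr (a : Fin 3) (p : Pt) : ∑ i, rot a p i * dr p i = 0 := by
  fin_cases a <;> simp [Fin.sum_univ_four, rot, dr] <;> ring

theorem der_rot_rad (a : Fin 3) {p : Pt} (hp : 0 < rad p) : der (rot a) rad p = 0 := by
  simp only [der_eq_sum, pd_rad _ hp, sum_rot_mul_dr]

theorem rot_zero (a : Fin 3) (p : Pt) : rot a p 0 = 0 := by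
  fin_cases a <;> simp [rot]

theorem isTangent_rot (a : Fin 3) (p : Pt) : IsTangent p (rot a p) := by
  have h := sum_rot_mul_dr a p
  simp only [Fin.sum_univ_four, dr_zero] at h
  exact ⟨rot_zero a p, by linarith⟩

theorem der_mu {M : ℝ} {X : Pt → Fin 4 → ℝ} {p : Pt} (hp : 0 < rad p) :
    der X (mu M) p = -(2 * M / rad p ^ 2) * der X rad p := by
  have h := (HasDerivAt.fun_div (hasDerivAt_const (rad p) (2 * M)) (hasDerivAt_id (rad p))
    hp.ne').comp_hasFDerivAt p (differentiableAt_rad hp).hasFDerivAt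
  have h2 : fderiv ℝ (mu M) p = _ := h.fderiv
  rw [der, h2, der]
  simp
  ring

theorem differentiableAt_mu {M : ℝ} {p : Pt} (hp : 0 < rad p) : DifferentiableAt ℝ (mu M) p :=
  differentiableAt_div_rad (differentiableAt_const _) hp

theorem der_L_apply {M : ℝ} {X : Pt → Fin 4 → ℝ} {p : Pt} (hp : 0 < rad p) (i : Fin 4) :
    der X (fun q => L M q i) p = 2 * M / rad p ^ 2 * der X rad p * dr p i
      + (1 - mu M p) * der X (fun q => dr q i) p := by
  have h1 := differentiableAt_mu (M := M) hp
  have h2 := differentiableAt_dr hp i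
  have h3 := (((hasFDerivAt_const (1 : ℝ) p).fun_sub h1.hasFDerivAt).fun_mul h2.hasFDerivAt).const_add
    (dt i)
  have h4 := der_mu (M := M) (X := X) hp
  rw [der] at h4
  have h5 : fderiv ℝ (fun q => L M q i) p = _ := h3.fderiv
  rw [der, h5]
  simp [h4, der]
  ring

theorem der_Lbar_apply {M : ℝ} {X : Pt → Fin 4 → ℝ} {p : Pt} (hp : 0 < rad p) (i : Fin 4) :
    der X (fun q => Lbar M q i) p = -(2 * M / rad p ^ 2 * der X rad p * dr p i
      + (1 - mu M p) * der X (fun q => dr q i) p) := by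
  have h1 := differentiableAt_mu (M := M) hp
  have h2 := differentiableAt_dr hp i
  have h3 := (((hasFDerivAt_const (1 : ℝ) p).fun_sub h1.hasFDerivAt).fun_mul h2.hasFDerivAt).const_sub
    (dt i)
  have h4 := der_mu (M := M) (X := X) hp
  rw [der] at h4
  have h5 : fderiv ℝ (fun q => Lbar M q i) p = _ := h3.fderiv
  rw [der, h5]
  simp [h4, der]
  ring

theorem der_dr_of_normal {X : Pt → Fin 4 → ℝ} {p : Pt} (hp : 0 < rad p)
    (hX : ∀ j, ∑ i, X p i * sph p i j = 0) (i : Fin 4) : der X (fun q => dr q i) p = 0 := by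
  simp only [der_eq_sum, pd_dr _ _ hp, mul_div_assoc', ← Finset.sum_div, hX, zero_div]

theorem der_rot_dr (a : Fin 3) {p : Pt} (hp : 0 < rad p) (i : Fin 4) :
    der (rot a) (fun q => dr q i) p = rot a p i / rad p := by
  rw [← (isTangent_rot a p).sum_sph_mul i]
  simp only [der_eq_sum, pd_dr _ _ hp, mul_div_assoc', ← Finset.sum_div]
  congr 1
  exact Finset.sum_congr rfl fun b _ => by rw [sph_symm p i b, mul_comm]

/-- The rotation fields are linear in the chart. -/
theorem der_rot_apply (a : Fin 3) (X : Pt → Fin 4 → ℝ) (p : Pt) (i : Fin 4) :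
    der X (fun q => rot a q i) p = rot a (X p) i := by
  simp only [der_eq_sum, pd_rot]
  fin_cases a <;> fin_cases i <;> simp [rot, Pi.single_apply]

theorem rot_L {M : ℝ} (a : Fin 3) (p : Pt) (i : Fin 4) :
    rot a (L M p) i = (1 - mu M p) * (rot a p i / rad p) := by
  fin_cases a <;> fin_cases i <;> simp [rot, L, dt, dr] <;> ring

theorem rot_Lbar {M : ℝ} (a : Fin 3) (p : Pt) (i : Fin 4) :
    rot a (Lbar M p) i = -((1 - mu M p) * (rot a p i / rad p)) := by
  fin_cases a <;> fin_cases i <;> simp [rot, Lbar, dt, dr] <;> ring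

section Commutators

variable {M : ℝ} {W : Set Pt} {f : Pt → ℝ} {p : Pt}

theorem der_L_der_Lbar (hM : 0 < M) (hW : IsOpen W) (hWM : W ⊆ exterior M) (hf : SmoothOn f W)
    (hp : p ∈ W) : der (L M) (der (Lbar M) f) p = der (Lbar M) (der (L M) f) p := by
  have hr := rad_pos hM (hWM hp)
  refine der_der_comm hW hf hp
    ((((contDiffOn_L hM).mono hWM).contDiffAt (hW.mem_nhds hp)).differentiableAt (by simp))
    ((((contDiffOn_Lbar hM).mono hWM).contDiffAt (hW.mem_nhds hp)).differentiableAt (by simp))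
    fun i => ?_
  rw [der_L_apply hr, der_Lbar_apply hr, der_L_rad hr, der_Lbar_rad hr,
    der_dr_of_normal hr (sum_sph_L hr), der_dr_of_normal hr (sum_sph_Lbar hr)]
  ring

theorem der_L_der_rot (hM : 0 < M) (hW : IsOpen W) (hWM : W ⊆ exterior M) (hf : SmoothOn f W)
    (hp : p ∈ W) (a : Fin 3) : der (L M) (der (rot a) f) p = der (rot a) (der (L M) f) p := by
  have hr := rad_pos hM (hWM hp)
  refine der_der_comm hW hf hp
    ((((contDiffOn_L hM).mono hWM).contDiffAt (hW.mem_nhds hp)).differentiableAt (by simp))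
    ((contDiff_rot a).contDiffAt.differentiableAt (by simp)) fun i => ?_
  rw [der_L_apply hr, der_rot_apply, der_rot_rad a hr, der_rot_dr a hr, rot_L]
  ring

theorem der_Lbar_der_rot (hM : 0 < M) (hW : IsOpen W) (hWM : W ⊆ exterior M) (hf : SmoothOn f W)
    (hp : p ∈ W) (a : Fin 3) :
    der (Lbar M) (der (rot a) f) p = der (rot a) (der (Lbar M) f) p := by
  have hr := rad_pos hM (hWM hp)
  refine der_der_comm hW hf hp
    ((((contDiffOn_Lbar hM).mono hWM).contDiffAt (hW.mem_nhds hp)).differentiableAt (by simp))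
    ((contDiff_rot a).contDiffAt.differentiableAt (by simp)) fun i => ?_
  rw [der_Lbar_apply hr, der_rot_apply, der_rot_rad a hr, der_rot_dr a hr, rot_Lbar]
  ring

end Commutators

/-! ### Energy currents -/

/-- The Euclidean inner product of two one-forms given by their Cartesian components. -/
def dotForm (η ψ : OneForm) (p : Pt) : ℝ := ∑ c, η p c * ψ p c

/-- The componentwise derivative of a one-form along a vector field. -/
def derForm (X : Pt → Fin 4 → ℝ) (η : OneForm) : OneForm := fun p c => der X (fun q => η q c) p

/-- `∑_a |Ω_a φ|²`, which for a tangential form equals `r² |∇̸φ|² + |φ|²`. -/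
def rotEnergy (φ : OneForm) (p : Pt) : ℝ :=
  ∑ a, dotForm (derForm (rot a) φ) (derForm (rot a) φ) p

/-- The scaled inverse radius `M / r`, which lies in `(0, 1/2)`. -/
def invRad (M : ℝ) (p : Pt) : ℝ := M / rad p

/-- All components are smooth on `W`. -/
def SmoothFormOn (η : OneForm) (W : Set Pt) : Prop := ∀ j, SmoothOn (fun q => η q j) W

theorem SmoothFormOn.derForm {η : OneForm} {W : Set Pt} (hη : SmoothFormOn η W) (hW : IsOpen W)
    {X : Pt → Fin 4 → ℝ} (hX : SmoothOn X W) : SmoothFormOn (derForm X η) W :=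
  fun j => contDiffOn_der hW hX (hη j)

theorem SmoothFormOn.dotForm {η ψ : OneForm} {W : Set Pt} (hη : SmoothFormOn η W)
    (hψ : SmoothFormOn ψ W) : SmoothOn (dotForm η ψ) W :=
  ContDiffOn.sum fun c _ => (hη c).mul (hψ c)

theorem dotForm_comm (η ψ : OneForm) (p : Pt) : dotForm η ψ p = dotForm ψ η p :=
  Finset.sum_congr rfl fun _ _ => mul_comm _ _

theorem dotForm_self_nonneg (η : OneForm) (p : Pt) : 0 ≤ dotForm η η p :=
  Finset.sum_nonneg fun _ _ => mul_self_nonneg _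

/-- `f` is differentiable at `p` and its derivative along `X` is `f'`. -/
structure HasDer (X : Pt → Fin 4 → ℝ) (f : Pt → ℝ) (f' : ℝ) (p : Pt) : Prop where
  differentiableAt : DifferentiableAt ℝ f p
  der_eq : der X f p = f'

section HasDer

variable {X : Pt → Fin 4 → ℝ} {f g : Pt → ℝ} {f' g' : ℝ} {p : Pt}

theorem hasDer_of_differentiableAt (hf : DifferentiableAt ℝ f p) : HasDer X f (der X f p) p := ⟨hf, rfl⟩

theorem HasDer.add (hf : HasDer X f f' p) (hg : HasDer X g g' p) :
    HasDer X (fun q => f q + g q) (f' + g') p := by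
  refine ⟨hf.1.fun_add hg.1, ?_⟩
  rw [← hf.2, ← hg.2, der, fderiv_fun_add hf.1 hg.1]
  rfl

theorem HasDer.sub (hf : HasDer X f f' p) (hg : HasDer X g g' p) :
    HasDer X (fun q => f q - g q) (f' - g') p := by
  refine ⟨hf.1.fun_sub hg.1, ?_⟩
  rw [← hf.2, ← hg.2, der, fderiv_fun_sub hf.1 hg.1]
  rfl

theorem HasDer.mul (hf : HasDer X f f' p) (hg : HasDer X g g' p) :
    HasDer X (fun q => f q * g q) (f' * g p + f p * g') p := by
  refine ⟨hf.1.fun_mul hg.1, ?_⟩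
  rw [← hf.2, ← hg.2, der, fderiv_fun_mul hf.1 hg.1]
  simp [der]
  ring

theorem HasDer.const_mul (c : ℝ) (hf : HasDer X f f' p) : HasDer X (fun q => c * f q) (c * f') p := by
  refine ⟨hf.1.const_mul c, ?_⟩
  rw [← hf.2, der, fderiv_const_mul hf.1]
  rfl

theorem HasDer.finset_sum {ι : Type*} {s : Finset ι} {F : ι → Pt → ℝ} {F' : ι → ℝ}
    (h : ∀ i, HasDer X (F i) (F' i) p) :
    HasDer X (fun q => ∑ i ∈ s, F i q) (∑ i ∈ s, F' i) p := by
  refine ⟨DifferentiableAt.fun_sum fun i _ => (h i).1, ?_⟩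
  rw [der, fderiv_fun_sum fun i _ => (h i).1]
  simp only [sum_apply]
  exact Finset.sum_congr rfl fun i _ => (h i).2

theorem HasDer.comp {G : ℝ → ℝ} {G' : ℝ} (hG : HasDerivAt G G' (f p)) (hf : HasDer X f f' p) :
    HasDer X (fun q => G (f q)) (G' * f') p := by
  have h := hG.comp_hasFDerivAt p hf.1.hasFDerivAt
  refine ⟨h.differentiableAt, ?_⟩
  have h2 : fderiv ℝ (fun q => G (f q)) p = _ := h.fderiv
  rw [← hf.2, der, h2]
  rfl

theorem HasDer.congr_der (hf : HasDer X f f' p) (h : f' = g') : HasDer X f g' p := h ▸ hf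

end HasDer

section Currents

variable {M : ℝ} {W : Set Pt} {η ψ φ : OneForm} {p : Pt}

theorem HasDer.dotForm (hW : IsOpen W) (hη : SmoothFormOn η W) (hψ : SmoothFormOn ψ W)
    (hp : p ∈ W) (X : Pt → Fin 4 → ℝ) :
    HasDer X (dotForm η ψ)
      (FackerellIpser.dotForm (derForm X η) ψ p + FackerellIpser.dotForm η (derForm X ψ) p) p := by
  have h := HasDer.finset_sum (X := X) (s := Finset.univ) fun c : Fin 4 =>
    (hasDer_of_differentiableAt (X := X) (differentiableAt_of_mem hW (hη c) hp)).mul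
      (hasDer_of_differentiableAt (differentiableAt_of_mem hW (hψ c) hp))
  refine h.congr_der ?_
  rw [Finset.sum_add_distrib]
  rfl

theorem hasDer_invRad (hr : 0 < rad p) (X : Pt → Fin 4 → ℝ) :
    HasDer X (invRad M) (-(M / rad p ^ 2) * der X rad p) p := by
  have h := HasDer.comp (X := X) (G := fun r => M / r) (f := rad)
    (HasDerivAt.fun_div (hasDerivAt_const (rad p) M) (hasDerivAt_id (rad p)) hr.ne')
    ⟨differentiableAt_rad hr, rfl⟩
  refine h.congr_der ?_
  ring

/-- `M²` times the potential `(1 - μ) / r²`, as a function of `x = M / r`. -/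
def potential (x : ℝ) : ℝ := x ^ 2 - 2 * x ^ 3

theorem hasDerivAt_potential (x : ℝ) : HasDerivAt potential (2 * x - 6 * x ^ 2) x := by
  refine ((hasDerivAt_pow 2 x).sub ((hasDerivAt_pow 3 x).const_mul 2)).congr_deriv ?_
  norm_num
  ring

theorem mu_eq_invRad (M : ℝ) (p : Pt) : mu M p = 2 * invRad M p := by
  rw [mu, invRad]; ring

theorem potential_invRad (hM : 0 < M) (hr : 0 < rad p) :
    potential (invRad M p) = M ^ 2 * ((1 - mu M p) / rad p ^ 2) := by
  rw [potential, mu_eq_invRad, invRad]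
  field_simp

theorem hasDer_L_invRad (hM : 0 < M) (hr : 0 < rad p) :
    HasDer (L M) (invRad M) (-potential (invRad M p) / M) p := by
  refine (hasDer_invRad hr _).congr_der ?_
  rw [der_L_rad hr, potential_invRad hM hr]
  field_simp

theorem hasDer_Lbar_invRad (hM : 0 < M) (hr : 0 < rad p) :
    HasDer (Lbar M) (invRad M) (potential (invRad M p) / M) p := by
  refine (hasDer_invRad hr _).congr_der ?_
  rw [der_Lbar_rad hr, potential_invRad hM hr]
  field_simp

theorem hasDer_rot_invRad (hr : 0 < rad p) (a : Fin 3) : HasDer (rot a) (invRad M) 0 p := by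
  refine (hasDer_invRad hr _).congr_der ?_
  rw [der_rot_rad a hr, mul_zero]

theorem smoothOn_invRad (hM : 0 < M) (hWM : W ⊆ exterior M) : SmoothOn (invRad M) W :=
  (contDiffOn_const.div (contDiffOn_rad hM) fun _ hp => (rad_pos hM hp).ne').mono hWM

/-- The hypotheses on `φ` under which the energy currents are studied: a smooth tangential one-form
on an open subset `W` of the exterior. -/
structure TangentialOn (M : ℝ) (φ : OneForm) (W : Set Pt) : Prop where
  pos : 0 < M
  isOpen : IsOpen W
  subset : W ⊆ exterior M
  smooth : SmoothFormOn φ W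
  isTangent : ∀ p ∈ W, IsTangent p (φ p)

theorem TangentialOn.rad_pos (h : TangentialOn M φ W) (hp : p ∈ W) : 0 < rad p :=
  FackerellIpser.rad_pos h.pos (h.subset hp)

theorem TangentialOn.smooth_L (h : TangentialOn M φ W) : SmoothFormOn (derForm (L M) φ) W :=
  h.smooth.derForm h.isOpen ((contDiffOn_L h.pos).mono h.subset)

theorem TangentialOn.smooth_Lbar (h : TangentialOn M φ W) : SmoothFormOn (derForm (Lbar M) φ) W :=
  h.smooth.derForm h.isOpen ((contDiffOn_Lbar h.pos).mono h.subset)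

theorem TangentialOn.smooth_rot (h : TangentialOn M φ W) (a : Fin 3) :
    SmoothFormOn (derForm (rot a) φ) W :=
  h.smooth.derForm h.isOpen (contDiff_rot a).contDiffOn

theorem TangentialOn.isTangent_L (h : TangentialOn M φ W) (hp : p ∈ W) :
    IsTangent p (derForm (L M) φ p) :=
  isTangent_der h.isOpen (fun _ => h.rad_pos) h.smooth h.isTangent hp (sum_sph_L (h.rad_pos hp))

theorem TangentialOn.isTangent_Lbar (h : TangentialOn M φ W) (hp : p ∈ W) :
    IsTangent p (derForm (Lbar M) φ p) :=
  isTangent_der h.isOpen (fun _ => h.rad_pos) h.smooth h.isTangent hp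
    (sum_sph_Lbar (h.rad_pos hp))

theorem TangentialOn.smooth_rotEnergy (h : TangentialOn M φ W) : SmoothOn (rotEnergy φ) W :=
  ContDiffOn.sum fun a _ => (h.smooth_rot a).dotForm (h.smooth_rot a)

/-- Fields commuting with the rotations differentiate `∑_a |Ω_a φ|²` through `φ` only. -/
theorem TangentialOn.hasDer_rotEnergy (h : TangentialOn M φ W) (hp : p ∈ W)
    {X : Pt → Fin 4 → ℝ} (hX : ∀ a c, der X (der (rot a) fun q => φ q c) p
      = der (rot a) (der X fun q => φ q c) p) :
    HasDer X (rotEnergy φ)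
      (2 * ∑ a, dotForm (derForm (rot a) (derForm X φ)) (derForm (rot a) φ) p) p := by
  have h1 := HasDer.finset_sum (X := X) (s := Finset.univ) fun a =>
    HasDer.dotForm h.isOpen (h.smooth_rot a) (h.smooth_rot a) hp X
  refine h1.congr_der ?_
  rw [Finset.mul_sum]
  refine Finset.sum_congr rfl fun a _ => ?_
  have : derForm X (derForm (rot a) φ) p = derForm (rot a) (derForm X φ) p :=
    funext fun c => hX a c
  have h2 : dotForm (derForm X (derForm (rot a) φ)) (derForm (rot a) φ) p
      = dotForm (derForm (rot a) (derForm X φ)) (derForm (rot a) φ) p := by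
    simp only [dotForm, this]
  rw [dotForm_comm (derForm (rot a) φ), h2]
  ring

theorem TangentialOn.hasDer_L_rotEnergy (h : TangentialOn M φ W) (hp : p ∈ W) :
    HasDer (L M) (rotEnergy φ)
      (2 * ∑ a, dotForm (derForm (rot a) (derForm (L M) φ)) (derForm (rot a) φ) p) p :=
  h.hasDer_rotEnergy hp fun a c => der_L_der_rot h.pos h.isOpen h.subset (h.smooth c) hp a

theorem TangentialOn.hasDer_Lbar_rotEnergy (h : TangentialOn M φ W) (hp : p ∈ W) :
    HasDer (Lbar M) (rotEnergy φ)
      (2 * ∑ a, dotForm (derForm (rot a) (derForm (Lbar M) φ)) (derForm (rot a) φ) p) p :=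
  h.hasDer_rotEnergy hp fun a c => der_Lbar_der_rot h.pos h.isOpen h.subset (h.smooth c) hp a

/-- The pairing `(D_L̲ D_L φ) · ψ` of the wave operator with a one-form. -/
def waveDot (M : ℝ) (φ ψ : OneForm) (p : Pt) : ℝ :=
  dotForm ψ (derForm (Lbar M) (derForm (L M) φ)) p

/-- Integration by parts on the spheres in differential form: up to the divergence on the left, the
pairing of the equation with `ψ` is minus the angular Dirichlet form. -/
theorem TangentialOn.sum_der_rot (h : TangentialOn M φ W) (hp : p ∈ W)
    (hFI : FackerellIpserAt M φ p) (hψ : SmoothFormOn ψ W) (hψt : IsTangent p (ψ p)) :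
    potential (invRad M p) * ∑ a, der (rot a) (dotForm ψ (derForm (rot a) φ)) p
      = M ^ 2 * waveDot M φ ψ p
        + potential (invRad M p)
          * ∑ a, dotForm (derForm (rot a) ψ) (derForm (rot a) φ) p := by
  have h1 := hFI.sum_mul_der h.pos h.isOpen h.subset h.smooth h.isTangent hp hψt
  have h2 : ∀ a, der (rot a) (dotForm ψ (derForm (rot a) φ)) p
      = dotForm (derForm (rot a) ψ) (derForm (rot a) φ) p
        + dotForm ψ (derForm (rot a) (derForm (rot a) φ)) p := fun a =>
    (HasDer.dotForm h.isOpen hψ (h.smooth_rot a) hp (rot a)).2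
  have h3 : ∑ c, ψ p c * ∑ a, der (rot a) (der (rot a) fun q => φ q c) p
      = ∑ a, dotForm ψ (derForm (rot a) (derForm (rot a) φ)) p := by
    simp only [dotForm, Finset.mul_sum]
    rw [Finset.sum_comm]
    rfl
  rw [h3] at h1
  have h4 : waveDot M φ ψ p = ∑ c, ψ p c * der (Lbar M) (der (L M) fun q => φ q c) p := rfl
  simp only [h2, Finset.sum_add_distrib]
  rw [h4, h1, potential_invRad h.pos (h.rad_pos hp)]
  ring

theorem TangentialOn.derForm_L_Lbar (h : TangentialOn M φ W) (hp : p ∈ W) :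
    derForm (L M) (derForm (Lbar M) φ) p = derForm (Lbar M) (derForm (L M) φ) p :=
  funext fun c => der_L_der_Lbar h.pos h.isOpen h.subset (h.smooth c) hp

/-- `M²` times the energy density `|D_L φ|² + (1 - μ) |∇̸φ|² + V |φ|²` on outgoing cones. -/
def energyL (M : ℝ) (φ : OneForm) (p : Pt) : ℝ :=
  M ^ 2 * dotForm (derForm (L M) φ) (derForm (L M) φ) p + potential (invRad M p) * rotEnergy φ p

/-- `M²` times the energy density `|D_L̲ φ|² + (1 - μ) |∇̸φ|² + V |φ|²` on ingoing cones. -/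
def energyLbar (M : ℝ) (φ : OneForm) (p : Pt) : ℝ :=
  M ^ 2 * dotForm (derForm (Lbar M) φ) (derForm (Lbar M) φ) p
    + potential (invRad M p) * rotEnergy φ p

/-- The angular component of the energy current. -/
def energyAngular (M : ℝ) (φ : OneForm) (a : Fin 3) (p : Pt) : ℝ :=
  -2 * (potential (invRad M p) * (dotForm (derForm (L M) φ) (derForm (rot a) φ) p
    + dotForm (derForm (Lbar M) φ) (derForm (rot a) φ) p))

/-- The weight `M w` of the Lagrangian term, `w = f' - g` with `f = 1 - 3 x` and
`M g = (x² - 2 x³) (1 - 3 x)² / 10`, as a function of `x = M / r`; the prime is the derivative in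
`r_*`, so that `M f' = 3 (x² - 2 x³)`. -/
def lagrangeWeight (x : ℝ) : ℝ := 29 / 10 * x ^ 2 - 26 / 5 * x ^ 3 - 21 / 10 * x ^ 4 + 9 / 5 * x ^ 5

/-- The weight `M² (h - w' / 2)` of `|φ|²` in the Morawetz current, with
`M² h = 4 x³ (x² - 2 x³)`, as a function of `x = M / r`. -/
def zerothWeight (x : ℝ) : ℝ :=
  29 / 10 * x ^ 3 - 68 / 5 * x ^ 4 + 77 / 5 * x ^ 5 + 49 / 10 * x ^ 6 - 9 * x ^ 7

/-- The component of the Morawetz current (scaled by `M²`) that is integrated over outgoing cones: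
`f (|D_L φ|² - V N) + w φ · D_L φ + (h - w' / 2) |φ|²` with `N = ∑_a |Ω_a φ|²`. -/
def morawetzL (M : ℝ) (φ : OneForm) (p : Pt) : ℝ :=
  (1 - 3 * invRad M p) * (M ^ 2 * dotForm (derForm (L M) φ) (derForm (L M) φ) p
      - potential (invRad M p) * rotEnergy φ p)
    + M * (lagrangeWeight (invRad M p) * dotForm φ (derForm (L M) φ) p)
    + zerothWeight (invRad M p) * dotForm φ φ p

/-- The component of the Morawetz current (scaled by `M²`) that is integrated over ingoing cones:
`f (V N - |D_L̲ φ|²) + w φ · D_L̲ φ - (h - w' / 2) |φ|²` with `N = ∑_a |Ω_a φ|²`. -/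
def morawetzLbar (M : ℝ) (φ : OneForm) (p : Pt) : ℝ :=
  (1 - 3 * invRad M p) * (potential (invRad M p) * rotEnergy φ p
      - M ^ 2 * dotForm (derForm (Lbar M) φ) (derForm (Lbar M) φ) p)
    + M * (lagrangeWeight (invRad M p) * dotForm φ (derForm (Lbar M) φ) p)
    - zerothWeight (invRad M p) * dotForm φ φ p

/-- The component of the Morawetz current (scaled by `M²`) along the rotation `Ω_a`. -/
def morawetzAngular (M : ℝ) (φ : OneForm) (a : Fin 3) (p : Pt) : ℝ :=
  -2 * (((1 - 3 * invRad M p) * potential (invRad M p))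
      * (dotForm (derForm (L M) φ) (derForm (rot a) φ) p
        - dotForm (derForm (Lbar M) φ) (derForm (rot a) φ) p))
    - 2 / M * ((potential (invRad M p) * lagrangeWeight (invRad M p))
      * dotForm φ (derForm (rot a) φ) p)

/-- The bulk term of the Morawetz identity: `-M` times the divergence of the (scaled) Morawetz
current, expressed through `|D_L φ - D_L̲ φ|²`, `|D_L φ + D_L̲ φ|²`, `∑_a |Ω_a φ|²`, `|φ|²` and the
cross term `φ · (D_L φ - D_L̲ φ)`. -/
def morawetzBulk (M : ℝ) (φ : OneForm) (p : Pt) : ℝ :=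
  let x := invRad M p
  let ll := dotForm (derForm (L M) φ) (derForm (L M) φ) p
  let bb := dotForm (derForm (Lbar M) φ) (derForm (Lbar M) φ) p
  let d := dotForm (derForm (L M) φ) (derForm (Lbar M) φ) p
  potential x * ((3 - (1 - 3 * x) ^ 2 / 20) * (M ^ 2 * (ll - 2 * d + bb))
    + (1 - 3 * x) ^ 2 / 20 * (M ^ 2 * (ll + 2 * d + bb))
    + (4 * x - potential x / 5) * (1 - 3 * x) ^ 2 * rotEnergy φ p
    - 2 * (87 / 10 * x ^ 2 - 272 / 5 * x ^ 3 + 77 * x ^ 4 + 147 / 5 * x ^ 5 - 63 * x ^ 6)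
      * dotForm φ φ p
    + 8 * x ^ 3 * (M * (dotForm φ (derForm (L M) φ) p - dotForm φ (derForm (Lbar M) φ) p)))

theorem hasDerivAt_lagrangeWeight (x : ℝ) : HasDerivAt lagrangeWeight
    (29 / 5 * x - 78 / 5 * x ^ 2 - 42 / 5 * x ^ 3 + 9 * x ^ 4) x := by
  refine (((((hasDerivAt_pow 2 x).const_mul (29 / 10)).sub
    ((hasDerivAt_pow 3 x).const_mul (26 / 5))).sub ((hasDerivAt_pow 4 x).const_mul (21 / 10))).add
    ((hasDerivAt_pow 5 x).const_mul (9 / 5))).congr_deriv ?_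
  norm_num
  ring

theorem hasDerivAt_zerothWeight (x : ℝ) : HasDerivAt zerothWeight
    (87 / 10 * x ^ 2 - 272 / 5 * x ^ 3 + 77 * x ^ 4 + 147 / 5 * x ^ 5 - 63 * x ^ 6) x := by
  refine ((((((hasDerivAt_pow 3 x).const_mul (29 / 10)).sub
    ((hasDerivAt_pow 4 x).const_mul (68 / 5))).add ((hasDerivAt_pow 5 x).const_mul (77 / 5))).add
    ((hasDerivAt_pow 6 x).const_mul (49 / 10))).sub ((hasDerivAt_pow 7 x).const_mul 9)).congr_deriv ?_
  norm_num
  ring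

theorem hasDerivAt_one_sub_three_mul (x : ℝ) : HasDerivAt (fun x : ℝ => 1 - 3 * x) (-3) x := by
  simpa using ((hasDerivAt_id x).const_mul 3).const_sub 1

/-- The derivatives at `p` of the quadratic expressions from which the currents are built.  Here `α`,
`β`, `γ` are the pairings of `D_L̲ D_L φ` with `D_L φ`, `D_L̲ φ`, `φ`, and `NL`, `NB` are the
derivatives of `∑_a |Ω_a φ|²` along `L` and `L̲`.  The last three fields are the equation tested
against `D_L φ`, `D_L̲ φ` and `φ`, after an integration by parts on the spheres. -/
structure CurrentDerivatives (M : ℝ) (φ : OneForm) (p : Pt) (α β γ NL NB : ℝ) : Prop where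
  ll : HasDer (Lbar M) (dotForm (derForm (L M) φ) (derForm (L M) φ)) (2 * α) p
  bb : HasDer (L M) (dotForm (derForm (Lbar M) φ) (derForm (Lbar M) φ)) (2 * β) p
  pl : HasDer (Lbar M) (dotForm φ (derForm (L M) φ))
    (dotForm (derForm (L M) φ) (derForm (Lbar M) φ) p + γ) p
  pb : HasDer (L M) (dotForm φ (derForm (Lbar M) φ))
    (dotForm (derForm (L M) φ) (derForm (Lbar M) φ) p + γ) p
  nL : HasDer (L M) (dotForm φ φ) (2 * dotForm φ (derForm (L M) φ) p) p
  nLbar : HasDer (Lbar M) (dotForm φ φ) (2 * dotForm φ (derForm (Lbar M) φ) p) p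
  rotEnergyL : HasDer (L M) (rotEnergy φ) NL p
  rotEnergyLbar : HasDer (Lbar M) (rotEnergy φ) NB p
  rotL : potential (invRad M p)
    * ∑ a, der (rot a) (dotForm (derForm (L M) φ) (derForm (rot a) φ)) p
      = M ^ 2 * α + potential (invRad M p) * (NL / 2)
  rotLbar : potential (invRad M p)
    * ∑ a, der (rot a) (dotForm (derForm (Lbar M) φ) (derForm (rot a) φ)) p
      = M ^ 2 * β + potential (invRad M p) * (NB / 2)
  rotφ : potential (invRad M p) * ∑ a, der (rot a) (dotForm φ (derForm (rot a) φ)) p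
      = M ^ 2 * γ + potential (invRad M p) * rotEnergy φ p

theorem TangentialOn.currentDerivatives (h : TangentialOn M φ W) (hp : p ∈ W)
    (hFI : FackerellIpserAt M φ p) :
    CurrentDerivatives M φ p (waveDot M φ (derForm (L M) φ) p) (waveDot M φ (derForm (Lbar M) φ) p)
      (waveDot M φ φ p) (2 * ∑ a, dotForm (derForm (rot a) (derForm (L M) φ)) (derForm (rot a) φ) p)
      (2 * ∑ a, dotForm (derForm (rot a) (derForm (Lbar M) φ)) (derForm (rot a) φ) p) where
  ll := (HasDer.dotForm h.isOpen h.smooth_L h.smooth_L hp _).congr_der (by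
    rw [dotForm_comm, waveDot]; ring)
  bb := (HasDer.dotForm h.isOpen h.smooth_Lbar h.smooth_Lbar hp _).congr_der (by
    rw [dotForm_comm, waveDot]
    simp only [dotForm, h.derForm_L_Lbar hp]; ring)
  pl := (HasDer.dotForm h.isOpen h.smooth h.smooth_L hp _).congr_der (by
    rw [dotForm_comm, waveDot])
  pb := (HasDer.dotForm h.isOpen h.smooth h.smooth_Lbar hp _).congr_der (by
    rw [waveDot]
    simp only [dotForm, h.derForm_L_Lbar hp])
  nL := (HasDer.dotForm h.isOpen h.smooth h.smooth hp _).congr_der (by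
    rw [dotForm_comm]; ring)
  nLbar := (HasDer.dotForm h.isOpen h.smooth h.smooth hp _).congr_der (by
    rw [dotForm_comm]; ring)
  rotEnergyL := h.hasDer_L_rotEnergy hp
  rotEnergyLbar := h.hasDer_Lbar_rotEnergy hp
  rotL := by
    rw [h.sum_der_rot hp hFI h.smooth_L (h.isTangent_L hp)]; ring
  rotLbar := by
    rw [h.sum_der_rot hp hFI h.smooth_Lbar (h.isTangent_Lbar hp)]; ring
  rotφ := h.sum_der_rot hp hFI h.smooth (h.isTangent p hp)

/-- Conservation of energy. -/
theorem TangentialOn.divergence_energy (h : TangentialOn M φ W) (hp : p ∈ W)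
    (hFI : FackerellIpserAt M φ p) :
    der (Lbar M) (energyL M φ) p + der (L M) (energyLbar M φ) p
      + ∑ a, der (rot a) (energyAngular M φ a) p = 0 := by
  have hr := h.rad_pos hp
  have hc := h.currentDerivatives hp hFI
  have vL := HasDer.comp (hasDerivAt_potential _) (hasDer_L_invRad h.pos hr)
  have vB := HasDer.comp (hasDerivAt_potential _) (hasDer_Lbar_invRad h.pos hr)
  have vr := fun a => HasDer.comp (hasDerivAt_potential _) (hasDer_rot_invRad (M := M) hr a)
  have e1 : der (Lbar M) (energyL M φ) p = _ := ((hc.ll.const_mul (M ^ 2)).add (vB.mul hc.rotEnergyLbar)).2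
  have e2 : der (L M) (energyLbar M φ) p = _ := ((hc.bb.const_mul (M ^ 2)).add (vL.mul hc.rotEnergyL)).2
  have d1 := fun a => hasDer_of_differentiableAt (X := rot a)
    (HasDer.dotForm h.isOpen h.smooth_L (h.smooth_rot a) hp (rot a)).1
  have d2 := fun a => hasDer_of_differentiableAt (X := rot a)
    (HasDer.dotForm h.isOpen h.smooth_Lbar (h.smooth_rot a) hp (rot a)).1
  have e3 : ∀ a, der (rot a) (energyAngular M φ a) p = _ := fun a =>
    (((vr a).mul ((d1 a).add (d2 a))).const_mul (-2)).2
  have e4 : ∑ a, der (rot a) (energyAngular M φ a) p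
      = -2 * (potential (invRad M p)
          * ∑ a, der (rot a) (dotForm (derForm (L M) φ) (derForm (rot a) φ)) p)
        - 2 * (potential (invRad M p)
          * ∑ a, der (rot a) (dotForm (derForm (Lbar M) φ) (derForm (rot a) φ)) p) := by
    simp only [e3, Finset.mul_sum, ← Finset.sum_sub_distrib]
    exact Finset.sum_congr rfl fun a _ => by ring
  rw [e4, hc.rotL, hc.rotLbar, e1, e2]
  ring

/-- The Morawetz identity. -/
theorem TangentialOn.divergence_morawetz (h : TangentialOn M φ W) (hp : p ∈ W)
    (hFI : FackerellIpserAt M φ p) :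
    -(morawetzBulk M φ p) / M = der (Lbar M) (morawetzL M φ) p + der (L M) (morawetzLbar M φ) p
      + ∑ a, der (rot a) (morawetzAngular M φ a) p := by
  have hM := h.pos
  have hr := h.rad_pos hp
  have hc := h.currentDerivatives hp hFI
  have xL := hasDer_L_invRad hM hr
  have xB := hasDer_Lbar_invRad hM hr
  have xr := fun a => hasDer_rot_invRad (M := M) hr a
  have vL := HasDer.comp (hasDerivAt_potential _) xL
  have vB := HasDer.comp (hasDerivAt_potential _) xB
  have fL := HasDer.comp (hasDerivAt_one_sub_three_mul _) xL
  have fB := HasDer.comp (hasDerivAt_one_sub_three_mul _) xB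
  have wL := HasDer.comp (hasDerivAt_lagrangeWeight _) xL
  have wB := HasDer.comp (hasDerivAt_lagrangeWeight _) xB
  have kL := HasDer.comp (hasDerivAt_zerothWeight _) xL
  have kB := HasDer.comp (hasDerivAt_zerothWeight _) xB
  have vr := fun a => HasDer.comp (hasDerivAt_potential _) (xr a)
  have fr := fun a => HasDer.comp (hasDerivAt_one_sub_three_mul _) (xr a)
  have wr := fun a => HasDer.comp (hasDerivAt_lagrangeWeight _) (xr a)
  have e1 : der (Lbar M) (morawetzL M φ) p = _ :=
    (((fB.mul ((hc.ll.const_mul (M ^ 2)).sub (vB.mul hc.rotEnergyLbar))).add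
      ((wB.mul hc.pl).const_mul M)).add (kB.mul hc.nLbar)).2
  have e2 : der (L M) (morawetzLbar M φ) p = _ :=
    (((fL.mul ((vL.mul hc.rotEnergyL).sub (hc.bb.const_mul (M ^ 2)))).add
      ((wL.mul hc.pb).const_mul M)).sub (kL.mul hc.nL)).2
  have d1 := fun a => hasDer_of_differentiableAt (X := rot a)
    (HasDer.dotForm h.isOpen h.smooth_L (h.smooth_rot a) hp (rot a)).1
  have d2 := fun a => hasDer_of_differentiableAt (X := rot a)
    (HasDer.dotForm h.isOpen h.smooth_Lbar (h.smooth_rot a) hp (rot a)).1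
  have d3 := fun a => hasDer_of_differentiableAt (X := rot a)
    (HasDer.dotForm h.isOpen h.smooth (h.smooth_rot a) hp (rot a)).1
  have e3 : ∀ a, der (rot a) (morawetzAngular M φ a) p = _ := fun a =>
    (((((fr a).mul (vr a)).mul ((d1 a).sub (d2 a))).const_mul (-2)).sub
      ((((vr a).mul (wr a)).mul (d3 a)).const_mul (2 / M))).2
  have e4 : ∑ a, der (rot a) (morawetzAngular M φ a) p
      = -2 * (1 - 3 * invRad M p) * (potential (invRad M p)
          * ∑ a, der (rot a) (dotForm (derForm (L M) φ) (derForm (rot a) φ)) p)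
        + 2 * (1 - 3 * invRad M p) * (potential (invRad M p)
          * ∑ a, der (rot a) (dotForm (derForm (Lbar M) φ) (derForm (rot a) φ)) p)
        - 2 / M * lagrangeWeight (invRad M p) * (potential (invRad M p)
          * ∑ a, der (rot a) (dotForm φ (derForm (rot a) φ)) p) := by
    simp only [e3, Finset.mul_sum, ← Finset.sum_sub_distrib, ← Finset.sum_add_distrib]
    exact Finset.sum_congr rfl fun a _ => by ring
  rw [e4, hc.rotL, hc.rotLbar, hc.rotφ, e1, e2, morawetzBulk]
  simp only [potential, lagrangeWeight, zerothWeight]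
  field_simp
  ring

end Currents

/-! ### Comparison of the angular norms with the Euclidean ones -/

theorem sum_sq_le_sq_sum_abs {ι : Type*} [Fintype ι] (s : ι → ℝ) :
    ∑ a, s a ^ 2 ≤ (∑ a, |s a|) ^ 2 := by
  have := Finset.sum_sq_le_sq_sum_of_nonneg (s := Finset.univ) (f := fun a => |s a|)
    fun _ _ => abs_nonneg _
  simpa only [sq_abs] using this

theorem sq_sum_abs_le {ι : Type*} [Fintype ι] (s : ι → ℝ) :
    (∑ a, |s a|) ^ 2 ≤ Fintype.card ι * ∑ a, s a ^ 2 := by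
  have := sq_sum_le_card_mul_sum_sq (s := Finset.univ) (f := fun a => |s a|)
  simpa only [sq_abs, Finset.card_univ] using this

/-- The rotations form a tight frame of the tangent spaces of the spheres. -/
theorem sum_rot_sq {p : Pt} (hp : 0 < rad p) {η : Fin 4 → ℝ} (hη : η 0 = 0) :
    ∑ a, (∑ i, η i * rot a p i) ^ 2
      = rad p ^ 2 * (∑ i, η i ^ 2 - (dr p 1 * η 1 + dr p 2 * η 2 + dr p 3 * η 3) ^ 2) := by
  have e1 := dr_mul_rad hp 1
  have e2 := dr_mul_rad hp 2
  have e3 := dr_mul_rad hp 3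
  simp only [Fin.isValue, Fin.reduceEq, if_false] at e1 e2 e3
  have h : rad p ^ 2 * (∑ i, η i ^ 2 - (dr p 1 * η 1 + dr p 2 * η 2 + dr p 3 * η 3) ^ 2)
      = rad p ^ 2 * ∑ i, η i ^ 2 - ((dr p 1 * rad p) * η 1 + (dr p 2 * rad p) * η 2
        + (dr p 3 * rad p) * η 3) ^ 2 := by ring
  rw [h, e1, e2, e3, rad_sq]
  simp [Fin.sum_univ_three, Fin.sum_univ_four, rot, hη]
  ring

theorem sum_rot_div_sq {p : Pt} (hp : 0 < rad p) {η : Fin 4 → ℝ} (hη : IsTangent p η) :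
    ∑ a, (∑ i, η i * (rot a p i / rad p)) ^ 2 = ∑ i, η i ^ 2 := by
  have h0 := hp.ne'
  have h1 := sum_rot_sq hp hη.1
  rw [hη.2] at h1
  simp only [mul_div_assoc', ← Finset.sum_div, div_pow, h1]
  field_simp
  ring

theorem le_normOne_sq {p : Pt} (hp : 0 < rad p) {η : Fin 4 → ℝ} (hη : IsTangent p η) :
    ∑ i, η i ^ 2 ≤ normOne p η ^ 2 := by
  rw [← sum_rot_div_sq hp hη]
  exact sum_sq_le_sq_sum_abs _

theorem normOne_sq_le {p : Pt} (hp : 0 < rad p) {η : Fin 4 → ℝ} (hη : IsTangent p η) :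
    normOne p η ^ 2 ≤ 3 * ∑ i, η i ^ 2 := by
  rw [← sum_rot_div_sq hp hη]
  simpa [normOne] using sq_sum_abs_le fun a => ∑ i, η i * (rot a p i / rad p)

section Estimates

variable {M : ℝ} {W : Set Pt} {φ : OneForm} {p : Pt}

theorem dotForm_self (η : OneForm) (p : Pt) : dotForm η η p = ∑ c, η p c ^ 2 :=
  Finset.sum_congr rfl fun _ _ => by ring

theorem TangentialOn.slashAlong_L (h : TangentialOn M φ W) (hp : p ∈ W) :
    slashAlong M (L M) φ p = derForm (L M) φ p :=
  funext fun j => slashAlong_eq_der h.pos h.isOpen h.subset h.smooth h.isTangent hp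
    (sum_sph_L (h.rad_pos hp)) j

theorem TangentialOn.slashAlong_Lbar (h : TangentialOn M φ W) (hp : p ∈ W) :
    slashAlong M (Lbar M) φ p = derForm (Lbar M) φ p :=
  funext fun j => slashAlong_eq_der h.pos h.isOpen h.subset h.smooth h.isTangent hp
    (sum_sph_Lbar (h.rad_pos hp)) j

/-- Evaluated on rotations, the angular gradient only sees the componentwise derivatives `Ω_a φ`. -/
theorem TangentialOn.slashGrad_rot (h : TangentialOn M φ W) (hp : p ∈ W) (a b : Fin 3) :
    ∑ i, ∑ j, slashGrad M φ p i j * (rot a p i / rad p) * (rot b p j / rad p)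
      = (∑ j, derForm (rot a) φ p j * rot b p j) / rad p ^ 2 := by
  have hr := (h.rad_pos hp).ne'
  have h1 := sum_rot_mul_dr a p
  have h2 := sum_rot_mul_dr b p
  have e := slashGrad_eq h.pos h.isOpen h.subset h.smooth h.isTangent hp
  simp only [e, derForm, der_eq_sum (rot a)]
  -- the radial derivative is not expanded, as `dr` annihilates the rotations
  generalize hR : (fun c => der dr (fun q => φ q c) p) = R
  have hR' : ∀ c, der dr (fun q => φ q c) p = R c := fun c => by rw [← hR]
  simp only [hR']
  simp only [Fin.sum_univ_four, rot_zero, dr_zero, dt, Matrix.cons_val] at h1 h2 ⊢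
  field_simp
  linear_combination (-(rad p) * (R 1 * rot b p 1 + R 2 * rot b p 2 + R 3 * rot b p 3)) * h1
    + (rot a p 1 * φ p 1 + rot a p 2 * φ p 2 + rot a p 3 * φ p 3) * h2

/-- `r² |∇̸φ|² + |φ|² = ∑_a |Ω_a φ|²`. -/
theorem TangentialOn.sum_slashGrad_rot_sq (h : TangentialOn M φ W) (hp : p ∈ W) :
    ∑ a, ∑ b, (∑ i, ∑ j, slashGrad M φ p i j * (rot a p i / rad p) * (rot b p j / rad p)) ^ 2
      = (rotEnergy φ p - dotForm φ φ p) / rad p ^ 2 := by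
  have hrp := h.rad_pos hp
  have hr := hrp.ne'
  have h0 : ∀ a, derForm (rot a) φ p 0 = 0 := fun a => by
    rw [derForm, der_eq_sum]
    refine Finset.sum_eq_zero fun i _ => ?_
    rw [pd_congr i h.isOpen (fun q hq => (h.isTangent q hq).1) hp, pd_const, mul_zero]
  have hn : ∀ a, dr p 1 * derForm (rot a) φ p 1 + dr p 2 * derForm (rot a) φ p 2
      + dr p 3 * derForm (rot a) φ p 3 = -(∑ i, φ p i * rot a p i) / rad p := by
    intro a
    have h1 := fun i => sum_dr_mul_pd h.isOpen (fun _ => h.rad_pos) h.smooth h.isTangent hp i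
    have h2 : -(∑ i, φ p i * rot a p i) / rad p = ∑ i, rot a p i * (-φ p i / rad p) := by
      rw [← Finset.sum_neg_distrib, Finset.sum_div]
      exact Finset.sum_congr rfl fun i _ => by ring
    rw [h2]
    simp only [← h1, derForm, der_eq_sum, Fin.sum_univ_four]
    ring
  have h3 := sum_rot_sq hrp (h.isTangent p hp).1
  rw [(h.isTangent p hp).2] at h3
  have h4 : ∀ a, ∑ b, (∑ j, derForm (rot a) φ p j * rot b p j) ^ 2
      = rad p ^ 2 * dotForm (derForm (rot a) φ) (derForm (rot a) φ) p
        - (∑ i, φ p i * rot a p i) ^ 2 := by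
    intro a
    rw [sum_rot_sq hrp (h0 a), hn a, dotForm_self]
    field_simp
  simp only [h.slashGrad_rot hp, div_pow, ← Finset.sum_div, h4, Finset.sum_sub_distrib, h3,
    ← Finset.mul_sum]
  rw [rotEnergy, dotForm_self φ]
  field_simp
  ring

theorem TangentialOn.dotForm_le_rotEnergy (h : TangentialOn M φ W) (hp : p ∈ W) :
    dotForm φ φ p ≤ rotEnergy φ p := by
  have hrp := h.rad_pos hp
  have h1 := h.sum_slashGrad_rot_sq hp
  have h2 : 0 ≤ (rotEnergy φ p - dotForm φ φ p) / rad p ^ 2 := by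
    rw [← h1]; positivity
  rw [div_nonneg_iff] at h2
  have h3 : 0 < rad p ^ 2 := by positivity
  rcases h2 with h2 | h2 <;> linarith

theorem TangentialOn.le_normTwo_sq (h : TangentialOn M φ W) (hp : p ∈ W) :
    (rotEnergy φ p - dotForm φ φ p) / rad p ^ 2 ≤ normTwo p (slashGrad M φ p) ^ 2 := by
  rw [← h.sum_slashGrad_rot_sq hp, normTwo, ← Fintype.sum_prod_type', ← Fintype.sum_prod_type']
  exact sum_sq_le_sq_sum_abs _

theorem TangentialOn.normTwo_sq_le (h : TangentialOn M φ W) (hp : p ∈ W) :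
    normTwo p (slashGrad M φ p) ^ 2 ≤ 9 * ((rotEnergy φ p - dotForm φ φ p) / rad p ^ 2) := by
  rw [← h.sum_slashGrad_rot_sq hp, normTwo, ← Fintype.sum_prod_type', ← Fintype.sum_prod_type']
  refine (sq_sum_abs_le _).trans (le_of_eq ?_)
  norm_num

/-! ### Coercivity of the Morawetz current -/

theorem invRad_pos (hM : 0 < M) (hp : p ∈ exterior M) : 0 < invRad M p :=
  div_pos hM (rad_pos hM hp)

theorem invRad_lt (hM : 0 < M) (hp : p ∈ exterior M) : invRad M p < 1 / 2 := by
  rw [invRad, div_lt_iff₀ (rad_pos hM hp)]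
  have : 2 * M < rad p := hp
  linarith

theorem potential_pos {x : ℝ} (h0 : 0 < x) (h1 : x < 1 / 2) : 0 < potential x := by
  have : potential x = x ^ 2 * (1 - 2 * x) := by rw [potential]; ring
  rw [this]
  exact mul_pos (by positivity) (by linarith)

theorem potential_le_one {x : ℝ} (h0 : 0 < x) (h1 : x < 1 / 2) : potential x ≤ 1 := by
  have h2 : x ^ 2 ≤ 1 := by nlinarith
  have h3 : 0 < x ^ 3 := by positivity
  rw [potential]
  linarith

/-- The coefficient of `|φ|²` in the Morawetz bulk term, after completing the square in the radial
derivative and using `|φ|² ≤ ∑_a |Ω_a φ|²`. -/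
theorem zeroth_coefficient_pos {x : ℝ} (h0 : 0 ≤ x) (h1 : x ≤ 1 / 2) :
    x / 10 ≤ (4 * x - potential x / 5) * (1 - 3 * x) ^ 2
      - 2 * (87 / 10 * x ^ 2 - 272 / 5 * x ^ 3 + 77 * x ^ 4 + 147 / 5 * x ^ 5 - 63 * x ^ 6)
      - 160 / 29 * x ^ 6 := by
  have h : 1 / 10 ≤ (4 - x * (1 - 2 * x) / 5) * (1 - 3 * x) ^ 2 - 87 / 5 * x + 544 / 5 * x ^ 2
      - 154 * x ^ 3 - 294 / 5 * x ^ 4 + 126 * x ^ 5 - 160 / 29 * x ^ 5 := by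
    have h2 := sub_nonneg.2 h1
    nlinarith [mul_nonneg h0 (sq_nonneg (x - 1 / 4)), mul_nonneg h2 (sq_nonneg (x - 1 / 4)),
      mul_nonneg h0 (sq_nonneg (x - 2 / 5)), mul_nonneg h2 (sq_nonneg (x - 1 / 5)),
      mul_nonneg h0 (sq_nonneg (x * (x - 1 / 4))), mul_nonneg h2 (sq_nonneg (x * (x - 1 / 4))),
      sq_nonneg (x * (x - 1 / 4)), sq_nonneg (x - 1 / 4), mul_nonneg h0 h2,
      mul_nonneg (mul_nonneg h0 h0) h2, mul_nonneg (mul_nonneg h0 h0) (mul_nonneg h0 h2)]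
  have h2 := mul_le_mul_of_nonneg_left h h0
  rw [potential]
  linarith

theorem dotForm_square_nonneg (s t : ℝ) (η ψ : OneForm) (p : Pt) :
    0 ≤ s ^ 2 * dotForm η η p + 2 * s * t * dotForm η ψ p + t ^ 2 * dotForm ψ ψ p := by
  have : s ^ 2 * dotForm η η p + 2 * s * t * dotForm η ψ p + t ^ 2 * dotForm ψ ψ p
      = ∑ c, (s * η p c + t * ψ p c) ^ 2 := by
    simp only [dotForm, Finset.mul_sum, ← Finset.sum_add_distrib]
    exact Finset.sum_congr rfl fun _ _ => by ring
  rw [this]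
  positivity

theorem dotForm_sub_square_nonneg (s t : ℝ) (η ψ ξ : OneForm) (p : Pt) :
    0 ≤ s ^ 2 * (dotForm η η p - 2 * dotForm η ψ p + dotForm ψ ψ p)
      + 2 * s * t * (dotForm ξ η p - dotForm ξ ψ p) + t ^ 2 * dotForm ξ ξ p := by
  have : s ^ 2 * (dotForm η η p - 2 * dotForm η ψ p + dotForm ψ ψ p)
      + 2 * s * t * (dotForm ξ η p - dotForm ξ ψ p) + t ^ 2 * dotForm ξ ξ p
      = ∑ c, (s * (η p c - ψ p c) + t * ξ p c) ^ 2 := by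
    simp only [dotForm, Finset.mul_sum, ← Finset.sum_add_distrib, ← Finset.sum_sub_distrib]
    exact Finset.sum_congr rfl fun _ _ => by ring
  rw [this]
  positivity

/-- Coercivity of the bulk term: degenerate at `r = 3M` in the angular and time derivatives only. -/
theorem TangentialOn.le_morawetzBulk (h : TangentialOn M φ W) (hp : p ∈ W) :
    potential (invRad M p) * (1 / 20 * (M ^ 2 * (dotForm (derForm (L M) φ) (derForm (L M) φ) p
          - 2 * dotForm (derForm (L M) φ) (derForm (Lbar M) φ) p
          + dotForm (derForm (Lbar M) φ) (derForm (Lbar M) φ) p))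
        + (1 - 3 * invRad M p) ^ 2 / 20 * (M ^ 2 * (dotForm (derForm (L M) φ) (derForm (L M) φ) p
          + 2 * dotForm (derForm (L M) φ) (derForm (Lbar M) φ) p
          + dotForm (derForm (Lbar M) φ) (derForm (Lbar M) φ) p))
        + 3 * invRad M p * (1 - 3 * invRad M p) ^ 2 * (rotEnergy φ p - dotForm φ φ p)
        + invRad M p / 10 * dotForm φ φ p) ≤ morawetzBulk M φ p := by
  have x0 := invRad_pos h.pos (h.subset hp)
  have x1 := invRad_lt h.pos (h.subset hp)
  have hN := h.dotForm_le_rotEnergy hp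
  have hn := dotForm_self_nonneg φ p
  have hB := zeroth_coefficient_pos x0.le x1.le
  have hzz := dotForm_sub_square_nonneg M 0 (derForm (L M) φ) (derForm (Lbar M) φ) φ p
  -- `29/10` of the coefficient `3` of `|D_L φ - D_L̲ φ|²` is spent on absorbing the cross term
  have hsq := dotForm_sub_square_nonneg (29 / 10 * M) (4 * invRad M p ^ 3) (derForm (L M) φ)
    (derForm (Lbar M) φ) φ p
  rw [morawetzBulk]
  refine mul_le_mul_of_nonneg_left ?_ (potential_pos x0 x1).le
  have hcV : potential (invRad M p) ≤ invRad M p := by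
    rw [potential]
    nlinarith [pow_pos x0 3]
  set x := invRad M p
  set n := dotForm φ φ p
  set N := rotEnergy φ p
  have hy : (1 - 3 * x) ^ 2 ≤ 1 := by nlinarith
  have i1 := mul_le_mul_of_nonneg_right hB hn
  have i2 : 0 ≤ (x - potential x / 5) * (1 - 3 * x) ^ 2 * (N - n) :=
    mul_nonneg (mul_nonneg (by linarith) (sq_nonneg _)) (by linarith)
  have i3 := mul_le_mul_of_nonneg_right hy hzz
  nlinarith

theorem lagrangeWeight_sq_le {x : ℝ} (h0 : 0 < x) (h1 : x < 1 / 2) :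
    lagrangeWeight x ^ 2 ≤ 9 * potential x := by
  have h2 : lagrangeWeight x = potential x * (3 - (1 - 3 * x) ^ 2 / 10) := by
    rw [lagrangeWeight, potential]; ring
  have hv := potential_pos h0 h1
  have hv1 := potential_le_one h0 h1
  have hy : (1 - 3 * x) ^ 2 ≤ 1 := by nlinarith
  have h3 : (3 - (1 - 3 * x) ^ 2 / 10) ^ 2 ≤ 9 := by nlinarith [sq_nonneg (1 - 3 * x)]
  have h4 : potential x ^ 2 ≤ potential x := by nlinarith
  rw [h2, mul_pow]
  nlinarith [sq_nonneg (potential x)]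

theorem abs_zerothWeight_le {x : ℝ} (h0 : 0 < x) (h1 : x < 1 / 2) :
    |zerothWeight x| ≤ 10 * potential x := by
  have h2 : zerothWeight x
      = (29 / 10 * x - 39 / 5 * x ^ 2 - 1 / 5 * x ^ 3 + 9 / 2 * x ^ 4) * potential x := by
    rw [zerothWeight, potential]; ring
  have hv := potential_pos h0 h1
  have p2 : x ^ 2 ≤ 1 := pow_le_one₀ h0.le (by linarith)
  have p3 : x ^ 3 ≤ 1 := pow_le_one₀ h0.le (by linarith)
  have p4 : x ^ 4 ≤ 1 := pow_le_one₀ h0.le (by linarith)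
  have q2 : 0 < x ^ 2 := by positivity
  have q3 : 0 < x ^ 3 := by positivity
  have q4 : 0 < x ^ 4 := by positivity
  rw [h2, abs_mul, abs_of_pos hv]
  refine mul_le_mul_of_nonneg_right ?_ hv.le
  rw [abs_le]
  constructor <;> linarith

/-- A quadratic current with bounded weight `f` and with lower-order weights `w`, `k` that decay like
the potential is bounded by the energy density. -/
theorem abs_current_le {f w k V A N n l : ℝ} (hf : |f| ≤ 1) (hA : 0 ≤ A) (hn : 0 ≤ n) (hnN : n ≤ N)
    (hV : 0 ≤ V) (hl : |2 * w * l| ≤ A + w ^ 2 * n) (hw : w ^ 2 ≤ 9 * V) (hk : |k| ≤ 10 * V) :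
    |f * (A - V * N) + w * l + k * n| ≤ 16 * (A + V * N) := by
  have hVN : 0 ≤ V * N := mul_nonneg hV (hn.trans hnN)
  have e1 : |f * (A - V * N)| ≤ A + V * N := by
    rw [abs_mul]
    have : |A - V * N| ≤ A + V * N := abs_le.2 ⟨by linarith, by linarith⟩
    calc |f| * |A - V * N| ≤ 1 * |A - V * N| := mul_le_mul_of_nonneg_right hf (abs_nonneg _)
      _ ≤ _ := by linarith
  have e2 : |w * l| ≤ 1 / 2 * (A + 9 * (V * N)) := by
    have h2 : |2 * w * l| = 2 * |w * l| := by rw [mul_assoc, abs_mul]; norm_num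
    have h3 : w ^ 2 * n ≤ 9 * V * N := by
      calc w ^ 2 * n ≤ 9 * V * n := mul_le_mul_of_nonneg_right hw hn
        _ ≤ 9 * V * N := mul_le_mul_of_nonneg_left hnN (by linarith)
    linarith
  have e3 : |k * n| ≤ 10 * (V * N) := by
    rw [abs_mul, abs_of_nonneg hn]
    calc |k| * n ≤ 10 * V * n := mul_le_mul_of_nonneg_right hk hn
      _ ≤ 10 * V * N := mul_le_mul_of_nonneg_left hnN (by linarith)
      _ = _ := by ring
  have := abs_add_three (f * (A - V * N)) (w * l) (k * n)
  linarith

theorem abs_two_mul_dotForm_le (w : ℝ) (η : OneForm) :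
    |2 * w * (M * dotForm φ η p)| ≤ M ^ 2 * dotForm η η p + w ^ 2 * dotForm φ φ p := by
  have h1 := dotForm_square_nonneg w M φ η p
  have h2 := dotForm_square_nonneg w (-M) φ η p
  rw [abs_le]
  constructor <;> linarith

theorem abs_one_sub_three_mul_le {x : ℝ} (h0 : 0 < x) (h1 : x < 1 / 2) : |1 - 3 * x| ≤ 1 :=
  abs_le.2 ⟨by linarith, by linarith⟩

theorem TangentialOn.abs_morawetzL_le (h : TangentialOn M φ W) (hp : p ∈ W) :
    |morawetzL M φ p| ≤ 16 * energyL M φ p := by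
  have x0 := invRad_pos h.pos (h.subset hp)
  have x1 := invRad_lt h.pos (h.subset hp)
  have := abs_current_le (abs_one_sub_three_mul_le x0 x1)
    (mul_nonneg (sq_nonneg M) (dotForm_self_nonneg (derForm (L M) φ) p)) (dotForm_self_nonneg φ p)
    (h.dotForm_le_rotEnergy hp) (potential_pos x0 x1).le (abs_two_mul_dotForm_le _ _)
    (lagrangeWeight_sq_le x0 x1) (abs_zerothWeight_le x0 x1)
  refine (le_of_eq ?_).trans this
  rw [morawetzL]
  congr 1
  ring

theorem TangentialOn.abs_morawetzLbar_le (h : TangentialOn M φ W) (hp : p ∈ W) :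
    |morawetzLbar M φ p| ≤ 16 * energyLbar M φ p := by
  have x0 := invRad_pos h.pos (h.subset hp)
  have x1 := invRad_lt h.pos (h.subset hp)
  have := abs_current_le (f := -(1 - 3 * invRad M p)) (k := -zerothWeight (invRad M p))
    (by rw [abs_neg]; exact abs_one_sub_three_mul_le x0 x1)
    (mul_nonneg (sq_nonneg M) (dotForm_self_nonneg (derForm (Lbar M) φ) p))
    (dotForm_self_nonneg φ p)
    (h.dotForm_le_rotEnergy hp) (potential_pos x0 x1).le (abs_two_mul_dotForm_le _ _)
    (lagrangeWeight_sq_le x0 x1) (by rw [abs_neg]; exact abs_zerothWeight_le x0 x1)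
  refine (le_of_eq ?_).trans this
  rw [morawetzLbar]
  congr 1
  ring

theorem TangentialOn.le_angularDensity (h : TangentialOn M φ W) (hp : p ∈ W) :
    potential (invRad M p) * rotEnergy φ p ≤ M ^ 2 * angularDensity M φ p := by
  have hr := h.rad_pos hp
  have ha := one_sub_mu_pos h.pos (h.subset hp)
  have h1 := mul_le_mul_of_nonneg_left (h.le_normTwo_sq hp) ha.le
  have h2 := mul_le_mul_of_nonneg_left (le_normOne_sq hr (h.isTangent p hp))
    (div_pos ha (pow_pos hr 2)).le
  rw [← dotForm_self] at h2
  rw [potential_invRad h.pos hr, angularDensity, mul_assoc]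
  refine mul_le_mul_of_nonneg_left ?_ (sq_nonneg M)
  refine (le_of_eq ?_).trans (add_le_add h1 h2)
  ring

theorem TangentialOn.energyL_le (h : TangentialOn M φ W) (hp : p ∈ W) :
    energyL M φ p
      ≤ M ^ 2 * (normOne p (slashAlong M (L M) φ p) ^ 2 + angularDensity M φ p) := by
  have h1 := le_normOne_sq (h.rad_pos hp) (h.isTangent_L hp)
  rw [← dotForm_self] at h1
  rw [h.slashAlong_L hp, energyL, mul_add]
  exact add_le_add (mul_le_mul_of_nonneg_left h1 (sq_nonneg M)) (h.le_angularDensity hp)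

theorem TangentialOn.energyLbar_le (h : TangentialOn M φ W) (hp : p ∈ W) :
    energyLbar M φ p
      ≤ M ^ 2 * (normOne p (slashAlong M (Lbar M) φ p) ^ 2 + angularDensity M φ p) := by
  have h1 := le_normOne_sq (h.rad_pos hp) (h.isTangent_Lbar hp)
  rw [← dotForm_self] at h1
  rw [h.slashAlong_Lbar hp, energyLbar, mul_add]
  exact add_le_add (mul_le_mul_of_nonneg_left h1 (sq_nonneg M)) (h.le_angularDensity hp)

theorem morawetzDensity_nonneg (hM : 0 < M) (hp : p ∈ exterior M) :
    0 ≤ morawetzDensity M φ p * (1 - mu M p) := by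
  have hr := rad_pos hM hp
  have ha := one_sub_mu_pos hM hp
  rw [morawetzDensity]
  positivity

/-- The Morawetz density is bounded by the bulk term of the Morawetz identity. -/
theorem TangentialOn.morawetzDensity_le (h : TangentialOn M φ W) (hp : p ∈ W) :
    morawetzDensity M φ p * (1 - mu M p)
      ≤ 60 * (1 / M ^ 4 + 1 / M ^ 3) * morawetzBulk M φ p := by
  have hM := h.pos
  have hr := h.rad_pos hp
  have ha := one_sub_mu_pos hM (h.subset hp)
  have x0 := invRad_pos hM (h.subset hp)
  have x1 := invRad_lt hM (h.subset hp)
  have hV := potential_pos x0 x1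
  have htL := h.isTangent_L hp
  have htB := h.isTangent_Lbar hp
  have hN := h.dotForm_le_rotEnergy hp
  have hn := dotForm_self_nonneg φ p
  have hbulk := h.le_morawetzBulk hp
  have hzz := dotForm_sub_square_nonneg 1 0 (derForm (L M) φ) (derForm (Lbar M) φ) φ p
  have hss := dotForm_square_nonneg 1 1 (derForm (L M) φ) (derForm (Lbar M) φ) p
  have tz : IsTangent p (derForm (L M) φ p - derForm (Lbar M) φ p) :=
    ⟨by simp [htL.1, htB.1], by simp only [Pi.sub_apply]; linarith [htL.2, htB.2]⟩
  have ts : IsTangent p (derForm (L M) φ p + derForm (Lbar M) φ p) :=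
    ⟨by simp [htL.1, htB.1], by simp only [Pi.add_apply]; linarith [htL.2, htB.2]⟩
  have b1 := normOne_sq_le hr tz
  have b2 := normOne_sq_le hr ts
  have b3 := normOne_sq_le hr (h.isTangent p hp)
  have b4 := h.normTwo_sq_le hp
  have ez : ∑ i, (derForm (L M) φ p - derForm (Lbar M) φ p) i ^ 2
      = dotForm (derForm (L M) φ) (derForm (L M) φ) p
        - 2 * dotForm (derForm (L M) φ) (derForm (Lbar M) φ) p
        + dotForm (derForm (Lbar M) φ) (derForm (Lbar M) φ) p := by
    simp only [dotForm, Finset.mul_sum, ← Finset.sum_add_distrib, ← Finset.sum_sub_distrib]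
    exact Finset.sum_congr rfl fun _ _ => by rw [Pi.sub_apply]; ring
  have es : ∑ i, (derForm (L M) φ p + derForm (Lbar M) φ p) i ^ 2
      = dotForm (derForm (L M) φ) (derForm (L M) φ) p
        + 2 * dotForm (derForm (L M) φ) (derForm (Lbar M) φ) p
        + dotForm (derForm (Lbar M) φ) (derForm (Lbar M) φ) p := by
    simp only [dotForm, Finset.mul_sum, ← Finset.sum_add_distrib]
    exact Finset.sum_congr rfl fun _ _ => by rw [Pi.add_apply]; ring
  rw [ez] at b1
  rw [es] at b2
  rw [← dotForm_self] at b3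
  have hdens : morawetzDensity M φ p * (1 - mu M p)
      = potential (invRad M p) / M ^ 2 *
        (normOne p (derForm (L M) φ p - derForm (Lbar M) φ p) ^ 2
          + (1 - 3 * invRad M p) ^ 2 * (rad p * normTwo p (slashGrad M φ p) ^ 2
            + normOne p (derForm (L M) φ p + derForm (Lbar M) φ p) ^ 2)
          + invRad M p / M * normOne p (φ p) ^ 2) := by
    rw [morawetzDensity, h.slashAlong_L hp, h.slashAlong_Lbar hp, potential_invRad hM hr, invRad]
    field_simp
  have b4' : rad p * normTwo p (slashGrad M φ p) ^ 2
      ≤ 9 * (invRad M p / M * (rotEnergy φ p - dotForm φ φ p)) := by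
    refine (mul_le_mul_of_nonneg_left b4 hr.le).trans (le_of_eq ?_)
    rw [invRad]
    field_simp
  set zz := dotForm (derForm (L M) φ) (derForm (L M) φ) p
    - 2 * dotForm (derForm (L M) φ) (derForm (Lbar M) φ) p
    + dotForm (derForm (Lbar M) φ) (derForm (Lbar M) φ) p with hzz_def
  set ss := dotForm (derForm (L M) φ) (derForm (L M) φ) p
    + 2 * dotForm (derForm (L M) φ) (derForm (Lbar M) φ) p
    + dotForm (derForm (Lbar M) φ) (derForm (Lbar M) φ) p with hss_def
  have hz0 : 0 ≤ zz := by linarith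
  have hs0 : 0 ≤ ss := by linarith
  set x := invRad M p
  set y := (1 - 3 * x) ^ 2 with hy_def
  have hy : 0 ≤ y := sq_nonneg _
  set D := rotEnergy φ p - dotForm φ φ p with hD_def
  have hD : 0 ≤ D := by linarith
  set n := dotForm φ φ p
  have hK : 0 ≤ 60 * (1 / M ^ 4 + 1 / M ^ 3) := by positivity
  rw [hdens]
  calc _ ≤ potential x / M ^ 2 * (3 * zz + y * (9 * (x / M * D) + 3 * ss) + x / M * (3 * n)) := by
        refine mul_le_mul_of_nonneg_left ?_ (by positivity)
        gcongr
    _ ≤ 60 * (1 / M ^ 4 + 1 / M ^ 3) * (potential x * (1 / 20 * (M ^ 2 * zz) + y / 20 * (M ^ 2 * ss)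
          + 3 * x * y * D + x / 10 * n)) := by
        have e : 60 * (1 / M ^ 4 + 1 / M ^ 3) * (potential x * (1 / 20 * (M ^ 2 * zz)
            + y / 20 * (M ^ 2 * ss) + 3 * x * y * D + x / 10 * n))
            - potential x / M ^ 2 * (3 * zz + y * (9 * (x / M * D) + 3 * ss) + x / M * (3 * n))
            = potential x * (3 / M * zz + 3 / M * y * ss + (180 / M ^ 4 + 171 / M ^ 3) * x * y * D
              + (6 / M ^ 4 + 3 / M ^ 3) * x * n) := by
          field_simp
          ring
        have : 0 ≤ potential x * (3 / M * zz + 3 / M * y * ss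
            + (180 / M ^ 4 + 171 / M ^ 3) * x * y * D + (6 / M ^ 4 + 3 / M ^ 3) * x * n) := by
          positivity
        linarith
    _ ≤ _ := mul_le_mul_of_nonneg_left hbulk hK

end Estimates

/-! ### Integration of the currents -/

section Integration

variable {M : ℝ} {W : Set Pt} {φ : OneForm}

theorem smoothOn_comp_invRad (hM : 0 < M) (hWM : W ⊆ exterior M) {G : ℝ → ℝ}
    (hG : ContDiff ℝ ((⊤ : ℕ∞) : WithTop ℕ∞) G) : SmoothOn (fun p => G (invRad M p)) W :=
  hG.comp_contDiffOn (smoothOn_invRad hM hWM)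

theorem contDiff_potential : ContDiff ℝ ((⊤ : ℕ∞) : WithTop ℕ∞) potential := by
  unfold potential; fun_prop

theorem contDiff_lagrangeWeight : ContDiff ℝ ((⊤ : ℕ∞) : WithTop ℕ∞) lagrangeWeight := by
  unfold lagrangeWeight; fun_prop

theorem contDiff_zerothWeight : ContDiff ℝ ((⊤ : ℕ∞) : WithTop ℕ∞) zerothWeight := by
  unfold zerothWeight; fun_prop

theorem TangentialOn.smooth_energyL (h : TangentialOn M φ W) : SmoothOn (energyL M φ) W :=
  (contDiffOn_const.mul (h.smooth_L.dotForm h.smooth_L)).add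
    ((smoothOn_comp_invRad h.pos h.subset contDiff_potential).mul h.smooth_rotEnergy)

theorem TangentialOn.smooth_energyLbar (h : TangentialOn M φ W) : SmoothOn (energyLbar M φ) W :=
  (contDiffOn_const.mul (h.smooth_Lbar.dotForm h.smooth_Lbar)).add
    ((smoothOn_comp_invRad h.pos h.subset contDiff_potential).mul h.smooth_rotEnergy)

theorem TangentialOn.smooth_energyAngular (h : TangentialOn M φ W) (a : Fin 3) :
    SmoothOn (energyAngular M φ a) W :=
  contDiffOn_const.mul ((smoothOn_comp_invRad h.pos h.subset contDiff_potential).mul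
    ((h.smooth_L.dotForm (h.smooth_rot a)).add (h.smooth_Lbar.dotForm (h.smooth_rot a))))

theorem TangentialOn.smooth_morawetzL (h : TangentialOn M φ W) : SmoothOn (morawetzL M φ) W :=
  (((smoothOn_comp_invRad h.pos h.subset (G := fun x => 1 - 3 * x) (by fun_prop)).mul
    ((contDiffOn_const.mul (h.smooth_L.dotForm h.smooth_L)).sub
      ((smoothOn_comp_invRad h.pos h.subset contDiff_potential).mul h.smooth_rotEnergy))).add
    (contDiffOn_const.mul ((smoothOn_comp_invRad h.pos h.subset contDiff_lagrangeWeight).mul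
      (h.smooth.dotForm h.smooth_L)))).add
    ((smoothOn_comp_invRad h.pos h.subset contDiff_zerothWeight).mul (h.smooth.dotForm h.smooth))

theorem TangentialOn.smooth_morawetzLbar (h : TangentialOn M φ W) :
    SmoothOn (morawetzLbar M φ) W :=
  (((smoothOn_comp_invRad h.pos h.subset (G := fun x => 1 - 3 * x) (by fun_prop)).mul
    (((smoothOn_comp_invRad h.pos h.subset contDiff_potential).mul h.smooth_rotEnergy).sub
      (contDiffOn_const.mul (h.smooth_Lbar.dotForm h.smooth_Lbar)))).add
    (contDiffOn_const.mul ((smoothOn_comp_invRad h.pos h.subset contDiff_lagrangeWeight).mul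
      (h.smooth.dotForm h.smooth_Lbar)))).sub
    ((smoothOn_comp_invRad h.pos h.subset contDiff_zerothWeight).mul (h.smooth.dotForm h.smooth))

theorem TangentialOn.smooth_morawetzAngular (h : TangentialOn M φ W) (a : Fin 3) :
    SmoothOn (morawetzAngular M φ a) W :=
  (contDiffOn_const.mul (((smoothOn_comp_invRad h.pos h.subset
      (G := fun x => 1 - 3 * x) (by fun_prop)).mul
      (smoothOn_comp_invRad h.pos h.subset contDiff_potential)).mul
    ((h.smooth_L.dotForm (h.smooth_rot a)).sub (h.smooth_Lbar.dotForm (h.smooth_rot a))))).sub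
    (contDiffOn_const.mul (((smoothOn_comp_invRad h.pos h.subset contDiff_potential).mul
      (smoothOn_comp_invRad h.pos h.subset contDiff_lagrangeWeight)).mul
        (h.smooth.dotForm (h.smooth_rot a))))

theorem TangentialOn.continuousOn_morawetzBulk (h : TangentialOn M φ W) :
    ContinuousOn (morawetzBulk M φ) W := by
  have hx := (smoothOn_invRad h.pos h.subset).continuousOn
  have hV := (smoothOn_comp_invRad h.pos h.subset contDiff_potential).continuousOn
  have h1 := (h.smooth_L.dotForm h.smooth_L).continuousOn
  have h2 := (h.smooth_Lbar.dotForm h.smooth_Lbar).continuousOn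
  have h3 := (h.smooth_L.dotForm h.smooth_Lbar).continuousOn
  have h4 := h.smooth_rotEnergy.continuousOn
  have h5 := (h.smooth.dotForm h.smooth).continuousOn
  have h6 := (h.smooth.dotForm h.smooth_L).continuousOn
  have h7 := (h.smooth.dotForm h.smooth_Lbar).continuousOn
  unfold morawetzBulk
  dsimp only
  fun_prop

theorem continuousOn_normOne (hM : 0 < M) (hWM : W ⊆ exterior M) {η : OneForm}
    (hη : ∀ i, ContinuousOn (fun p => η p i) W) : ContinuousOn (fun p => normOne p (η p)) W := by
  have hr : ContinuousOn rad W := ((contDiffOn_rad hM).mono hWM).continuousOn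
  have hrot : ∀ a i, ContinuousOn (fun p => rot a p i / rad p) W := fun a i =>
    (((continuous_apply i).comp (contDiff_rot a).continuous).continuousOn).div hr
      fun p hp => (rad_pos hM (hWM hp)).ne'
  unfold normOne
  exact continuousOn_finsetSum _ fun a _ => ContinuousOn.abs
    (continuousOn_finsetSum _ fun i _ => (hη i).mul (hrot a i))

theorem continuousOn_normTwo (hM : 0 < M) (hWM : W ⊆ exterior M) {T : TwoTensor}
    (hT : ∀ i j, ContinuousOn (fun p => T p i j) W) :
    ContinuousOn (fun p => normTwo p (T p)) W := by
  have hr : ContinuousOn rad W := ((contDiffOn_rad hM).mono hWM).continuousOn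
  have hrot : ∀ a i, ContinuousOn (fun p => rot a p i / rad p) W := fun a i =>
    (((continuous_apply i).comp (contDiff_rot a).continuous).continuousOn).div hr
      fun p hp => (rad_pos hM (hWM hp)).ne'
  unfold normTwo
  exact continuousOn_finsetSum _ fun a _ => continuousOn_finsetSum _ fun b _ => ContinuousOn.abs
    (continuousOn_finsetSum _ fun i _ => continuousOn_finsetSum _ fun j _ =>
      ((hT i j).mul (hrot a i)).mul (hrot b j))

theorem TangentialOn.continuousOn_slashGrad (h : TangentialOn M φ W) (i j : Fin 4) :
    ContinuousOn (fun p => slashGrad M φ p i j) W := by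
  have hr : ContinuousOn rad W := ((contDiffOn_rad h.pos).mono h.subset).continuousOn
  have hr0 : ∀ p ∈ W, rad p ≠ 0 := fun p hp => (h.rad_pos hp).ne'
  have hdr : ∀ k, ContinuousOn (fun p => dr p k) W := fun k =>
    (contDiffOn_pi.1 ((contDiffOn_dr h.pos).mono h.subset) k).continuousOn
  have hpd : ∀ k, ContinuousOn (pd k fun q => φ q j) W := fun k =>
    (contDiffOn_der h.isOpen (X := fun _ => Pi.single k 1) contDiffOn_const
      (h.smooth j)).continuousOn
  have hder : ContinuousOn (der dr fun q => φ q j) W :=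
    (contDiffOn_der h.isOpen ((contDiffOn_dr h.pos).mono h.subset) (h.smooth j)).continuousOn
  refine ContinuousOn.congr ?_ fun p hp =>
    slashGrad_eq h.pos h.isOpen h.subset h.smooth h.isTangent hp i j
  exact (((hpd i).sub (continuousOn_const.mul (hpd 0))).sub ((hdr i).mul hder)).add
    ((hdr j).mul ((h.smooth i).continuousOn.div hr hr0))

theorem TangentialOn.continuousOn_angularDensity (h : TangentialOn M φ W) :
    ContinuousOn (angularDensity M φ) W := by
  have hmu : ContinuousOn (mu M) W := ((contDiffOn_mu h.pos).mono h.subset).continuousOn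
  have hr : ContinuousOn rad W := ((contDiffOn_rad h.pos).mono h.subset).continuousOn
  have hr0 : ∀ p ∈ W, rad p ^ 2 ≠ 0 := fun p hp => pow_ne_zero 2 (h.rad_pos hp).ne'
  have h1 := continuousOn_normTwo h.pos h.subset h.continuousOn_slashGrad
  have h2 := continuousOn_normOne h.pos h.subset fun i => (h.smooth i).continuousOn
  exact ((continuousOn_const.sub hmu).mul (h1.pow 2)).add
    (((continuousOn_const.sub hmu).div (hr.pow 2) hr0).mul (h2.pow 2))

theorem TangentialOn.continuousOn_fluxDensity_L (h : TangentialOn M φ W) :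
    ContinuousOn (fun p => normOne p (slashAlong M (L M) φ p) ^ 2 + angularDensity M φ p) W := by
  refine ContinuousOn.add ((continuousOn_normOne h.pos h.subset fun i => ?_).pow 2)
    h.continuousOn_angularDensity
  exact (h.smooth_L i).continuousOn.congr fun p hp => by rw [h.slashAlong_L hp]

theorem TangentialOn.continuousOn_fluxDensity_Lbar (h : TangentialOn M φ W) :
    ContinuousOn (fun p => normOne p (slashAlong M (Lbar M) φ p) ^ 2 + angularDensity M φ p)
      W := by
  refine ContinuousOn.add ((continuousOn_normOne h.pos h.subset fun i => ?_).pow 2)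
    h.continuousOn_angularDensity
  exact (h.smooth_Lbar i).continuousOn.congr fun p hp => by rw [h.slashAlong_Lbar hp]

theorem integral_cone_le {a b c : ℝ} (hab : a ≤ b) {F G : ℝ → S2 → ℝ}
    (hF : ContinuousOn (uncurry F) (Icc a b ×ˢ univ))
    (hG : ContinuousOn (uncurry G) (Icc a b ×ˢ univ))
    (hFG : ∀ x ∈ Icc a b, ∀ ω, F x ω ≤ c * G x ω) :
    ∫ x in a..b, ∫ ω, F x ω ∂dS2 ≤ c * ∫ x in a..b, ∫ ω, G x ω ∂dS2 := by
  have h := integral_cone_mono hab hF (G := fun x ω => c * G x ω) (continuousOn_const.mul hG) hFG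
  simpa only [integral_const_mul, intervalIntegral.integral_const_mul] using h

/-- The Morawetz estimate on a null rectangle on which the equation holds. -/
theorem TangentialOn.morawetz_estimate (h : TangentialOn M φ W) {u₁ u₂ v₁ v₂ : ℝ} (hu : u₁ ≤ u₂)
    (hv : v₁ ≤ v₂) (hpt : ∀ u ∈ Icc u₁ u₂, ∀ v ∈ Icc v₁ v₂, ∀ ω, pt M u v ω ∈ W)
    (hFI : ∀ u ∈ Icc u₁ u₂, ∀ v ∈ Icc v₁ v₂, ∀ ω, FackerellIpserAt M φ (pt M u v ω)) :
    ∫ u in u₁..u₂, ∫ v in v₁..v₂, ∫ ω,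
        morawetzDensity M φ (pt M u v ω) * (1 - mu M (pt M u v ω)) ∂dS2
      ≤ 3840 * (1 / M + 1) * (fluxV M φ v₁ u₁ u₂ + fluxU M φ u₁ v₁ v₂) := by
  have hM := h.pos
  have hu₁ : u₁ ∈ Icc u₁ u₂ := left_mem_Icc.2 hu
  have hu₂ : u₂ ∈ Icc u₁ u₂ := right_mem_Icc.2 hu
  have hv₁ : v₁ ∈ Icc v₁ v₂ := left_mem_Icc.2 hv
  have hv₂ : v₂ ∈ Icc v₁ v₂ := right_mem_Icc.2 hv
  -- continuity on the outgoing cone `u` and on the ingoing cone `v`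
  have cU : ∀ {F : Pt → ℝ}, ContinuousOn F W → ∀ u ∈ Icc u₁ u₂,
      ContinuousOn (uncurry fun v ω => F (pt M u v ω)) (Icc v₁ v₂ ×ˢ univ) := fun hF u hu' =>
    continuousOn_pt_v hM hF (hpt u hu')
  have cV : ∀ {F : Pt → ℝ}, ContinuousOn F W → ∀ v ∈ Icc v₁ v₂,
      ContinuousOn (uncurry fun u ω => F (pt M u v ω)) (Icc u₁ u₂ ×ˢ univ) := fun hF v hv' =>
    continuousOn_pt_u hM hF fun u hu' => hpt u hu' v hv'
  have hcons := integral_divergence hM hu hv h.isOpen h.subset hpt h.smooth_energyL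
    h.smooth_energyLbar h.smooth_energyAngular (B := fun _ => 0)
    fun u hu' v hv' ω => (h.divergence_energy (hpt u hu' v hv' ω) (hFI u hu' v hv' ω)).symm
  have hmor := integral_divergence hM hu hv h.isOpen h.subset hpt h.smooth_morawetzL
    h.smooth_morawetzLbar h.smooth_morawetzAngular (B := fun p => -(morawetzBulk M φ p) / M)
    fun u hu' v hv' ω => h.divergence_morawetz (hpt u hu' v hv' ω) (hFI u hu' v hv' ω)
  simp only [integral_zero, intervalIntegral.integral_zero] at hcons
  -- The bulk term is written as a multiple of the divergence of the Morawetz current.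
  have hbulk := integral_rectangle_mono_of_nonneg hu hv
    (F := fun u v ω => morawetzDensity M φ (pt M u v ω) * (1 - mu M (pt M u v ω)))
    (G := fun u v ω => (-(60 * (1 / M ^ 3 + 1 / M ^ 2)))
      * (-(morawetzBulk M φ (pt M u v ω)) / M))
    (fun u hu' v hv' ω => morawetzDensity_nonneg hM (h.subset (hpt u hu' v hv' ω)))
    (fun u hu' v hv' ω => (h.morawetzDensity_le (hpt u hu' v hv' ω)).trans (le_of_eq (by
      field_simp)))
    (continuousOn_const.mul (continuousOn_pt hM
      ((h.continuousOn_morawetzBulk.neg).div_const M) hpt))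
  simp only [integral_const_mul, intervalIntegral.integral_const_mul] at hbulk
  rw [hmor] at hbulk
  -- the flux of the Morawetz current through a cone is bounded by the energy flux
  have hL : ∀ u ∈ Icc u₁ u₂, |∫ v in v₁..v₂, ∫ ω, morawetzL M φ (pt M u v ω) ∂dS2|
      ≤ 16 * ∫ v in v₁..v₂, ∫ ω, energyL M φ (pt M u v ω) ∂dS2 := by
    intro u hu'
    have h1 := fun v (hv' : v ∈ Icc v₁ v₂) ω =>
      abs_le.1 (h.abs_morawetzL_le (hpt u hu' v hv' ω))
    have cm := cU h.smooth_morawetzL.continuousOn u hu'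
    have ce := cU h.smooth_energyL.continuousOn u hu'
    rw [abs_le]
    refine ⟨?_, integral_cone_le hv cm ce fun v hv' ω => (h1 v hv' ω).2⟩
    have := integral_cone_le (c := 16) hv (F := fun v ω => -morawetzL M φ (pt M u v ω)) cm.neg ce
      fun v hv' ω => by linarith [(h1 v hv' ω).1]
    simp only [integral_neg, intervalIntegral.integral_neg] at this
    linarith
  have hLbar : ∀ v ∈ Icc v₁ v₂, |∫ u in u₁..u₂, ∫ ω, morawetzLbar M φ (pt M u v ω) ∂dS2|
      ≤ 16 * ∫ u in u₁..u₂, ∫ ω, energyLbar M φ (pt M u v ω) ∂dS2 := by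
    intro v hv'
    have h1 := fun u (hu' : u ∈ Icc u₁ u₂) ω =>
      abs_le.1 (h.abs_morawetzLbar_le (hpt u hu' v hv' ω))
    have cm := cV h.smooth_morawetzLbar.continuousOn v hv'
    have ce := cV h.smooth_energyLbar.continuousOn v hv'
    rw [abs_le]
    refine ⟨?_, integral_cone_le hu cm ce fun u hu' ω => (h1 u hu' ω).2⟩
    have := integral_cone_le (c := 16) hu (F := fun u ω => -morawetzLbar M φ (pt M u v ω)) cm.neg ce
      fun u hu' ω => by linarith [(h1 u hu' ω).1]
    simp only [integral_neg, intervalIntegral.integral_neg] at this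
    linarith
  have fU : ∫ v in v₁..v₂, ∫ ω, energyL M φ (pt M u₁ v ω) ∂dS2 ≤ M ^ 2 * fluxU M φ u₁ v₁ v₂ :=
    integral_cone_le hv (cU h.smooth_energyL.continuousOn u₁ hu₁)
      (cU h.continuousOn_fluxDensity_L u₁ hu₁) fun v hv' ω => h.energyL_le (hpt u₁ hu₁ v hv' ω)
  have fV : ∫ u in u₁..u₂, ∫ ω, energyLbar M φ (pt M u v₁ ω) ∂dS2 ≤ M ^ 2 * fluxV M φ v₁ u₁ u₂ :=
    integral_cone_le hu (cV h.smooth_energyLbar.continuousOn v₁ hv₁)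
      (cV h.continuousOn_fluxDensity_Lbar v₁ hv₁)
      fun u hu' ω => h.energyLbar_le (hpt u hu' v₁ hv₁ ω)
  have a1 := abs_le.1 (hL u₁ hu₁)
  have a2 := abs_le.1 (hL u₂ hu₂)
  have a3 := abs_le.1 (hLbar v₁ hv₁)
  have a4 := abs_le.1 (hLbar v₂ hv₂)
  refine hbulk.trans ?_
  set EU₁ := ∫ v in v₁..v₂, ∫ ω, energyL M φ (pt M u₁ v ω) ∂dS2
  set EU₂ := ∫ v in v₁..v₂, ∫ ω, energyL M φ (pt M u₂ v ω) ∂dS2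
  set EV₁ := ∫ u in u₁..u₂, ∫ ω, energyLbar M φ (pt M u v₁ ω) ∂dS2
  set EV₂ := ∫ u in u₁..u₂, ∫ ω, energyLbar M φ (pt M u v₂ ω) ∂dS2
  set PU₁ := ∫ v in v₁..v₂, ∫ ω, morawetzL M φ (pt M u₁ v ω) ∂dS2
  set PU₂ := ∫ v in v₁..v₂, ∫ ω, morawetzL M φ (pt M u₂ v ω) ∂dS2
  set PV₁ := ∫ u in u₁..u₂, ∫ ω, morawetzLbar M φ (pt M u v₁ ω) ∂dS2
  set PV₂ := ∫ u in u₁..u₂, ∫ ω, morawetzLbar M φ (pt M u v₂ ω) ∂dS2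
  set FU := fluxU M φ u₁ v₁ v₂
  set FV := fluxV M φ v₁ u₁ u₂
  have hK : 0 ≤ 60 * (1 / M ^ 3 + 1 / M ^ 2) := by positivity
  -- Energy conservation `hcons` bounds the future fluxes `EU₂ + EV₂` by `EU₁ + EV₁`.
  have hbd : -(2 * (PU₂ - PU₁) + 2 * (PV₂ - PV₁)) ≤ 64 * (M ^ 2 * (FV + FU)) := by linarith
  calc _ = 60 * (1 / M ^ 3 + 1 / M ^ 2) * -(2 * (PU₂ - PU₁) + 2 * (PV₂ - PV₁)) := by ring
    _ ≤ 60 * (1 / M ^ 3 + 1 / M ^ 2) * (64 * (M ^ 2 * (FV + FU))) :=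
        mul_le_mul_of_nonneg_left hbd hK
    _ = _ := by
        field_simp
        ring

end Integration

end

end FackerellIpser

theorem mainTheorem5 (M : ℝ) (hM : 0 < M) :
    ∃ C : ℝ, 0 < C ∧
      ∀ (u₀ v₀ : ℝ) (W : Set FackerellIpser.Pt) (φ : FackerellIpser.OneForm),
        IsOpen W → W ⊆ FackerellIpser.exterior M → FackerellIpser.region M u₀ v₀ ⊆ W →
        FackerellIpser.IsSmoothSphereForm M φ W →
        (∀ p ∈ FackerellIpser.region M u₀ v₀, FackerellIpser.FackerellIpserAt M φ p) →
        ∀ u₁ u₂ v₁ v₂ : ℝ, u₀ ≤ u₁ → u₁ ≤ u₂ → v₀ ≤ v₁ → v₁ ≤ v₂ →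
          (∫ u in u₁..u₂, ∫ v in v₁..v₂, ∫ ω : FackerellIpser.S2,
              FackerellIpser.morawetzDensity M φ (FackerellIpser.pt M u v ω) *
                (1 - FackerellIpser.mu M (FackerellIpser.pt M u v ω)) ∂FackerellIpser.dS2)
            ≤ C * (FackerellIpser.fluxV M φ v₁ u₁ u₂ + FackerellIpser.fluxU M φ u₁ v₁ v₂) := by
  refine ⟨3840 * (1 / M + 1), by positivity, ?_⟩
  intro u₀ v₀ W φ hW hWM hreg hφ hFI u₁ u₂ v₁ v₂ hu₀ hu hv₀ hv
  have hpt : ∀ u ∈ Set.Icc u₁ u₂, ∀ v ∈ Set.Icc v₁ v₂, ∀ ω,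
      FackerellIpser.pt M u v ω ∈ FackerellIpser.region M u₀ v₀ := fun u hu' v hv' ω =>
    FackerellIpser.pt_mem_region hM (hu₀.trans hu'.1) (hv₀.trans hv'.1) ω
  have h : FackerellIpser.TangentialOn M φ W :=
    ⟨hM, hW, hWM, fun j => contDiffOn_pi.1 hφ.smooth j, fun p hp => hφ.isTangent hM hWM hp⟩
  exact h.morawetz_estimate hu hv (fun u hu' v hv' ω => hreg (hpt u hu' v hv' ω))
    fun u hu' v hv' ω => hFI _ (hpt u hu' v hv' ω)
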